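/- **Notation.** For a positive integer $N$ put $w(N)=\tfrac12\log\log N$, $W=\prod_{p\le w(N)}p$, and, for a fixed parameter $C_1>1$, $\overline W=\prod_{p\le w(N)}p^{\lfloor C_1\log_p(\log N)\rfloor}$. For $\gamma>0$ let $$\tilde\tau'_\gamma(n)=\frac{W}{\phi(W)}\,\frac{1}{\gamma\log N}\sum_{d\le N^\gamma,\ (d,W)=1}1_{d\mid n}.$$ For non-negative integers $i,s$ let $m_0(i,s)=\lceil \gamma s(i+3-\log_2 s)/100\rceil$ and let $U(i,s)$ be the set of all products of $m_0(i,s)$ distinct primes from $[N^{1/2^{i+1}},N^{1/2^i}]$. The $W$-tricked majorant $\nu'=\nu'_{\gamma,N}$ is $$C'\nu'(n)=2^{2/\gamma}\,\tilde\tau'_\gamma(n)+\sum_{2/\gamma<s\le(\log\log N)^3}\ \sum_{\log_2 s-2\le i\le 6\log\log\log N}\ \sum_{u\in U(i,s)}2^s\,1_{u\mid n}\,\tilde\tau'_\gamma(n),$$ where $s,i$ run over integers and $C'$ (a constant depending on $\gamma$, possibly varying with $N$) is any normalisation for which $\mathbb E_{n\le N}\nu'(n)=1+o(1)$ as $N\to\infty$.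 An affine-linear form on $\mathbb Z^d$ is $\psi(n)=\sum_k a_kn_k+c$ with $a_k,c\in\mathbb Z$; its linear part is $\dot\psi(n)=\sum_k a_kn_k$. Two forms are affinely related modulo a prime $p$ if their linear parts are linearly dependent modulo $p$. A prime $p$ is exceptional for $\Psi=(\psi_1,\dots,\psi_t)$ if two forms $\psi_i,\psi_j$ with $i\neq j$ are affinely related modulo $p$, or if some $\psi_i$ is constant modulo $p$ (the second condition is implied by the first when $t\ge2$). The system $\Psi$ has finite complexity if no $\psi_i$ is constant and no two of the linear parts $\dot\psi_i,\dot\psi_j$, $i\ne j$, are linearly dependent over $\mathbb Q$. A convex body is a bounded convex set with non-empty interior, and $\mathbb E_{n\in\mathbb Z^d\cap K}$ is the average over the lattice points of $K$ (read as $0$ if there are none). **Proposition.** Let $D\ge1$. There are constants $A,B$ and $\gamma_0>0$ depending only on $D$ such that for every $0<\gamma\le\gamma_0$ and every normalisation $C'$ as above the following hold. The terms $o(1)$ are for $N\to\infty$, may depend on $D$, $\gamma$, $C'$ (and in (2), (3) on $C_1$, in (3) also on $c$), and are otherwise uniform in all the data. 1. Let $1\le d,t\le D$ and let $\Psi:\mathbb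 Z^d\to\mathbb Z^t$ be a system of affine-linear forms all of whose exceptional primes are at most $w(N)$ (no bound on the coefficients is assumed). Then for every convex body $K\subseteq[-N,N]^d$ with $\Psi(K)\subseteq[1,N]^t$, $$\Big|\mathbb E_{n\in\mathbb Z^d\cap K}\prod_{j=1}^t\nu'(\psi_j(n))-1\Big|\le B\,\frac{N^{d-1+A\gamma}}{\mathrm{vol}(K)}+o(1).$$ 2. ($D$-linear forms estimate.) Let $C_1>1$, $M=N/\overline W$ and $1\le d,t\le D$. Let $b_1,\dots,b_t\in\{1,\dots,\overline W\}$, $(i_1,\dots,i_t)\in\{1,\dots,t\}^t$, and let $\Psi:\mathbb Z^d\to\mathbb Z^t$ be a finite complexity system of affine-linear forms whose linear coefficients are bounded by $D$ in absolute value. Then for every convex body $K\subseteq[-M,M]^d$ with $\overline W\Psi(K)+(b_{i_1},\dots,b_{i_t})\subseteq[1,N]^t$, $$\Big|\mathbb E_{n\in\mathbb Z^d\cap K}\prod_{j=1}^t\nu'(\overline W\psi_j(n)+b_{i_j})-1\Big|\le B\,\frac{N^{d-1+A\gamma}}{\mathrm{vol}(K)}+o(1).$$ 3. (Green–Tao linear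 forms condition.) Let $C_1>1$, $M=N/\overline W$, let $c$ be a constant, let $M'$ be a prime with $M<M'\le cM$, let $r\ge1$ and $b_1,\dots,b_r\in\{1,\dots,\overline W\}$. Define $\nu^*$ on $\mathbb Z/M'\mathbb Z$, identified with $\{1,\dots,M'\}$, by $\nu^*(n)=\tfrac12\big(1+\tfrac1r\sum_{i=1}^r\nu'(\overline Wn+b_i)\big)$ for $n\le M$ and $\nu^*(n)=1$ for $M<n\le M'$. Then for all $1\le d,t\le D$ and every finite complexity system $\Psi:\mathbb Z^d\to\mathbb Z^t$ of affine-linear forms whose linear coefficients are bounded by $D$ in absolute value, $$\mathbb E_{n\in(\mathbb Z/M'\mathbb Z)^d}\prod_{j=1}^t\nu^*(\psi_j(n))=1+o(1).$$ -/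

import Mathlib

open MeasureTheory Filter Topology

noncomputable section

namespace DivisorMajorant

/-! ### Affine-linear forms -/

/-- An affine-linear form `n ↦ ∑ k, coeff k * n k + const` on `ℤ^d`. -/
structure AffineForm (d : ℕ) where
  /-- the coefficients of the linear part -/
  coeff : Fin d → ℤ
  /-- the constant term -/
  const : ℤ

/-- The value of the form at a point of `R^d`; used with `R = ℤ`, `R = ℝ` and `R = ZMod M`. -/
def AffineForm.eval {d : ℕ} {R : Type*} [CommRing R] (ψ : AffineForm d) (x : Fin d → R) : R :=
  ∑ k, (ψ.coeff k : R) * x k + (ψ.const : R)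

/-- The linear parts of `φ` and `ψ` are linearly dependent modulo `p`. -/
def AffinelyRelatedMod {d : ℕ} (p : ℕ) (φ ψ : AffineForm d) : Prop :=
  ∃ a b : ZMod p, (a ≠ 0 ∨ b ≠ 0) ∧
    ∀ k, a * (φ.coeff k : ZMod p) + b * (ψ.coeff k : ZMod p) = 0

/-- `ψ` is constant modulo `p`. -/
def ConstantMod {d : ℕ} (p : ℕ) (ψ : AffineForm d) : Prop :=
  ∀ k, (ψ.coeff k : ZMod p) = 0

/-- Exceptional primes of a system. The second alternative is a special case of the first
one as soon as there are at least two forms; it only matters for a single form. -/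
def IsExceptional {d t : ℕ} (Ψ : Fin t → AffineForm d) (p : ℕ) : Prop :=
  (∃ i j, i ≠ j ∧ AffinelyRelatedMod p (Ψ i) (Ψ j)) ∨ ∃ i, ConstantMod p (Ψ i)

/-- No form is constant, and no two forms have linearly dependent (over `ℚ`, equivalently
over `ℤ`) linear parts. -/
def FiniteComplexity {d t : ℕ} (Ψ : Fin t → AffineForm d) : Prop :=
  (∀ i, (Ψ i).coeff ≠ 0) ∧
    ∀ i j, i ≠ j → ∀ a b : ℤ,
      (∀ k, a * (Ψ i).coeff k + b * (Ψ j).coeff k = 0) → a = 0 ∧ b = 0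

/-! ### Convex bodies and averages over their lattice points -/

/-- Convex bodies; they need not be closed. -/
def IsConvexBody {d : ℕ} (K : Set (Fin d → ℝ)) : Prop :=
  Convex ℝ K ∧ Bornology.IsBounded K ∧ (interior K).Nonempty

/-- `ℤ^d ∩ K`. -/
def latticePoints {d : ℕ} (K : Set (Fin d → ℝ)) : Set (Fin d → ℤ) :=
  {n | (fun k => (n k : ℝ)) ∈ K}

/-- The average of `f` over the (finitely many) points of `ℤ^d ∩ K`. -/
def latticeAverage {d : ℕ} (K : Set (Fin d → ℝ)) (f : (Fin d → ℤ) → ℝ) : ℝ :=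
  (∑ᶠ n ∈ latticePoints K, f n) / (latticePoints K).ncard

/-! ### The majorant -/

/-- `w(N) = (1/2) log log N`. -/
def w (N : ℕ) : ℝ := Real.log (Real.log N) / 2

/-- `W`, the product of the primes `p ≤ w(N)`. -/
def W (N : ℕ) : ℕ := primorial ⌊w N⌋₊

/-- The product over the primes `p ≤ w(N)` of `p ^ ⌊C₁ log_p (log N)⌋`. -/
def Wbar (C₁ : ℝ) (N : ℕ) : ℕ :=
  ∏ p ∈ (Finset.range (⌊w N⌋₊ + 1)).filter Nat.Prime,
    p ^ ⌊C₁ * Real.logb p (Real.log N)⌋₊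

/-- The `W`-tricked normalised truncated divisor function: it counts the divisors
`d ≤ N ^ γ` of `n` that are coprime to `W`. -/
def truncTau (γ : ℝ) (N : ℕ) (n : ℤ) : ℝ :=
  (W N : ℝ) / (Nat.totient (W N) : ℝ) * (γ * Real.log N)⁻¹ *
    (((Finset.Icc 1 ⌊(N : ℝ) ^ γ⌋₊).filter
      (fun d : ℕ => Nat.Coprime d (W N) ∧ (d : ℤ) ∣ n)).card : ℝ)

/-- The primes in the interval `[N^(1/2^(i+1)), N^(1/2^i)]`. -/
def dyadicPrimes (N i : ℕ) : Finset ℕ :=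
  (Finset.range (N + 1)).filter (fun p => p.Prime ∧
    (N : ℝ) ^ ((1 : ℝ) / 2 ^ (i + 1)) ≤ p ∧ (p : ℝ) ≤ (N : ℝ) ^ ((1 : ℝ) / 2 ^ i))

/-- `m₀(i, s) = ⌈γ s (i + 3 - log₂ s) / 100⌉`. -/
def m₀ (γ : ℝ) (i s : ℕ) : ℕ := ⌈γ * s * (i + 3 - Real.logb 2 s) / 100⌉₊

/-- `U(i, s)`: the products of `m₀(i, s)` distinct primes from `dyadicPrimes N i`. -/
def U (γ : ℝ) (N i s : ℕ) : Finset ℕ :=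
  ((dyadicPrimes N i).powersetCard (m₀ γ i s)).image (fun S => ∏ p ∈ S, p)

/-- The unnormalised majorant `C' ν'`. The first summand is the contribution of `s = 2/γ`,
where `U(i, s)` is `{1}` for exactly one `i` and empty otherwise. For `γ ≤ 1/2` every
`s > 2/γ` has `log₂ s - 2 > 0`, so that the index `i` is a natural number. -/
def nuSum (γ : ℝ) (N : ℕ) (n : ℤ) : ℝ :=
  (2 : ℝ) ^ (2 / γ) * truncTau γ N n +
    ∑ s ∈ Finset.Ioc ⌊2 / γ⌋₊ ⌊Real.log (Real.log N) ^ 3⌋₊,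
      ∑ i ∈ Finset.Icc ⌈Real.logb 2 s - 2⌉₊ ⌊6 * Real.log (Real.log (Real.log N))⌋₊,
        ∑ u ∈ U γ N i s,
          (2 : ℝ) ^ s * (if (u : ℤ) ∣ n then 1 else 0) * truncTau γ N n

/-- The majorant `ν'` at level `N`, with normalising constant `C' = C N`. -/
def nu (γ : ℝ) (C : ℕ → ℝ) (N : ℕ) (n : ℤ) : ℝ := nuSum γ N n / C N

/-- `C` is a choice of normalising constants: the average of `ν'` over `[N]` is `1 + o(1)`.
(A constant independent of `N` is a constant function `C`.) -/
def IsNormalising (γ : ℝ) (C : ℕ → ℝ) : Prop :=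
  Tendsto (fun N : ℕ => (∑ n ∈ Finset.Icc 1 N, nu γ C N (n : ℤ)) / (N : ℝ)) atTop (𝓝 1)

lemma truncTau_nonneg {γ : ℝ} (hγ : 0 < γ) (N : ℕ) (n : ℤ) : 0 ≤ truncTau γ N n := by
  have : 0 ≤ Real.log N := Real.log_natCast_nonneg N
  unfold truncTau
  positivity

lemma truncTau_pos {γ : ℝ} (hγ : 0 < γ) {N : ℕ} (hN : 2 ≤ N) (n : ℤ) :
    0 < truncTau γ N n := by
  have hlog : 0 < Real.log N := Real.log_pos (by exact_mod_cast hN)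
  have hW : 0 < W N := primorial_pos _
  have hφ : 0 < Nat.totient (W N) := Nat.totient_pos.2 hW
  have h1 : 1 ∈ (Finset.Icc 1 ⌊(N : ℝ) ^ γ⌋₊).filter
      (fun d : ℕ => Nat.Coprime d (W N) ∧ (d : ℤ) ∣ n) := by
    simp only [Finset.mem_filter, Finset.mem_Icc, le_refl, true_and, Nat.coprime_one_left_eq_true,
      Nat.cast_one, one_dvd, and_true]
    exact Nat.le_floor (by
      simpa using Real.one_le_rpow (by exact_mod_cast (by omega : 1 ≤ N)) hγ.le)
  have hc := Finset.card_pos.2 ⟨1, h1⟩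
  unfold truncTau
  positivity

lemma nuSum_pos {γ : ℝ} (hγ : 0 < γ) {N : ℕ} (hN : 2 ≤ N) (n : ℤ) : 0 < nuSum γ N n := by
  have h := truncTau_pos hγ hN n
  unfold nuSum
  refine add_pos_of_pos_of_nonneg (by positivity) ?_
  refine Finset.sum_nonneg fun s _ => Finset.sum_nonneg fun i _ => Finset.sum_nonneg fun u _ => ?_
  split_ifs <;> simp [h.le]

/-- Normalising constants exist. -/
theorem exists_isNormalising {γ : ℝ} (hγ : 0 < γ) : ∃ C : ℕ → ℝ, IsNormalising γ C := by
  refine ⟨fun N => (∑ n ∈ Finset.Icc 1 N, nuSum γ N (n : ℤ)) / (N : ℝ), ?_⟩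
  refine (tendsto_congr' ?_).2 tendsto_const_nhds
  filter_upwards [eventually_ge_atTop 2] with N hN
  have hS : 0 < ∑ n ∈ Finset.Icc 1 N, nuSum γ N (n : ℤ) :=
    Finset.sum_pos (fun n _ => nuSum_pos hγ hN n) ⟨1, by simp; omega⟩
  have hN' : (0 : ℝ) < N := by positivity
  simp only [nu]
  rw [← Finset.sum_div]
  field_simp

/-- The majorant `ν*` on `ℤ/M'ℤ`, identified with `{1, …, M'}`, that belongs to the residues
`b`: it is `(1 + 𝔼_i ν'(Wbar n + b i)) / 2` for `1 ≤ n ≤ M = N / Wbar` and `1` elsewhere. -/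
def nuStar (γ : ℝ) (C : ℕ → ℝ) (C₁ : ℝ) (N : ℕ) {r : ℕ} (b : Fin r → ℕ) (M' : ℕ)
    (x : ZMod M') : ℝ :=
  if 1 ≤ x.val ∧ (x.val : ℝ) ≤ (N : ℝ) / Wbar C₁ N then
    (1 + (∑ i, nu γ C N ((Wbar C₁ N : ℤ) * (x.val : ℤ) + (b i : ℤ))) / (r : ℝ)) / 2
  else 1

end DivisorMajorant

end

/-!
The majorant is a nonnegative combination `∑ c_q 1_{q ∣ n}` over moduli `q = lcm(u, d)` that are
at most `N ^ (4 γ)` and composed of primes in `(w(N), N]`. Its mean value over `[N]` is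
`meanSum = ∑ c_q / q` up to a negligible error, so that every normalising constant is asymptotic
to `meanSum` (`IsNormalising.tendsto_meanSum_div`). The point is that `∏ ν'(ψ_j(n))` has mean value
asymptotic to `(meanSum / C N) ^ t`, that is, that the divisibility conditions for different forms
are independent on average.

Expanding the product, one has to count the `n` in a convex set with `q_j ∣ ψ_j(n)` for all `j`.
Since the lattice points of a convex set are equidistributed modulo small numbers
(`abs_ncard_latticePoints_sub_volume_le`, `abs_card_filter_dvd_sub_le`), this is a volume times the
density of the condition, with an error `N ^ (d - 1 + O(γ))`. If every prime divides at most two of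
the `q_j`, the density is *exactly* `∏ 1 / q_j`: modulo an unexceptional prime any two linear parts
are jointly surjective, and this lifts to all moduli (`linearParts_surjective`). At a prime
dividing several of the `q_j`, all but two of the conditions are dropped; the resulting bound for
the density gains `p⁻²` and decays geometrically in the exponents (`abs_residueCount_div_sub_le`).

Hence only tuples in which two of the moduli share a prime `p > w(N)` contribute to the error. Their
total weight is bounded by an Euler product (`sum_colliding_le`). Rankin's trick relaxes the number
of prime factors of `u ∈ U(i, s)`: a factor `R ^ ω(u)` is inserted, the `m₀(i, s)` factors `R⁻¹`
beat the coefficients `2 ^ s`, and the primes of `U(i, s)` only contribute a bounded factor as the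
sum of their reciprocals is bounded. The Euler factors of the variables `d` are compensated by the
normalisation of `truncTau`, by Mertens-type bounds. What remains is
`O(∑_{p > w(N)} p⁻²) = O(1 / w(N))`. This gives `eventually_abs_sum_prod_nu_sub_le`, for convex sets
of any shape and systems without any bound on the coefficients.

A system of finite complexity with bounded coefficients has boundedly many exceptional primes;
restricted to a progression modulo `Wbar` it acquires only the primes dividing `Wbar`, all of which
are at most `w(N)`. So the estimate along the progression is a special case. For the cyclic group
`ℤ/M'ℤ`, the box `{0, …, M' - 1} ^ d` is cut into boundedly many convex pieces on which every form
wraps around a constant number of times and its representative lies on one side of `N / Wbar`; on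
each piece the product of the `ν*` is a convex combination of products of values of `ν'`
(`abs_sum_prod_nuStar_sub_le`).
-/


namespace DivisorMajorant

/-! ### Prime sums in the style of Mertens -/

/-- The upper half of Mertens' first theorem: compare `n!` with its divisor `∏ p ^ (n / p)`. -/
theorem sum_log_div_primesLE_le {n : ℕ} (hn : 1 ≤ n) :
    ∑ p ∈ n.primesLE, Real.log p / p ≤ Real.log n + Real.log 4 := by
  have hn0 : (0 : ℝ) < n := by exact_mod_cast hn
  have hdvd : ∏ p ∈ n.primesLE, p ^ (n / p) ∣ n.factorial := by
    refine Finset.prod_dvd_of_isRelPrime ?_ ?_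
    · intro p hp q hq hpq
      refine Nat.coprime_iff_isRelPrime.1 (Nat.Coprime.pow _ _ ?_)
      exact (Nat.coprime_primes (Nat.prime_of_mem_primesLE hp)
        (Nat.prime_of_mem_primesLE hq)).2 hpq
    · intro p hp
      have hpp := Nat.prime_of_mem_primesLE hp
      refine dvd_trans ?_ (Nat.factorial_dvd_factorial (Nat.mul_div_le n p))
      rw [hpp.pow_dvd_iff_le_factorization (Nat.factorial_ne_zero _),
        Nat.factorization_factorial_mul hpp]
      omega
  have h1 : ∑ p ∈ n.primesLE, ((n / p : ℕ) : ℝ) * Real.log p ≤ n * Real.log n := by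
    have h2 : ((∏ p ∈ n.primesLE, p ^ (n / p) : ℕ) : ℝ) ≤ (n : ℝ) ^ n := by
      exact_mod_cast (Nat.le_of_dvd (Nat.factorial_pos n) hdvd).trans (Nat.factorial_le_pow n)
    have h3 : (0 : ℝ) < ((∏ p ∈ n.primesLE, p ^ (n / p) : ℕ) : ℝ) := by
      exact_mod_cast Finset.prod_pos fun p hp =>
        pow_pos (Nat.prime_of_mem_primesLE hp).pos _
    have h4 := Real.log_le_log h3 h2
    rw [Real.log_pow, Nat.cast_prod, Real.log_prod] at h4
    · simpa [Real.log_pow] using h4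
    · intro p hp
      have := (Nat.prime_of_mem_primesLE hp).pos
      positivity
  have hθ : ∑ p ∈ n.primesLE, Real.log p ≤ Real.log 4 * n := by
    rw [← Chebyshev.theta_eq_sum_primesLE_log]
    exact Chebyshev.theta_le_log4_mul_x hn0.le
  have h5 : (n : ℝ) * ∑ p ∈ n.primesLE, Real.log p / p ≤ n * (Real.log n + Real.log 4) := by
    calc (n : ℝ) * ∑ p ∈ n.primesLE, Real.log p / p
        = ∑ p ∈ n.primesLE, ((n : ℝ) / p) * Real.log p := by
          rw [Finset.mul_sum]; exact Finset.sum_congr rfl fun p _ => by ring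
      _ ≤ ∑ p ∈ n.primesLE, (((n / p : ℕ) : ℝ) * Real.log p + Real.log p) := by
          refine Finset.sum_le_sum fun p hp => ?_
          have hpp := Nat.prime_of_mem_primesLE hp
          have hlog : 0 ≤ Real.log p := Real.log_natCast_nonneg p
          have : (n : ℝ) / p ≤ ((n / p : ℕ) : ℝ) + 1 := by
            rw [← Nat.floor_div_eq_div (K := ℝ)]
            exact (Nat.lt_floor_add_one _).le
          nlinarith
      _ ≤ n * (Real.log n + Real.log 4) := by
          rw [Finset.sum_add_distrib]; linarith
  exact le_of_mul_le_mul_left h5 hn0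

/-- Partial sums of `ζ(1 + σ)` are at most `1 + 1 / σ`. -/
theorem sum_rpow_neg_le {σ : ℝ} (hσ : 0 < σ) (n : ℕ) :
    ∑ k ∈ Finset.range n, ((k + 1 : ℕ) : ℝ) ^ (-(1 + σ)) ≤ 1 + 1 / σ := by
  suffices h : ∀ n : ℕ, ∑ k ∈ Finset.range (n + 1), ((k + 1 : ℕ) : ℝ) ^ (-(1 + σ)) ≤
      1 + (1 - ((n + 1 : ℕ) : ℝ) ^ (-σ)) / σ by
    rcases n with _ | n
    · simp; positivity
    · refine (h n).trans ?_
      have : 0 ≤ ((n + 1 : ℕ) : ℝ) ^ (-σ) := by positivity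
      gcongr
      linarith
  intro n
  induction n with
  | zero => simp
  | succ n ih =>
    rw [Finset.sum_range_succ]
    have hx : (0 : ℝ) < ((n + 1 : ℕ) : ℝ) := by positivity
    have hy : (0 : ℝ) < ((n + 1 + 1 : ℕ) : ℝ) := by positivity
    have hxy : ((n + 1 + 1 : ℕ) : ℝ) = ((n + 1 : ℕ) : ℝ) + 1 := by push_cast; ring
    set x : ℝ := ((n + 1 : ℕ) : ℝ)
    set y : ℝ := ((n + 1 + 1 : ℕ) : ℝ)
    -- `x ^ (-σ) = y ^ (-σ) * (y / x) ^ σ`, and `(y / x) ^ σ ≥ 1 + σ / y`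
    have h1 : y ^ (-σ) * (1 + σ / y) ≤ x ^ (-σ) := by
      have h2 : 1 + σ / y ≤ (x / y) ^ (-σ) := by
        rw [Real.rpow_def_of_pos (by positivity)]
        have h3 : Real.log (x / y) ≤ x / y - 1 := Real.log_le_sub_one_of_pos (by positivity)
        have h4 : x / y - 1 = -(1 / y) := by rw [hxy]; field_simp; ring
        have h5 := Real.add_one_le_exp (Real.log (x / y) * -σ)
        have h6 : σ / y = σ * (1 / y) := by ring
        nlinarith
      calc y ^ (-σ) * (1 + σ / y) ≤ y ^ (-σ) * (x / y) ^ (-σ) := by gcongr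
        _ = x ^ (-σ) := by
          rw [← Real.mul_rpow (by positivity) (by positivity)]
          congr 1; field_simp
    have h7 : y ^ (-(1 + σ)) = y ^ (-σ) / y := by
      rw [show -(1 + σ) = -σ - 1 by ring, Real.rpow_sub_one hy.ne']
    have h8 : y ^ (-(1 + σ)) ≤ (x ^ (-σ) - y ^ (-σ)) / σ := by
      rw [h7, le_div_iff₀ hσ]
      have : y ^ (-σ) / y * σ = y ^ (-σ) * (σ / y) := by ring
      linarith
    calc _ ≤ 1 + (1 - x ^ (-σ)) / σ + (x ^ (-σ) - y ^ (-σ)) / σ := add_le_add ih h8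
      _ = 1 + (1 - y ^ (-σ)) / σ := by ring

theorem prod_primesLE_one_sub_rpow_inv_le {σ : ℝ} (hσ : 0 < σ) (n : ℕ) :
    ∏ p ∈ n.primesLE, (1 - (p : ℝ) ^ (-(1 + σ)))⁻¹ ≤ 1 + 1 / σ := by
  let f : ℕ →* ℝ :=
    { toFun := fun k => (k : ℝ) ^ (-(1 + σ))
      map_one' := by simp
      map_mul' := fun a b => by push_cast; exact Real.mul_rpow (by positivity) (by positivity) }
  have hf : ∀ {p : ℕ}, p.Prime → ‖f p‖ < 1 := by
    intro p hp
    have h1 : (1 : ℝ) < p := by exact_mod_cast hp.one_lt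
    have : f p = (p : ℝ) ^ (-(1 + σ)) := rfl
    rw [this, Real.norm_of_nonneg (by positivity)]
    exact Real.rpow_lt_one_of_one_lt_of_neg h1 (by linarith)
  have h := (EulerProduct.summable_and_hasSum_smoothNumbers_prod_primesBelow_geometric hf
    (n + 1)).2
  refine le_of_tendsto h (Eventually.of_forall fun s => ?_)
  have hpos : ∀ m ∈ s, ((m : ℕ) ≠ 0) := fun m _ => Nat.ne_zero_of_mem_smoothNumbers m.2
  set t : Finset ℕ := s.image (fun m : (n + 1).smoothNumbers => (m : ℕ) - 1) with ht
  have h1 : ∑ m ∈ s, f m = ∑ k ∈ t, ((k + 1 : ℕ) : ℝ) ^ (-(1 + σ)) := by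
    rw [ht, Finset.sum_image]
    · refine Finset.sum_congr rfl fun m hm => ?_
      rw [Nat.sub_add_cancel (Nat.one_le_iff_ne_zero.2 (hpos m hm))]
      rfl
    · intro a ha b hb hab
      have := hpos a ha
      have := hpos b hb
      ext
      simp only at hab
      omega
  rw [h1]
  obtain ⟨m, hm⟩ := t.exists_nat_subset_range
  refine le_trans (Finset.sum_le_sum_of_subset_of_nonneg hm fun _ _ _ => by positivity)
    (sum_rpow_neg_le hσ m)

/-- The upper bound in Mertens' third theorem, up to a constant. With `σ = 1 / log n` the
product is compared with the partial Euler product of `ζ(1 + σ)`; the ratio of the two is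
controlled by Mertens' first theorem. -/
theorem prod_primesLE_one_sub_inv_le {n : ℕ} (hn : 3 ≤ n) :
    ∏ p ∈ n.primesLE, (1 - (p : ℝ)⁻¹)⁻¹ ≤ Real.exp 6 * (2 * Real.log n) := by
  have hn3 : (3 : ℝ) ≤ n := by exact_mod_cast hn
  have hlog : 1 ≤ Real.log n := by
    rw [Real.le_log_iff_exp_le (by linarith)]
    exact Real.exp_one_lt_d9.le.trans (by linarith)
  set σ : ℝ := 1 / Real.log n with hσ
  have hσ0 : 0 < σ := by positivity
  have key : ∀ p ∈ n.primesLE, (1 - (p : ℝ)⁻¹)⁻¹ ≤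
      Real.exp (2 * σ * (Real.log p / p)) * (1 - (p : ℝ) ^ (-(1 + σ)))⁻¹ := by
    intro p hp
    have hp2 : (2 : ℝ) ≤ p := by exact_mod_cast Nat.two_le_of_mem_primesLE hp
    have hp0 : (0 : ℝ) < p := by linarith
    set x : ℝ := (p : ℝ)⁻¹ with hx
    have hx2 : x ≤ 1 / 2 := by
      rw [hx, inv_eq_one_div]; exact one_div_le_one_div_of_le (by norm_num) hp2
    have hx0 : 0 < x := by positivity
    have h1 : (p : ℝ) ^ (-(1 + σ)) = x * (p : ℝ) ^ (-σ) := by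
      rw [show -(1 + σ) = -1 + -σ by ring, Real.rpow_add hp0, Real.rpow_neg_one]
    have h2 : 1 - σ * Real.log p ≤ (p : ℝ) ^ (-σ) := by
      rw [Real.rpow_def_of_pos hp0]
      have := Real.add_one_le_exp (Real.log p * -σ)
      linarith
    have h3 : (p : ℝ) ^ (-σ) < 1 := Real.rpow_lt_one_of_one_lt_of_neg (by linarith) (by linarith)
    have h3' : 0 < (p : ℝ) ^ (-σ) := by positivity
    set z : ℝ := (p : ℝ) ^ (-σ)
    have hl : 0 ≤ Real.log p := Real.log_nonneg (by linarith)
    have h4 : 2 * σ * (Real.log p / p) = 2 * (x * (σ * Real.log p)) := by rw [hx]; ring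
    have h5 := Real.add_one_le_exp (2 * σ * (Real.log p / p))
    rw [h1]
    have h6 : 0 < 1 - x * z := by nlinarith
    have h7 : 0 < 1 - x := by linarith
    rw [← div_eq_mul_inv, le_div_iff₀ h6, inv_mul_le_iff₀ h7]
    have h8 : 0 ≤ x * (σ * Real.log p) := by positivity
    have h9 : x * (1 - z) ≤ x * (σ * Real.log p) := by
      apply mul_le_mul_of_nonneg_left _ hx0.le; linarith
    have h10 : (1 - x) * (1 + 2 * (x * (σ * Real.log p))) ≤
        (1 - x) * Real.exp (2 * σ * (Real.log p / p)) := by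
      apply mul_le_mul_of_nonneg_left _ h7.le; linarith
    nlinarith
  calc ∏ p ∈ n.primesLE, (1 - (p : ℝ)⁻¹)⁻¹
      ≤ ∏ p ∈ n.primesLE, (Real.exp (2 * σ * (Real.log p / p)) *
          (1 - (p : ℝ) ^ (-(1 + σ)))⁻¹) := by
        refine Finset.prod_le_prod (fun p hp => ?_) key
        have hp2 : (1 : ℝ) ≤ p := by exact_mod_cast (Nat.prime_of_mem_primesLE hp).one_le
        exact inv_nonneg.2 (sub_nonneg.2 (inv_le_one_of_one_le₀ hp2))
    _ = Real.exp (2 * σ * ∑ p ∈ n.primesLE, Real.log p / p) *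
          ∏ p ∈ n.primesLE, (1 - (p : ℝ) ^ (-(1 + σ)))⁻¹ := by
        rw [Finset.prod_mul_distrib, ← Real.exp_sum, Finset.mul_sum]
    _ ≤ Real.exp 6 * (2 * Real.log n) := by
        have h1 := sum_log_div_primesLE_le (n := n) (by omega)
        have h2 := prod_primesLE_one_sub_rpow_inv_le hσ0 n
        have h4 : Real.log 4 ≤ 2 := by
          rw [show (4 : ℝ) = 2 ^ 2 by norm_num, Real.log_pow]
          have := Real.log_two_lt_d9
          push_cast; linarith
        have h5 : σ * Real.log n = 1 := by rw [hσ]; field_simp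
        have h6 : σ ≤ 1 := by rw [hσ]; exact (div_le_one (by linarith)).2 hlog
        have h7 : 1 + 1 / σ ≤ 2 * Real.log n := by rw [hσ]; simp; linarith
        refine mul_le_mul (Real.exp_le_exp.2 ?_) (h2.trans h7) ?_ (by positivity)
        · nlinarith
        · refine Finset.prod_nonneg fun p hp => inv_nonneg.2 (sub_nonneg.2 ?_)
          have hp2 : (1 : ℝ) ≤ p := by exact_mod_cast (Nat.prime_of_mem_primesLE hp).one_le
          exact Real.rpow_le_one_of_one_le_of_nonpos hp2 (by linarith)

end DivisorMajorant

namespace DivisorMajorant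

/-! ### Lattice points of convex sets -/

/-- A bounded interval contains its length many integers, up to an error of one. -/
theorem abs_ncard_int_sub_volume_le_one {s : Set ℝ} (hs : Convex ℝ s)
    (hb : Bornology.IsBounded s) :
    |(({n : ℤ | (n : ℝ) ∈ s}.ncard : ℕ) : ℝ) - volume.real s| ≤ 1 := by
  rcases s.eq_empty_or_nonempty with rfl | hne
  · simp
  obtain ⟨hbb, hba⟩ : BddBelow s ∧ BddAbove s := isBounded_iff_bddBelow_bddAbove.1 hb
  set α := sInf s
  set β := sSup s
  have hαβ : α ≤ β := csInf_le_csSup hne hbb hba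
  have hsub : s ⊆ Set.Icc α β := fun x hx => ⟨csInf_le hbb hx, le_csSup hba hx⟩
  have hsup : Set.Ioo α β ⊆ s := by
    intro x hx
    obtain ⟨y, hy, hyx⟩ := exists_lt_of_csInf_lt hne hx.1
    obtain ⟨z, hz, hxz⟩ := exists_lt_of_lt_csSup hne hx.2
    exact hs.ordConnected.out hy hz ⟨hyx.le, hxz.le⟩
  have hvol : volume.real s = β - α := by
    apply le_antisymm
    · calc volume.real s ≤ volume.real (Set.Icc α β) := measureReal_mono hsub (by simp)
        _ = β - α := by simp [hαβ]
    · calc β - α = volume.real (Set.Ioo α β) := by simp [hαβ]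
        _ ≤ volume.real s := measureReal_mono hsup hb.measure_lt_top.ne
  have h1 : {n : ℤ | (n : ℝ) ∈ s} ⊆ ((Finset.Icc ⌈α⌉ ⌊β⌋ : Finset ℤ) : Set ℤ) := by
    intro n hn
    have := hsub hn
    simp only [Finset.coe_Icc, Set.mem_Icc]
    exact ⟨Int.ceil_le.2 this.1, Int.le_floor.2 this.2⟩
  have hfin : {n : ℤ | (n : ℝ) ∈ s}.Finite := (Finset.finite_toSet _).subset h1
  have h2 : ((Finset.Ioo ⌊α⌋ ⌈β⌉ : Finset ℤ) : Set ℤ) ⊆ {n : ℤ | (n : ℝ) ∈ s} := by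
    intro n hn
    simp only [Finset.coe_Ioo, Set.mem_Ioo] at hn
    exact hsup ⟨Int.floor_lt.1 hn.1, Int.lt_ceil.1 hn.2⟩
  have c1 := Set.ncard_le_ncard h1 (Finset.finite_toSet _)
  have c2 := Set.ncard_le_ncard h2 hfin
  rw [Set.ncard_coe_finset, Int.card_Icc] at c1
  rw [Set.ncard_coe_finset, Int.card_Ioo] at c2
  have e1 := Int.ceil_lt_add_one β
  have e2 := Int.le_ceil α
  have e3 := Int.floor_le β
  have e4 := Int.lt_floor_add_one α
  have e5 := Int.ceil_lt_add_one α
  have e6 := Int.le_ceil β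
  have e7 := Int.floor_le α
  have e8 := Int.lt_floor_add_one β
  have hαβ' : (⌈α⌉ : ℤ) ≤ ⌊β⌋ + 1 := by
    have : ((⌈α⌉ : ℤ) : ℝ) < ((⌊β⌋ + 2 : ℤ) : ℝ) := by push_cast; linarith
    have := Int.cast_lt.1 this
    omega
  have d1 : (({n : ℤ | (n : ℝ) ∈ s}.ncard : ℕ) : ℤ) ≤ ⌊β⌋ + 1 - ⌈α⌉ := by omega
  have d2 : ⌈β⌉ - ⌊α⌋ - 1 ≤ (({n : ℤ | (n : ℝ) ∈ s}.ncard : ℕ) : ℤ) := by omega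
  have d1' : (({n : ℤ | (n : ℝ) ∈ s}.ncard : ℕ) : ℝ) ≤ ⌊β⌋ + 1 - ⌈α⌉ := by exact_mod_cast d1
  have d2' : (⌈β⌉ : ℝ) - ⌊α⌋ - 1 ≤ (({n : ℤ | (n : ℝ) ∈ s}.ncard : ℕ) : ℝ) := by
    exact_mod_cast d2
  rw [hvol, abs_le]
  constructor <;> linarith

theorem finite_latticePoints {d : ℕ} {K : Set (Fin d → ℝ)} {a : Fin d → ℝ} {L : ℝ}
    (hK : ∀ x ∈ K, ∀ k, x k ∈ Set.Icc (a k) (a k + L)) : (latticePoints K).Finite := by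
  refine (Set.Finite.pi' (fun k => (Finset.Icc ⌈a k⌉ ⌊a k + L⌋).finite_toSet)).subset ?_
  intro n hn k
  have := hK _ hn k
  simp only [Finset.coe_Icc, Set.mem_Icc]
  exact ⟨Int.ceil_le.2 this.1, Int.le_floor.2 this.2⟩

theorem isBounded_of_box {d : ℕ} {K : Set (Fin d → ℝ)} {a : Fin d → ℝ} {L : ℝ}
    (hK : ∀ x ∈ K, ∀ k, x k ∈ Set.Icc (a k) (a k + L)) : Bornology.IsBounded K := by
  refine (Bornology.IsBounded.pi fun k => Metric.isBounded_Icc (a k) (a k + L)).subset ?_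
  intro x hx k _
  exact hK x hx k

/-- Counting the lattice points of a set slice by slice. -/
theorem ncard_latticePoints_succ {d : ℕ} {K : Set (Fin (d + 1) → ℝ)} {a : Fin (d + 1) → ℝ}
    {L : ℝ} (hK : ∀ x ∈ K, ∀ k, x k ∈ Set.Icc (a k) (a k + L)) :
    (latticePoints K).ncard = ∑ m ∈ Finset.Icc ⌈a 0⌉ ⌊a 0 + L⌋,
      (latticePoints {y : Fin d → ℝ | (Fin.cons (m : ℝ) y : Fin (d + 1) → ℝ) ∈ K}).ncard := by
  classical
  have hfin := finite_latticePoints hK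
  rw [Set.ncard_eq_toFinset_card _ hfin]
  rw [Finset.card_eq_sum_card_fiberwise (f := fun n => n 0) (t := Finset.Icc ⌈a 0⌉ ⌊a 0 + L⌋)]
  · refine Finset.sum_congr rfl fun m _ => ?_
    rw [← Set.ncard_coe_finset]
    symm
    refine Set.ncard_congr (fun y _ => (Fin.cons m y : Fin (d + 1) → ℤ)) ?_ ?_ ?_
    · intro y hy
      simp only [Finset.coe_filter, Set.Finite.mem_toFinset, Set.mem_ofPred_eq, Fin.cons_zero,
        and_true]
      simp only [latticePoints, Set.mem_ofPred_eq] at hy ⊢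
      convert hy using 1
      ext k
      refine Fin.cases ?_ (fun i => ?_) k <;> simp
    · intro y z _ _ h
      exact (Fin.cons_injective2 h).2
    · intro n hn
      simp only [Finset.coe_filter, Set.Finite.mem_toFinset, Set.mem_ofPred_eq] at hn
      refine ⟨Fin.tail n, ?_, ?_⟩
      · simp only [latticePoints, Set.mem_ofPred_eq]
        have h := hn.1
        simp only [latticePoints, Set.mem_ofPred_eq] at h
        convert h using 1
        ext k
        refine Fin.cases ?_ (fun i => ?_) k
        · simp [hn.2]
        · simp [Fin.tail]
      · rw [← hn.2]; exact Fin.cons_self_tail n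
  · intro n hn
    have := hK _ (hfin.mem_toFinset.1 hn) 0
    simp only [Finset.coe_Icc, Set.mem_Icc]
    exact ⟨Int.ceil_le.2 this.1, Int.le_floor.2 this.2⟩

/-- Lattice point count for Borel convex sets in a box of side `L`. The coordinates are
discretised one at a time; each step costs at most one per line parallel to that coordinate. -/
theorem abs_ncard_latticePoints_sub_volume_le_of_measurableSet {L : ℝ} (hL : 0 ≤ L) (d : ℕ) :
    ∀ (K : Set (Fin d → ℝ)) (a : Fin d → ℝ), Convex ℝ K → MeasurableSet K →
      (∀ x ∈ K, ∀ k, x k ∈ Set.Icc (a k) (a k + L)) →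
      |((latticePoints K).ncard : ℝ) - volume.real K| ≤ d * (L + 1) ^ (d - 1) := by
  induction d with
  | zero =>
    intro K a _ _ _
    rcases Set.eq_empty_or_nonempty K with rfl | ⟨x, hx⟩
    · simp [latticePoints]
    · have hKu : K = Set.univ := by
        ext y; simp only [Set.mem_univ, iff_true]; rwa [Subsingleton.elim y x]
      subst hKu
      have : latticePoints (Set.univ : Set (Fin 0 → ℝ)) = Set.univ := by
        ext; simp [latticePoints]
      rw [this, Set.ncard_univ]
      simp [measureReal_def, volume_pi]
  | succ d ih =>
    intro K a hc hm hK
    rw [ncard_latticePoints_succ hK]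
    set J := Finset.Icc ⌈a 0⌉ ⌊a 0 + L⌋ with hJ
    set sl : ℝ → Set (Fin d → ℝ) :=
      fun t => {y : Fin d → ℝ | (Fin.cons t y : Fin (d + 1) → ℝ) ∈ K} with hsl
    have hJcard : (J.card : ℝ) ≤ L + 1 := by
      rw [hJ, Int.card_Icc]
      have e1 := Int.floor_le (a 0 + L)
      have e2 := Int.le_ceil (a 0)
      rcases le_total 0 (⌊a 0 + L⌋ + 1 - ⌈a 0⌉) with h | h
      · have : (((⌊a 0 + L⌋ + 1 - ⌈a 0⌉).toNat : ℤ) : ℝ) = ((⌊a 0 + L⌋ + 1 - ⌈a 0⌉ : ℤ) : ℝ) := by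
          rw [Int.toNat_of_nonneg h]
        rw [Int.cast_natCast] at this
        rw [this]; push_cast; linarith
      · rw [Int.toNat_of_nonpos h]; simp; linarith
    have hcons : ∀ y : Fin d → ℝ, Measurable fun t : ℝ => (Fin.cons t y : Fin (d + 1) → ℝ) := by
      intro y
      refine measurable_pi_iff.2 fun k => ?_
      refine Fin.cases ?_ (fun i => ?_) k <;> simp [measurable_id']
    have hcons2 : Measurable fun z : ℝ × (Fin d → ℝ) => (Fin.cons z.1 z.2 : Fin (d + 1) → ℝ) := by
      refine measurable_pi_iff.2 fun k => ?_
      refine Fin.cases ?_ (fun i => ?_) k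
      · simpa using measurable_fst
      · simp only [Fin.cons_succ]
        exact (measurable_pi_apply i).comp measurable_snd
    have hslm : ∀ t, MeasurableSet (sl t) := fun t =>
      (hcons2.comp (measurable_const.prodMk measurable_id)) hm
    have hslc : ∀ t, Convex ℝ (sl t) := by
      intro t y hy z hz α β hα hβ hαβ
      have := hc hy hz hα hβ hαβ
      simp only [hsl, Set.mem_ofPred_eq]
      convert this using 1
      ext k
      refine Fin.cases ?_ (fun i => ?_) k
      · simp [← add_mul, hαβ]
      · simp
    have hslb : ∀ t, ∀ y ∈ sl t, ∀ k, y k ∈ Set.Icc (a k.succ) (a k.succ + L) := by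
      intro t y hy k
      simpa using hK _ hy k.succ
    have step1 : |∑ m ∈ J, ((latticePoints (sl m)).ncard : ℝ) - ∑ m ∈ J, volume.real (sl m)| ≤
        d * (L + 1) ^ d := by
      rw [← Finset.sum_sub_distrib]
      refine (Finset.abs_sum_le_sum_abs _ _).trans ?_
      calc ∑ m ∈ J, |((latticePoints (sl m)).ncard : ℝ) - volume.real (sl m)|
          ≤ ∑ m ∈ J, (d * (L + 1) ^ (d - 1) : ℝ) :=
            Finset.sum_le_sum fun m _ => ih _ _ (hslc m) (hslm m) (hslb m)
        _ = J.card * (d * (L + 1) ^ (d - 1)) := by simp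
        _ ≤ (L + 1) * (d * (L + 1) ^ (d - 1)) := by gcongr
        _ = d * (L + 1) ^ d := by
          rcases d with _ | d
          · simp
          · simp only [Nat.add_sub_cancel]; ring
    set K' : Set (ℝ × (Fin d → ℝ)) := {z | (Fin.cons z.1 z.2 : Fin (d + 1) → ℝ) ∈ K} with hK'
    have hK'm : MeasurableSet K' := hcons2 hm
    have hvolK : volume K = volume K' := by
      have h :=
        (volume_preserving_piFinSuccAbove (fun _ : Fin (d + 1) => ℝ) 0).measure_preimage_equiv
        K'
      rw [← h]
      congr 1
      ext x
      simp only [hK', Set.mem_preimage, Set.mem_ofPred_eq, MeasurableEquiv.piFinSuccAbove]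
      simp [Fin.insertNthEquiv]
    have hKfin : volume K < ⊤ := (isBounded_of_box hK).measure_lt_top
    set Bx : Set (Fin d → ℝ) := Set.univ.pi fun k => Set.Icc (a k.succ) (a k.succ + L) with hBx
    have hBxm : MeasurableSet Bx := MeasurableSet.univ_pi fun k => measurableSet_Icc
    have hBxv : volume.real Bx = L ^ d := by
      rw [hBx, measureReal_def, volume_pi, Measure.pi_pi]
      simp [hL]
    have hBxf : volume Bx < ⊤ := by
      rw [hBx, volume_pi, Measure.pi_pi]
      exact ENNReal.prod_lt_top fun k _ => by simp
    have hfib : ∀ y, MeasurableSet {t : ℝ | (Fin.cons t y : Fin (d + 1) → ℝ) ∈ K} :=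
      fun y => hcons y hm
    have hfibb : ∀ y, {t : ℝ | (Fin.cons t y : Fin (d + 1) → ℝ) ∈ K} ⊆ Set.Icc (a 0) (a 0 + L) := by
      intro y t ht
      simpa using hK _ ht 0
    have hfibc : ∀ y, Convex ℝ {t : ℝ | (Fin.cons t y : Fin (d + 1) → ℝ) ∈ K} := by
      intro y s hs t ht α β hα hβ hαβ
      have := hc hs ht hα hβ hαβ
      simp only [Set.mem_ofPred_eq]
      convert this using 1
      ext k
      refine Fin.cases ?_ (fun i => ?_) k
      · simp
      · simp [← add_mul, hαβ]
    have hint : Integrable (K'.indicator (1 : ℝ × (Fin d → ℝ) → ℝ)) (volume.prod volume) := by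
      rw [integrable_indicator_iff hK'm]
      refine integrableOn_const ?_
      change volume K' ≠ ⊤
      rw [← hvolK]; exact hKfin.ne
    have hvol2 : volume.real K =
        ∫ y : Fin d → ℝ, volume.real {t : ℝ | (Fin.cons t y : Fin (d + 1) → ℝ) ∈ K} := by
      rw [measureReal_def, hvolK, ← measureReal_def]
      have h1 := integral_indicator_one (μ := (volume : Measure (ℝ × (Fin d → ℝ)))) hK'm
      rw [← h1]
      change ∫ z, K'.indicator 1 z ∂(volume.prod volume) = _
      rw [integral_prod_symm _ hint]
      refine integral_congr_ae (Eventually.of_forall fun y => ?_)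
      simp only
      rw [← integral_indicator_one (hfib y)]
      rfl
    have hintfib : Integrable
        (fun y : Fin d → ℝ => volume.real {t : ℝ | (Fin.cons t y : Fin (d + 1) → ℝ) ∈ K}) := by
      refine hint.integral_prod_right.congr (Eventually.of_forall fun y => ?_)
      simp only
      rw [← integral_indicator_one (hfib y)]
      rfl
    have hslf : ∀ t, volume (sl t) ≠ ⊤ := fun t => (isBounded_of_box (hslb t)).measure_lt_top.ne
    have hsum : ∑ m ∈ J, volume.real (sl m) =
        ∫ y : Fin d → ℝ, ∑ m ∈ J, (sl m).indicator (1 : (Fin d → ℝ) → ℝ) y := by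
      rw [integral_finsetSum]
      · exact Finset.sum_congr rfl fun m _ => (integral_indicator_one (hslm m)).symm
      · intro m _
        rw [integrable_indicator_iff (hslm m)]
        exact integrableOn_const (hslf m)
    have hcount : ∀ y : Fin d → ℝ, ∑ m ∈ J, (sl m).indicator (1 : (Fin d → ℝ) → ℝ) y =
        (({n : ℤ | (n : ℝ) ∈ {t : ℝ | (Fin.cons t y : Fin (d + 1) → ℝ) ∈ K}}.ncard : ℕ) : ℝ) := by
      intro y
      classical
      simp only [Set.indicator_apply, Pi.one_apply]
      rw [Finset.sum_boole, ← Set.ncard_coe_finset]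
      congr 2
      ext n
      simp only [hsl, Finset.coe_filter, Set.mem_ofPred_eq, and_iff_right_iff_imp]
      intro hn
      have := hfibb y hn
      exact Finset.mem_Icc.2 ⟨Int.ceil_le.2 this.1, Int.le_floor.2 this.2⟩
    have step2 : |∑ m ∈ J, volume.real (sl m) - volume.real K| ≤ L ^ d := by
      rw [hsum, hvol2, ← integral_sub _ hintfib]
      · rw [← setIntegral_eq_integral_of_forall_compl_eq_zero (s := Bx)]
        · have h := norm_setIntegral_le_of_norm_le_const (μ := volume) (s := Bx) (C := 1)
            (f := fun y => ∑ m ∈ J, (sl m).indicator (1 : (Fin d → ℝ) → ℝ) y -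
              volume.real {t : ℝ | (Fin.cons t y : Fin (d + 1) → ℝ) ∈ K}) hBxf ?_
          · rwa [hBxv, one_mul] at h
          · intro y _
            rw [hcount y]
            exact abs_ncard_int_sub_volume_le_one (hfibc y)
              (Metric.isBounded_Icc _ _ |>.subset (hfibb y))
        · intro y hy
          have hempty : {t : ℝ | (Fin.cons t y : Fin (d + 1) → ℝ) ∈ K} = ∅ := by
            ext t
            simp only [Set.mem_ofPred_eq, Set.mem_empty_iff_false, iff_false]
            intro ht
            exact hy fun k _ => by simpa using hK _ ht k.succ
          rw [hcount y, hempty]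
          simp
      · refine integrable_finsetSum _ fun m _ => ?_
        rw [integrable_indicator_iff (hslm m)]
        exact integrableOn_const (hslf m)
    have h3 : L ^ d ≤ (L + 1) ^ d := by gcongr; linarith
    rw [Nat.add_sub_cancel]
    push_cast
    calc |∑ m ∈ J, ((latticePoints (sl m)).ncard : ℝ) - volume.real K|
        ≤ |∑ m ∈ J, ((latticePoints (sl m)).ncard : ℝ) - ∑ m ∈ J, volume.real (sl m)| +
          |∑ m ∈ J, volume.real (sl m) - volume.real K| := abs_sub_le _ _ _
      _ ≤ d * (L + 1) ^ d + (L + 1) ^ d := add_le_add step1 (step2.trans h3)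
      _ = (d + 1) * (L + 1) ^ d := by ring

/-- The number of lattice points of a convex set in a box of side `L` is its volume, up to
`O(L ^ (d - 1))`. Neither closedness nor non-empty interior is needed. -/
theorem abs_ncard_latticePoints_sub_volume_le {L : ℝ} (hL : 0 ≤ L) {d : ℕ}
    {K : Set (Fin d → ℝ)} {a : Fin d → ℝ} (hc : Convex ℝ K)
    (hK : ∀ x ∈ K, ∀ k, x k ∈ Set.Icc (a k) (a k + L)) :
    |((latticePoints K).ncard : ℝ) - volume.real K| ≤ d * (L + 1) ^ (d - 1) := by
  have hcl : ∀ x ∈ closure K, ∀ k, x k ∈ Set.Icc (a k) (a k + L) := by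
    have hsub : K ⊆ Set.univ.pi fun k => Set.Icc (a k) (a k + L) := fun x hx k _ => hK x hx k
    have := closure_minimal hsub (isClosed_set_pi fun k _ => isClosed_Icc)
    exact fun x hx k => this hx k (Set.mem_univ k)
  have hfr : volume (frontier K) = 0 := hc.addHaar_frontier volume
  have hbcl : volume (closure K) ≠ ⊤ := (isBounded_of_box hcl).measure_lt_top.ne
  have hbK : volume K ≠ ⊤ := (isBounded_of_box hK).measure_lt_top.ne
  have hv1 : volume.real (closure K) ≤ volume.real K := by
    have h1 : closure K ⊆ K ∪ frontier K := by
      rw [← closure_eq_self_union_frontier]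
    calc volume.real (closure K) ≤ volume.real (K ∪ frontier K) :=
          measureReal_mono h1 (measure_union_lt_top hbK.lt_top (by simp [hfr])).ne
      _ ≤ volume.real K + volume.real (frontier K) := measureReal_union_le _ _
      _ = volume.real K := by simp [measureReal_def, hfr]
  have hv2 : volume.real K ≤ volume.real (interior K) := by
    have h1 : K ⊆ interior K ∪ frontier K := by
      rw [← closure_eq_interior_union_frontier]; exact subset_closure
    have h2 : volume (interior K) ≠ ⊤ := measure_ne_top_of_subset interior_subset hbK
    calc volume.real K ≤ volume.real (interior K ∪ frontier K) :=
          measureReal_mono h1 (measure_union_lt_top h2.lt_top (by simp [hfr])).ne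
      _ ≤ volume.real (interior K) + volume.real (frontier K) := measureReal_union_le _ _
      _ = volume.real (interior K) := by simp [measureReal_def, hfr]
  have h1 := abs_ncard_latticePoints_sub_volume_le_of_measurableSet hL d (closure K) a
    hc.closure isClosed_closure.measurableSet hcl
  have h2 := abs_ncard_latticePoints_sub_volume_le_of_measurableSet hL d (interior K) a
    hc.interior isOpen_interior.measurableSet (fun x hx => hK x (interior_subset hx))
  have c1 : ((latticePoints K).ncard : ℝ) ≤ (latticePoints (closure K)).ncard := by
    exact_mod_cast Set.ncard_le_ncard (s := latticePoints K)
      (fun n hn => subset_closure (X := Fin d → ℝ) hn) (finite_latticePoints hcl)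
  have c2 : ((latticePoints (interior K)).ncard : ℝ) ≤ (latticePoints K).ncard := by
    exact_mod_cast Set.ncard_le_ncard (t := latticePoints K)
      (fun n hn => interior_subset (X := Fin d → ℝ) hn) (finite_latticePoints hK)
  rw [abs_le] at h1 h2 ⊢
  constructor <;> linarith

end DivisorMajorant

namespace DivisorMajorant

/-! ### Local densities -/

/-- A prime (or any modulus) that is not exceptional for the system; the index type is
arbitrary here, so that one may pass to subsystems. -/
def Unexceptional {ι : Type*} {d : ℕ} (Ψ : ι → AffineForm d) (p : ℕ) : Prop :=
  (∀ i j, i ≠ j → ¬ AffinelyRelatedMod p (Ψ i) (Ψ j)) ∧ ∀ i, ¬ ConstantMod p (Ψ i)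

variable {ι : Type*} [Fintype ι] {d : ℕ}

/-- Modulo an unexceptional prime, the linear parts of at most two of the forms take
arbitrary prescribed values simultaneously. -/
theorem Unexceptional.exists_linearPart_eq {Ψ : ι → AffineForm d} {p : ℕ} [Fact p.Prime]
    (h : Unexceptional Ψ p) (s : Finset ι) (hs : s.card ≤ 2) (g : ι → ZMod p) :
    ∃ n : Fin d → ℤ, ∀ j ∈ s, ∑ k, ((Ψ j).coeff k : ZMod p) * (n k : ZMod p) = g j := by
  classical
  let A : (Fin d → ZMod p) →ₗ[ZMod p] (s → ZMod p) :=
    LinearMap.pi fun j => ∑ k, ((Ψ j).coeff k : ZMod p) • LinearMap.proj k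
  have hA : ∀ x j, A x j = ∑ k, ((Ψ j).coeff k : ZMod p) * x k := by
    intro x j; simp [A]
  have hsurj : LinearMap.range A = ⊤ := by
    by_contra hne
    obtain ⟨f, hf0, hf⟩ := Submodule.exists_le_ker_of_lt_top _ (lt_top_iff_ne_top.2 hne)
    set c : s → ZMod p := fun j => f (Pi.single j 1) with hc
    have hfc : ∀ v, f v = ∑ j, c j * v j := by
      intro v
      conv_lhs => rw [← LinearMap.sum_single_apply (fun _ => ZMod p) v]
      rw [map_sum]
      refine Finset.sum_congr rfl fun j _ => ?_
      have : (LinearMap.single (ZMod p) (fun _ : s => ZMod p) j) (v j) =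
          v j • Pi.single j (1 : ZMod p) := by
        ext i
        rcases eq_or_ne i j with rfl | hij
        · simp
        · simp [Pi.single_eq_of_ne hij]
      rw [LinearMap.coe_single] at this
      rw [this, map_smul, smul_eq_mul, mul_comm]
    have hzero : ∀ k, ∑ j, c j * ((Ψ j).coeff k : ZMod p) = 0 := by
      intro k
      have : f (A (Pi.single k 1)) = 0 := hf ⟨_, rfl⟩
      rw [hfc] at this
      simpa [hA, Pi.single_apply] using this
    obtain ⟨j₀, hj₀⟩ : ∃ j₀, c j₀ ≠ 0 := by
      by_contra hall
      push Not at hall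
      apply hf0
      ext v
      simp [hfc, hall]
    by_cases hex : ∃ j₁, j₁ ≠ j₀
    · obtain ⟨j₁, hj₁⟩ := hex
      refine h.1 j₀ j₁ (fun e => hj₁ (Subtype.ext e.symm)) ⟨c j₀, c j₁, Or.inl hj₀, fun k => ?_⟩
      rw [← hzero k, Fintype.sum_eq_add j₀ j₁ hj₁.symm]
      rintro x ⟨hx0, hx1⟩
      have h3 : ({j₀, j₁, x} : Finset s).card = 3 :=
        Finset.card_eq_three.2 ⟨j₀, j₁, x, hj₁.symm, hx0.symm, hx1.symm, rfl⟩
      have h4 := Finset.card_le_univ ({j₀, j₁, x} : Finset s)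
      rw [Fintype.card_coe] at h4
      omega
    · push Not at hex
      refine h.2 j₀ fun k => ?_
      have := hzero k
      rw [Fintype.sum_eq_single j₀ (fun x hx => absurd (hex x) hx)] at this
      exact (mul_eq_zero.1 this).resolve_left hj₀
  obtain ⟨x, hx⟩ := LinearMap.range_eq_top.1 hsurj (fun j => g j)
  refine ⟨fun k => ((x k).cast : ℤ), fun j hj => ?_⟩
  have := congrFun hx ⟨j, hj⟩
  rw [hA] at this
  simpa using this

/-- The linear parts of a system, reduced modulo the given moduli. -/
def linearParts (Ψ : ι → AffineForm d) (r : ι → ℕ) : (Fin d → ℤ) →+ (∀ j, ZMod (r j)) where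
  toFun n j := ∑ k, ((Ψ j).coeff k : ZMod (r j)) * (n k : ZMod (r j))
  map_zero' := by ext; simp
  map_add' a b := by ext; simp [mul_add, Finset.sum_add_distrib]

/-- If every prime divides at most two of the moduli, and the primes that do are
unexceptional, the reduced linear parts are jointly surjective. By Cauchy's theorem a proper
cokernel would have an element of prime order `p`, but the cokernel is `p`-divisible. -/
theorem linearParts_surjective {Ψ : ι → AffineForm d} {r : ι → ℕ} (hr : ∀ j, r j ≠ 0)
    (h1 : ∀ p : ℕ, p.Prime → (∃ j, p ∣ r j) → Unexceptional Ψ p)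
    (h2 : ∀ p : ℕ, p.Prime → (Finset.univ.filter fun j => p ∣ r j).card ≤ 2) :
    Function.Surjective (linearParts Ψ r) := by
  classical
  have : ∀ j, NeZero (r j) := fun j => ⟨hr j⟩
  set F := linearParts Ψ r
  rw [← AddMonoidHom.range_eq_top]
  by_contra hne
  have hcard : Nat.card ((∀ j, ZMod (r j)) ⧸ F.range) ≠ 1 := by
    intro h
    exact hne (AddSubgroup.index_eq_one.1 h)
  obtain ⟨p, hp, hpd⟩ := Nat.exists_prime_and_dvd hcard
  have := Fact.mk hp
  obtain ⟨x, hx⟩ := exists_prime_addOrderOf_dvd_card' (G := (∀ j, ZMod (r j)) ⧸ F.range) p hpd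
  have hdiv : ∀ g : ∀ j, ZMod (r j), ∃ n g', g = F n + p • g' := by
    intro g
    obtain ⟨n, hn⟩ : ∃ n : Fin d → ℤ, ∀ j ∈ Finset.univ.filter (fun j => p ∣ r j),
        ∑ k, ((Ψ j).coeff k : ZMod p) * (n k : ZMod p) = ((g j).val : ZMod p) := by
      by_cases hex : ∃ j, p ∣ r j
      · exact (h1 p hp hex).exists_linearPart_eq _ (h2 p hp) (fun j => ((g j).val : ZMod p))
      · push Not at hex
        exact ⟨0, fun j hj => absurd (Finset.mem_filter.1 hj).2 (hex j)⟩
    have : ∀ j, ∃ y : ZMod (r j), g j = F n j + p • y := by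
      intro j
      by_cases hj : p ∣ r j
      · have h3 := hn j (by simp [hj])
        have h4 : (((g j).val - ∑ k, (Ψ j).coeff k * n k : ℤ) : ZMod p) = 0 := by
          push_cast
          rw [h3]
          simp
        obtain ⟨z, hz⟩ := (ZMod.intCast_zmod_eq_zero_iff_dvd _ _).1 h4
        refine ⟨(z : ZMod (r j)), ?_⟩
        have h5 := congrArg (Int.cast : ℤ → ZMod (r j)) hz
        push_cast at h5
        rw [ZMod.natCast_zmod_val] at h5
        rw [nsmul_eq_mul, ← h5]
        have h6 : F n j = ∑ k, ((Ψ j).coeff k : ZMod (r j)) * (n k : ZMod (r j)) := rfl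
        rw [h6]
        ring
      · have hco : Nat.Coprime p (r j) := (Nat.Prime.coprime_iff_not_dvd hp).2 hj
        refine ⟨((ZMod.unitOfCoprime p hco)⁻¹ : (ZMod (r j))ˣ) * (g j - F n j), ?_⟩
        rw [nsmul_eq_mul, ← mul_assoc, ← ZMod.coe_unitOfCoprime p hco, Units.mul_inv, one_mul]
        ring
    choose g' hg' using this
    exact ⟨n, g', funext fun j => hg' j⟩
  have hsurj : Function.Surjective
      (fun y : (∀ j, ZMod (r j)) ⧸ F.range => p • y) := by
    intro y
    obtain ⟨g, rfl⟩ := QuotientAddGroup.mk_surjective y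
    obtain ⟨n, g', hg⟩ := hdiv g
    refine ⟨(g' : (∀ j, ZMod (r j)) ⧸ F.range), ?_⟩
    simp only
    rw [hg, QuotientAddGroup.mk_add,
      (QuotientAddGroup.eq_zero_iff (N := F.range) (F n)).2 ⟨n, rfl⟩, zero_add]
    rfl
  have hinj := Finite.injective_iff_surjective.2 hsurj
  have hx0 : x = 0 := by
    apply hinj
    simp only [smul_zero]
    rw [← hx]
    exact addOrderOf_nsmul_eq_zero x
  rw [hx0, addOrderOf_zero] at hx
  exact hp.one_lt.ne hx

/-- The number of residue classes `n` modulo `Q` with `q j ∣ ψ_j(n)` for all `j`. It is only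
used when all `q j` divide `Q`, and then does not depend on the representatives chosen. -/
def residueCount (Ψ : ι → AffineForm d) (q : ι → ℕ) (Q : ℕ) [NeZero Q] : ℕ :=
  (Finset.univ.filter fun a : Fin d → ZMod Q =>
    ∀ j, (q j : ℤ) ∣ (Ψ j).eval fun k => ((a k).val : ℤ)).card

theorem eval_intCast {R : Type*} [CommRing R] (ψ : AffineForm d) (n : Fin d → ℤ) :
    ((ψ.eval n : ℤ) : R) = ψ.eval (fun k => (n k : R)) := by
  simp [AffineForm.eval]

/-- Exact independence: the density of `r j ∣ ψ_j(n)` is `∏ 1 / r j`. -/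
theorem residueCount_mul_prod {Ψ : ι → AffineForm d} {r : ι → ℕ} (hr : ∀ j, r j ≠ 0)
    (h1 : ∀ p : ℕ, p.Prime → (∃ j, p ∣ r j) → Unexceptional Ψ p)
    (h2 : ∀ p : ℕ, p.Prime → (Finset.univ.filter fun j => p ∣ r j).card ≤ 2)
    (Q : ℕ) [NeZero Q] (hQ : ∀ j, r j ∣ Q) :
    residueCount Ψ r Q * ∏ j, r j = Q ^ d := by
  classical
  have : ∀ j, NeZero (r j) := fun j => ⟨hr j⟩
  let f : (Fin d → ZMod Q) →+ (∀ j, ZMod (r j)) :=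
    { toFun := fun a j => ∑ k, ((Ψ j).coeff k : ZMod (r j)) *
        ZMod.castHom (hQ j) (ZMod (r j)) (a k)
      map_zero' := by ext; simp
      map_add' := fun a b => by ext j; simp only [Pi.add_apply, map_add, mul_add,
        Finset.sum_add_distrib] }
  have hf : ∀ a j, f a j = ∑ k, ((Ψ j).coeff k : ZMod (r j)) *
        ZMod.castHom (hQ j) (ZMod (r j)) (a k) := fun _ _ => rfl
  have hsurj : Function.Surjective f := by
    intro g
    obtain ⟨n, hn⟩ := linearParts_surjective hr h1 h2 g
    refine ⟨fun k => (n k : ZMod Q), ?_⟩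
    rw [← hn]
    ext j
    rw [hf]
    simp [linearParts]
  have hfib : ∀ g, (Finset.univ.filter fun a => f a = g).card = residueCount Ψ r Q := by
    intro g
    have e : (Finset.univ.filter fun a : Fin d → ZMod Q =>
        ∀ j, (r j : ℤ) ∣ (Ψ j).eval fun k => ((a k).val : ℤ)) =
        Finset.univ.filter fun a => f a = fun j => -((Ψ j).const : ZMod (r j)) := by
      ext a
      simp only [Finset.mem_filter, Finset.mem_univ, true_and]
      rw [funext_iff]
      refine forall_congr' fun j => ?_
      rw [← ZMod.intCast_zmod_eq_zero_iff_dvd, eval_intCast, hf, ← add_eq_zero_iff_eq_neg]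
      simp [AffineForm.eval]
    rw [residueCount, e]
    exact AddMonoidHom.card_fiber_eq_of_mem_range f (hsurj _) (hsurj _)
  have htot : Fintype.card (Fin d → ZMod Q) = ∑ g : (∀ j, ZMod (r j)), residueCount Ψ r Q := by
    rw [← Finset.card_univ, Finset.card_eq_sum_card_fiberwise (f := f) (t := Finset.univ)
      (fun _ _ => by simp)]
    exact Finset.sum_congr rfl fun g _ => hfib g
  rw [Finset.sum_const, Finset.card_univ, Fintype.card_pi (α := fun j => ZMod (r j)),
    smul_eq_mul] at htot
  simp only [ZMod.card, Fintype.card_fun, Fintype.card_fin] at htot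
  rw [htot, mul_comm]

theorem residueCount_le_of_dvd {Ψ : ι → AffineForm d} {q r : ι → ℕ} (h : ∀ j, r j ∣ q j)
    (Q : ℕ) [NeZero Q] : residueCount Ψ q Q ≤ residueCount Ψ r Q := by
  refine Finset.card_le_card fun a ha => ?_
  simp only [Finset.mem_filter, Finset.mem_univ, true_and] at ha ⊢
  exact fun j => (Int.natCast_dvd_natCast.2 (h j)).trans (ha j)

theorem residueCount_le (Ψ : ι → AffineForm d) (q : ι → ℕ) (Q : ℕ) [NeZero Q] :
    residueCount Ψ q Q ≤ Q ^ d := by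
  refine (Finset.card_filter_le _ _).trans (le_of_eq ?_)
  simp [ZMod.card]

/-- The exponents `v` at some prime are called colliding if at least two of them are positive. -/
def Colliding (v : ι → ℕ) : Prop := ∃ i j, i ≠ j ∧ v i ≠ 0 ∧ v j ≠ 0

open Classical in
/-- An upper bound for the density of `p ^ v j ∣ ψ_j(n)` for all `j` at an unexceptional
prime. For colliding exponents it gains `p⁻²` and still decays geometrically in all `v j`. -/
noncomputable def localWeight (θ : ℝ) (p : ℕ) (v : ι → ℕ) : ℝ :=
  if Colliding v then 2 * ((p : ℝ)⁻¹) ^ 2 * ∏ j, θ ^ v j else ∏ j, ((p : ℝ)⁻¹) ^ v j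

theorem localWeight_nonneg {θ : ℝ} (hθ : 0 ≤ θ) (p : ℕ) (v : ι → ℕ) :
    0 ≤ localWeight θ p v := by
  unfold localWeight
  split_ifs <;> positivity

/-- Some of the exponents can be dropped so that at most two remain positive and
`localWeight` bounds the resulting density: keep the largest exponent, and one more with
value `1`. -/
theorem exists_exponents_le {θ : ℝ} (hθ0 : 0 < θ) (hθ1 : θ ≤ 1)
    (hθ : 1 / 2 ≤ θ ^ Fintype.card ι) {p : ℕ} (hp : 2 ≤ p) (v : ι → ℕ) :
    ∃ ρ : ι → ℕ, (∀ j, ρ j ≤ v j) ∧ (Finset.univ.filter fun j => ρ j ≠ 0).card ≤ 2 ∧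
      ∏ j, ((p : ℝ)⁻¹) ^ ρ j ≤ localWeight θ p v := by
  classical
  have hp2 : (2 : ℝ) ≤ p := by exact_mod_cast hp
  by_cases hv : Colliding v
  · obtain ⟨a, b, hab, ha, hb⟩ := id hv
    obtain ⟨i, -, hi⟩ := Finset.exists_max_image Finset.univ v ⟨a, Finset.mem_univ _⟩
    obtain ⟨j, hij, hj⟩ : ∃ j, j ≠ i ∧ v j ≠ 0 := by
      by_cases h : a = i
      · exact ⟨b, fun e => hab (h.trans e.symm), hb⟩
      · exact ⟨a, h, ha⟩
    have hvi : 1 ≤ v i := (Nat.one_le_iff_ne_zero.2 ha).trans (hi a (Finset.mem_univ _))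
    refine ⟨fun l => if l = i then v i else if l = j then 1 else 0, fun l => ?_, ?_, ?_⟩
    · dsimp only
      split_ifs with h1 h2
      · rw [h1]
      · rw [h2]; exact Nat.one_le_iff_ne_zero.2 hj
      · exact Nat.zero_le _
    · refine (Finset.card_le_card (t := {i, j}) ?_).trans Finset.card_le_two
      intro l hl
      simp only [Finset.mem_filter, Finset.mem_univ, true_and, Finset.mem_insert,
        Finset.mem_singleton] at hl ⊢
      by_contra hcon
      push Not at hcon
      simp [hcon.1, hcon.2] at hl
    · rw [localWeight, if_pos hv]
      rw [Fintype.prod_eq_mul i j hij.symm]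
      · simp only [if_true, hij, if_false, pow_one]
        have h1 : ((p : ℝ)⁻¹) ^ v i ≤ (p : ℝ)⁻¹ * (2⁻¹) ^ (v i - 1) := by
          calc ((p : ℝ)⁻¹) ^ v i = (p : ℝ)⁻¹ * ((p : ℝ)⁻¹) ^ (v i - 1) := by
                rw [← pow_succ', Nat.sub_add_cancel hvi]
            _ ≤ _ := by gcongr
        have h2 : (2⁻¹ : ℝ) ^ (v i - 1) = 2 * 2⁻¹ ^ v i := by
          obtain ⟨m, hm⟩ := Nat.exists_eq_add_of_le' hvi
          rw [hm, Nat.add_sub_cancel, pow_succ]; ring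
        have h3 : (2⁻¹ : ℝ) ^ v i ≤ ∏ l, θ ^ v l := by
          calc (2⁻¹ : ℝ) ^ v i ≤ (θ ^ Fintype.card ι) ^ v i := by
                gcongr; simpa using hθ
            _ = ∏ _l : ι, θ ^ v i := by
                rw [Finset.prod_const, Finset.card_univ, ← pow_mul, ← pow_mul, mul_comm]
            _ ≤ ∏ l, θ ^ v l := by
                refine Finset.prod_le_prod (fun _ _ => by positivity) fun l _ => ?_
                exact pow_le_pow_of_le_one hθ0.le hθ1 (hi l (Finset.mem_univ _))
        have hp0 : 0 ≤ (p : ℝ)⁻¹ := by positivity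
        calc ((p : ℝ)⁻¹) ^ v i * (p : ℝ)⁻¹ ≤ ((p : ℝ)⁻¹ * (2 * ∏ l, θ ^ v l)) * (p : ℝ)⁻¹ := by
              refine mul_le_mul_of_nonneg_right (h1.trans ?_) hp0
              refine mul_le_mul_of_nonneg_left ?_ hp0
              rw [h2]; linarith
          _ = 2 * ((p : ℝ)⁻¹) ^ 2 * ∏ l, θ ^ v l := by ring
      · rintro x ⟨hx1, hx2⟩
        simp [hx1, hx2]
  · refine ⟨v, fun _ => le_rfl, ?_, ?_⟩
    · by_contra hcon
      push Not at hcon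
      obtain ⟨a, ha, b, hb, hab⟩ := Finset.one_lt_card.1 (lt_trans one_lt_two hcon)
      exact hv ⟨a, b, hab, (Finset.mem_filter.1 ha).2, (Finset.mem_filter.1 hb).2⟩
    · rw [localWeight, if_neg hv]

theorem prod_pow_factorization_eq {P : Finset ℕ} {q : ℕ} (hq : q ≠ 0)
    (h : q.primeFactors ⊆ P) : ∏ p ∈ P, p ^ q.factorization p = q := by
  conv_rhs => rw [← Nat.prod_factorization_pow_eq_self hq]
  rw [Finsupp.prod_of_support_subset _ (by simpa using h) _ (fun _ _ => pow_zero _)]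

open Classical in
/-- The density of `q j ∣ ψ_j(n)` equals `∏ 1 / q j` unless some prime divides two of the
moduli, and in that case both quantities are bounded by the product of the local weights. -/
theorem abs_residueCount_div_sub_le {θ : ℝ} (hθ0 : 0 < θ) (hθ1 : θ ≤ 1)
    (hθ : 1 / 2 ≤ θ ^ Fintype.card ι) {Ψ : ι → AffineForm d} {P : Finset ℕ}
    (hP : ∀ p ∈ P, p.Prime) (hΨ : ∀ p ∈ P, Unexceptional Ψ p) {q : ι → ℕ} (hq : ∀ j, q j ≠ 0)
    (hqP : ∀ j, (q j).primeFactors ⊆ P) (Q : ℕ) [NeZero Q] (hQ : ∀ j, q j ∣ Q) :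
    |(residueCount Ψ q Q : ℝ) / (Q : ℝ) ^ d - ∏ j, ((q j : ℝ))⁻¹| ≤
      if ∃ p ∈ P, Colliding fun j => (q j).factorization p then
        ∏ p ∈ P, localWeight θ p fun j => (q j).factorization p else 0 := by
  have hQ0 : (0 : ℝ) < (Q : ℝ) ^ d := by
    have : 0 < Q := NeZero.pos Q
    positivity
  have hexc : ∀ (r : ι → ℕ), (∀ j, r j ∣ q j) → ∀ p : ℕ, p.Prime → (∃ j, p ∣ r j) → p ∈ P := by
    rintro r hrq p hp ⟨j, hj⟩
    exact hqP j (Nat.mem_primeFactors.2 ⟨hp, hj.trans (hrq j), hq j⟩)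
  split_ifs with hcol
  · choose! ρ hρ1 hρ2 hρ3 using fun p (hp : p ∈ P) =>
      exists_exponents_le hθ0 hθ1 hθ (hP p hp).two_le fun j => (q j).factorization p
    set r : ι → ℕ := fun j => ∏ p ∈ P, p ^ ρ p j with hr
    have hrq : ∀ j, r j ∣ q j := by
      intro j
      rw [← prod_pow_factorization_eq (hq j) (hqP j)]
      exact Finset.prod_dvd_prod_of_dvd _ _ fun p hp => pow_dvd_pow p (hρ1 p hp j)
    have hr0 : ∀ j, r j ≠ 0 := fun j => ne_zero_of_dvd_ne_zero (hq j) (hrq j)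
    have hpr : ∀ p : ℕ, p.Prime → ∀ j, p ∣ r j → ρ p j ≠ 0 := by
      intro p hp j hj h0
      obtain ⟨p', hp', hpd⟩ := (Prime.dvd_finsetProd_iff hp.prime _).1 hj
      have : p = p' := (Nat.prime_dvd_prime_iff_eq hp (hP p' hp')).1 (hp.dvd_of_dvd_pow hpd)
      subst this
      rw [h0, pow_zero] at hpd
      exact hp.one_lt.ne' (Nat.dvd_one.1 hpd)
    have hcount := residueCount_mul_prod (Ψ := Ψ) hr0
      (fun p hp hex => hΨ p (hexc r hrq p hp hex))
      (fun p hp => by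
        by_cases hpP : p ∈ P
        · refine (Finset.card_le_card fun j hj => ?_).trans (hρ2 p hpP)
          simp only [Finset.mem_filter, Finset.mem_univ, true_and] at hj ⊢
          exact hpr p hp j hj
        · rw [Finset.card_eq_zero.2]
          · omega
          · refine Finset.filter_eq_empty_iff.2 fun j _ hj => hpP (hexc r hrq p hp ⟨j, hj⟩))
      Q (fun j => (hrq j).trans (hQ j))
    have hrpos : (0 : ℝ) < ∏ j, (r j : ℝ) :=
      Finset.prod_pos fun j _ => by exact_mod_cast Nat.pos_of_ne_zero (hr0 j)
    have hb : ∏ j, ((r j : ℝ))⁻¹ ≤ ∏ p ∈ P, localWeight θ p fun j => (q j).factorization p := by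
      calc ∏ j, ((r j : ℝ))⁻¹ = ∏ p ∈ P, ∏ j, ((p : ℝ)⁻¹) ^ ρ p j := by
            rw [Finset.prod_comm]
            refine Finset.prod_congr rfl fun j _ => ?_
            rw [hr]
            push_cast
            rw [← Finset.prod_inv_distrib]
            simp
        _ ≤ _ := Finset.prod_le_prod (fun p _ => by positivity) hρ3
    have h1 : (residueCount Ψ q Q : ℝ) / (Q : ℝ) ^ d ≤ ∏ j, ((r j : ℝ))⁻¹ := by
      rw [Finset.prod_inv_distrib, div_le_iff₀ hQ0, inv_mul_eq_div, le_div_iff₀ hrpos]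
      calc (residueCount Ψ q Q : ℝ) * ∏ j, (r j : ℝ)
          ≤ (residueCount Ψ r Q : ℝ) * ∏ j, (r j : ℝ) := by
            refine mul_le_mul_of_nonneg_right ?_ hrpos.le
            exact_mod_cast residueCount_le_of_dvd hrq Q
        _ = (Q : ℝ) ^ d := by exact_mod_cast hcount
    have h2 : ∏ j, ((q j : ℝ))⁻¹ ≤ ∏ j, ((r j : ℝ))⁻¹ := by
      refine Finset.prod_le_prod (fun _ _ => by positivity) fun j _ => ?_
      have : (0 : ℝ) < r j := by exact_mod_cast Nat.pos_of_ne_zero (hr0 j)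
      exact inv_anti₀ this (by
        exact_mod_cast Nat.le_of_dvd (Nat.pos_of_ne_zero (hq j)) (hrq j))
    have h3 : 0 ≤ (residueCount Ψ q Q : ℝ) / (Q : ℝ) ^ d := by positivity
    have h4 : 0 ≤ ∏ j, ((q j : ℝ))⁻¹ := by positivity
    rw [abs_le]
    constructor <;> linarith
  · push Not at hcol
    have hcount := residueCount_mul_prod (Ψ := Ψ) hq
      (fun p hp hex => hΨ p (hexc q (fun _ => dvd_rfl) p hp hex))
      (fun p hp => by
        by_contra hcon
        push Not at hcon
        obtain ⟨a, ha, b, hb, hab⟩ := Finset.one_lt_card.1 (lt_trans one_lt_two hcon)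
        have ha' := (Finset.mem_filter.1 ha).2
        have hb' := (Finset.mem_filter.1 hb).2
        refine hcol p (hexc q (fun _ => dvd_rfl) p hp ⟨a, ha'⟩) ⟨a, b, hab, ?_, ?_⟩
        · exact (hp.factorization_pos_of_dvd (hq a) ha').ne'
        · exact (hp.factorization_pos_of_dvd (hq b) hb').ne')
      Q hQ
    have hqpos : (0 : ℝ) < ∏ j, (q j : ℝ) :=
      Finset.prod_pos fun j _ => by exact_mod_cast Nat.pos_of_ne_zero (hq j)
    have : (residueCount Ψ q Q : ℝ) / (Q : ℝ) ^ d = ∏ j, ((q j : ℝ))⁻¹ := by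
      rw [Finset.prod_inv_distrib, div_eq_iff hQ0.ne', inv_mul_eq_div, eq_div_iff hqpos.ne']
      exact_mod_cast hcount
    rw [this, sub_self, abs_zero]

end DivisorMajorant

namespace DivisorMajorant

variable {ι : Type*} [Fintype ι] {d : ℕ}

/-! ### Lattice points in residue classes -/

/-- Divisibility of the values of a system by divisors of `Q` only depends on residues
modulo `Q`. -/
theorem dvd_eval_iff_dvd_eval_val {Q : ℕ} [NeZero Q] {r : ℕ} (hr : r ∣ Q) (ψ : AffineForm d)
    (n : Fin d → ℤ) :
    (r : ℤ) ∣ ψ.eval n ↔ (r : ℤ) ∣ ψ.eval fun k => (((n k : ZMod Q)).val : ℤ) := by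
  rw [← ZMod.intCast_zmod_eq_zero_iff_dvd, ← ZMod.intCast_zmod_eq_zero_iff_dvd, eval_intCast,
    eval_intCast]
  have : ∀ k, ((n k : ℤ) : ZMod r) = ((((n k : ZMod Q)).val : ℤ) : ZMod r) := by
    intro k
    rw [ZMod.val_intCast, ZMod.intCast_eq_intCast_iff]
    have : (n k) ≡ n k % Q [ZMOD Q] := (Int.mod_modEq _ _).symm
    exact this.of_dvd (Int.natCast_dvd_natCast.2 hr)
  simp only [this]

/-- The part of a convex set in a residue class modulo `Q`, rescaled, has the expected number
of lattice points. -/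
theorem abs_ncard_residueClass_sub_le {H : ℝ} (hH : 0 ≤ H) {K : Set (Fin d → ℝ)}
    (hc : Convex ℝ K) (hK : ∀ x ∈ K, ∀ k, |x k| ≤ H) (Q : ℕ) [NeZero Q] (a : Fin d → ZMod Q) :
    |(({n ∈ latticePoints K | ∀ k, (n k : ZMod Q) = a k}.ncard : ℕ) : ℝ) -
      volume.real K / (Q : ℝ) ^ d| ≤ d * (2 * H + 1) ^ (d - 1) := by
  have hQ1 : (1 : ℝ) ≤ Q := by exact_mod_cast NeZero.one_le
  have hQ0 : (0 : ℝ) < Q := by linarith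
  set b : Fin d → ℝ := fun k => ((a k).val : ℝ) with hb
  set K' : Set (Fin d → ℝ) := {x | b + (Q : ℝ) • x ∈ K} with hK'
  have hcK' : Convex ℝ K' := by
    intro x hx y hy s t hs ht hst
    have := hc hx hy hs ht hst
    simp only [hK', Set.mem_ofPred_eq]
    convert this using 1
    ext k
    simp only [Pi.add_apply, Pi.smul_apply, smul_eq_mul]
    linear_combination -(b k) * hst
  have hvol : volume.real K' = volume.real K / (Q : ℝ) ^ d := by
    have h1 : K' = (fun x => (Q : ℝ) • x) ⁻¹' ((fun x => b + x) ⁻¹' K) := rfl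
    rw [h1, measureReal_def, Measure.addHaar_preimage_smul _ hQ0.ne', measure_preimage_add,
      ENNReal.toReal_mul, ENNReal.toReal_ofReal (abs_nonneg _), Module.finrank_fin_fun,
      abs_of_nonneg (by positivity), measureReal_def]
    ring
  have hbox : ∀ x ∈ K', ∀ k, x k ∈ Set.Icc ((-H - b k) / Q) ((-H - b k) / Q + 2 * H) := by
    intro x hx k
    have := abs_le.1 (hK _ hx k)
    simp only [Pi.add_apply, Pi.smul_apply, smul_eq_mul] at this
    constructor
    · rw [div_le_iff₀ hQ0]; linarith
    · have h2 : (-H - b k) / Q + 2 * H / Q ≤ (-H - b k) / Q + 2 * H := by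
        gcongr
        exact div_le_self (by linarith) hQ1
      refine le_trans ?_ h2
      rw [← add_div, le_div_iff₀ hQ0]; linarith
  have hcard : {n ∈ latticePoints K | ∀ k, (n k : ZMod Q) = a k}.ncard =
      (latticePoints K').ncard := by
    symm
    refine Set.ncard_congr (fun m _ => fun k => ((a k).val : ℤ) + Q * m k) ?_ ?_ ?_
    · intro m hm
      refine ⟨?_, fun k => ?_⟩
      · simp only [latticePoints, Set.mem_ofPred_eq, hK'] at hm ⊢
        convert hm using 1
        ext k
        simp [hb]
      · push_cast
        simp
    · intro m m' _ _ h
      ext k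
      have := congrFun h k
      simp only [add_right_inj] at this
      exact mul_left_cancel₀ (by exact_mod_cast NeZero.ne Q) this
    · rintro n ⟨hn, hna⟩
      have hdvd : ∀ k, (Q : ℤ) ∣ n k - ((a k).val : ℤ) := by
        intro k
        rw [← ZMod.intCast_zmod_eq_zero_iff_dvd]
        push_cast
        rw [hna k]
        simp
      choose m hm using hdvd
      have hnm : n = fun k => ((a k).val : ℤ) + Q * m k := by
        ext k; rw [← hm k]; ring
      refine ⟨m, ?_, hnm.symm⟩
      simp only [latticePoints, Set.mem_ofPred_eq, hK'] at hn ⊢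
      convert hn using 1
      ext k
      simp [hb, hnm]
  rw [hcard, ← hvol]
  exact abs_ncard_latticePoints_sub_volume_le (by linarith) hcK' hbox

open Classical in
/-- Among the lattice points of a convex set, the proportion of those with `q j ∣ ψ_j(n)` for
all `j` is the density of that condition modulo `Q`. -/
theorem abs_card_filter_dvd_sub_le {H : ℝ} (hH : 0 ≤ H) {K : Set (Fin d → ℝ)}
    (hc : Convex ℝ K) (hK : ∀ x ∈ K, ∀ k, |x k| ≤ H) {S : Finset (Fin d → ℤ)}
    (hS : ∀ n, n ∈ S ↔ n ∈ latticePoints K) (Ψ : ι → AffineForm d) {q : ι → ℕ} (Q : ℕ)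
    [NeZero Q] (hQ : ∀ j, q j ∣ Q) :
    |((S.filter fun n => ∀ j, (q j : ℤ) ∣ (Ψ j).eval n).card : ℝ) -
      (residueCount Ψ q Q : ℝ) / (Q : ℝ) ^ d * volume.real K| ≤
      (Q : ℝ) ^ d * (d * (2 * H + 1) ^ (d - 1)) := by
  set G : Finset (Fin d → ZMod Q) := Finset.univ.filter fun a : Fin d → ZMod Q =>
    ∀ j, (q j : ℤ) ∣ (Ψ j).eval fun k => ((a k).val : ℤ) with hG
  have hGcard : residueCount Ψ q Q = G.card := by
    rw [residueCount, hG]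
  rw [Finset.card_eq_sum_card_fiberwise (f := fun n k => (n k : ZMod Q)) (t := G)]
  · have hfib : ∀ a ∈ G, ((S.filter fun n => ∀ j, (q j : ℤ) ∣ (Ψ j).eval n).filter
        fun n => (fun k => (n k : ZMod Q)) = a).card =
        {n ∈ latticePoints K | ∀ k, (n k : ZMod Q) = a k}.ncard := by
      intro a ha
      rw [← Set.ncard_coe_finset]
      congr 1
      ext n
      simp only [Finset.coe_filter, Finset.mem_filter, Set.mem_ofPred_eq, hS, funext_iff]
      constructor
      · rintro ⟨⟨h1, _⟩, h2⟩; exact ⟨h1, h2⟩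
      · rintro ⟨h1, h2⟩
        refine ⟨⟨h1, fun j => ?_⟩, h2⟩
        rw [dvd_eval_iff_dvd_eval_val (hQ j)]
        simp only [h2]
        exact (Finset.mem_filter.1 ha).2 j
    push_cast
    rw [Finset.sum_congr rfl fun a ha => congrArg (Nat.cast : ℕ → ℝ) (hfib a ha)]
    have : (residueCount Ψ q Q : ℝ) / (Q : ℝ) ^ d * volume.real K =
        ∑ _a ∈ G, volume.real K / (Q : ℝ) ^ d := by
      rw [Finset.sum_const, hGcard, nsmul_eq_mul]; ring
    rw [this, ← Finset.sum_sub_distrib]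
    refine (Finset.abs_sum_le_sum_abs _ _).trans ?_
    calc _ ≤ ∑ _a ∈ G, ((d : ℝ) * (2 * H + 1) ^ (d - 1)) :=
          Finset.sum_le_sum fun a _ => abs_ncard_residueClass_sub_le hH hc hK Q a
      _ = G.card * ((d : ℝ) * (2 * H + 1) ^ (d - 1)) := by rw [Finset.sum_const, nsmul_eq_mul]
      _ ≤ _ := by
        refine mul_le_mul_of_nonneg_right ?_ (by positivity)
        rw [← hGcard]
        exact_mod_cast residueCount_le Ψ q Q
  · intro n hn
    have hn := (Finset.mem_filter.1 hn).2
    simp only [hG, Finset.coe_filter, Finset.mem_univ, true_and, Set.mem_ofPred_eq]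
    exact fun j => (dvd_eval_iff_dvd_eval_val (hQ j) _ _).1 (hn j)

end DivisorMajorant

namespace DivisorMajorant

variable {ι : Type*} [Fintype ι]

/-! ### Euler products over tuples of divisors -/

/-- A sum of products of local factors over objects determined by their local data is at most
the product of the sums over all local data. -/
theorem sum_prod_le_prod_sum {α β γ : Type*} {X : Finset α} {P : Finset β} {G : α → β → γ}
    {A : β → Finset γ} (hG : ∀ x ∈ X, ∀ p ∈ P, G x p ∈ A p)
    (hinj : ∀ x ∈ X, ∀ x' ∈ X, (∀ p ∈ P, G x p = G x' p) → x = x') {f : β → γ → ℝ}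
    (hf : ∀ p ∈ P, ∀ v, 0 ≤ f p v) :
    ∑ x ∈ X, ∏ p ∈ P, f p (G x p) ≤ ∏ p ∈ P, ∑ v ∈ A p, f p v := by
  classical
  rw [Finset.prod_sum]
  set Φ : α → (∀ p ∈ P, γ) := fun x p _ => G x p with hΦ
  have h1 : ∑ x ∈ X, ∏ p ∈ P, f p (G x p) =
      ∑ g ∈ X.image Φ, ∏ p ∈ P.attach, f p.1 (g p.1 p.2) := by
    rw [Finset.sum_image]
    · exact Finset.sum_congr rfl fun x _ => (Finset.prod_attach P fun p => f p (G x p)).symm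
    · intro x hx x' hx' h
      exact hinj x hx x' hx' fun p hp => congrFun (congrFun h p) hp
  rw [h1]
  refine Finset.sum_le_sum_of_subset_of_nonneg ?_ fun g _ _ =>
    Finset.prod_nonneg fun p _ => hf _ p.2 _
  intro g hg
  obtain ⟨x, hx, rfl⟩ := Finset.mem_image.1 hg
  exact Finset.mem_pi.2 fun p hp => hG x hx p hp

/-- The local factor at `p` of a tuple of pairs `(u, d)` with exponents `v j` at `p`: the local
weight of the tuple of least common multiples, times `R` for each `u` divisible by `p`. -/
noncomputable def eulerFactor (θ R : ℝ) (p : ℕ) (v : ι → ℕ × ℕ) : ℝ :=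
  localWeight θ p (fun j => max (v j).1 (v j).2) * ∏ j, R ^ (v j).1

/-- Possible exponents at a prime: the exponent of `u j` is at most `ε j`, the exponent of the
other variable at most `L`. -/
def exponentBox (L : ℕ) (ε : ι → ℕ) [DecidableEq ι] : Finset (ι → ℕ × ℕ) :=
  Fintype.piFinset fun j => Finset.range (ε j + 1) ×ˢ Finset.range (L + 1)

theorem sum_range_pow_le {x : ℝ} (hx0 : 0 ≤ x) (hx1 : x < 1) (n : ℕ) :
    ∑ a ∈ Finset.range n, x ^ a ≤ (1 - x)⁻¹ := by
  rw [← tsum_geometric_of_lt_one hx0 hx1]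
  exact (summable_geometric_of_lt_one hx0 hx1).sum_le_tsum _ fun _ _ => by positivity

theorem sum_pow_max_mul_le {x R : ℝ} (hx0 : 0 ≤ x) (hx1 : x < 1) (hR : 0 ≤ R) (L : ℕ) {ε : ℕ}
    (hε : ε ≤ 1) :
    ∑ y ∈ Finset.range (ε + 1) ×ˢ Finset.range (L + 1), x ^ max y.1 y.2 * R ^ y.1 ≤
      (1 - x)⁻¹ * (1 + 2 * R * (ε * x)) := by
  have hinv : 1 ≤ (1 - x)⁻¹ := (one_le_inv₀ (by linarith)).2 (by linarith)
  rw [Finset.sum_product]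
  interval_cases ε
  · simpa using sum_range_pow_le hx0 hx1 (L + 1)
  · simp only [Finset.sum_range_succ, Finset.range_zero, Finset.sum_empty, zero_add, pow_zero,
      mul_one, pow_one, ← Finset.sum_mul]
    have h0 : ∑ a ∈ Finset.range L, x ^ max 0 a + x ^ max 0 L ≤ (1 - x)⁻¹ := by
      rw [← Finset.sum_range_succ]
      simpa using sum_range_pow_le hx0 hx1 (L + 1)
    have h1 : ∑ a ∈ Finset.range L, x ^ max 1 a + x ^ max 1 L ≤ x + x * (1 - x)⁻¹ := by
      rw [← Finset.sum_range_succ (fun a => x ^ max 1 a), Finset.sum_range_succ']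
      have : ∑ k ∈ Finset.range L, x ^ max 1 (k + 1) = x * ∑ k ∈ Finset.range L, x ^ k := by
        rw [Finset.mul_sum]
        refine Finset.sum_congr rfl fun k _ => ?_
        rw [max_eq_right (by omega), pow_succ']
      rw [this]
      have := mul_le_mul_of_nonneg_left (sum_range_pow_le hx0 hx1 L) hx0
      simp only [max_eq_left (Nat.zero_le 1), pow_one]
      linarith
    have h2 : x + x * (1 - x)⁻¹ ≤ 2 * x * (1 - x)⁻¹ := by nlinarith
    have h3 := mul_le_mul_of_nonneg_right (h1.trans h2) hR
    push_cast
    nlinarith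

theorem sum_pow_max_mul_le' {θ R : ℝ} (hθ0 : 0 ≤ θ) (hθ1 : θ < 1) (hR : 0 ≤ R) (L : ℕ) {ε : ℕ}
    (hε : ε ≤ 1) :
    ∑ y ∈ Finset.range (ε + 1) ×ˢ Finset.range (L + 1), θ ^ max y.1 y.2 * R ^ y.1 ≤
      (1 + R) / (1 - θ) := by
  calc ∑ y ∈ Finset.range (ε + 1) ×ˢ Finset.range (L + 1), θ ^ max y.1 y.2 * R ^ y.1
      ≤ ∑ y ∈ Finset.range (ε + 1) ×ˢ Finset.range (L + 1), R ^ y.1 * θ ^ y.2 := by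
        refine Finset.sum_le_sum fun y _ => ?_
        rw [mul_comm]
        gcongr ?_ * ?_
        exact pow_le_pow_of_le_one hθ0 hθ1.le (le_max_right _ _)
    _ = (∑ e ∈ Finset.range (ε + 1), R ^ e) * ∑ a ∈ Finset.range (L + 1), θ ^ a := by
        rw [Finset.sum_product, Finset.sum_mul_sum]
    _ ≤ (1 + R) * (1 - θ)⁻¹ := by
        refine mul_le_mul ?_ (sum_range_pow_le hθ0 hθ1 _) (by positivity) (by positivity)
        interval_cases ε
        · simpa using hR
        · simp [Finset.sum_range_succ]
    _ = (1 + R) / (1 - θ) := by rw [div_eq_mul_inv]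

/-- The constant in the Euler factors. -/
noncomputable def collisionConst (θ R : ℝ) (t : ℕ) : ℝ := 2 * ((1 + R) / (1 - θ)) ^ t

theorem eulerFactor_nonneg {θ R : ℝ} (hθ : 0 ≤ θ) (hR : 0 ≤ R) (p : ℕ) (v : ι → ℕ × ℕ) :
    0 ≤ eulerFactor θ R p v :=
  mul_nonneg (localWeight_nonneg hθ _ _) (by positivity)

section

variable [DecidableEq ι]

theorem one_le_sum_eulerFactor {θ R : ℝ} (hθ : 0 ≤ θ) (hR : 0 ≤ R) (p L : ℕ) (ε : ι → ℕ) :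
    1 ≤ ∑ v ∈ exponentBox L ε, eulerFactor θ R p v := by
  have h0 : (fun _ => (0, 0) : ι → ℕ × ℕ) ∈ exponentBox L ε := by simp [exponentBox]
  refine le_trans (le_of_eq ?_)
    (Finset.single_le_sum (fun v _ => eulerFactor_nonneg hθ hR p v) h0)
  simp [eulerFactor, localWeight, Colliding]

open Classical in
/-- The colliding part of a local sum gains `p⁻²`. -/
theorem sum_eulerFactor_colliding_le {θ R : ℝ} (hθ0 : 0 ≤ θ) (hθ1 : θ < 1) (hR : 0 ≤ R)
    (p L : ℕ) {ε : ι → ℕ} (hε : ∀ j, ε j ≤ 1) :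
    ∑ v ∈ exponentBox L ε, (if Colliding fun j => max (v j).1 (v j).2 then
      eulerFactor θ R p v else 0) ≤
      collisionConst θ R (Fintype.card ι) * ((p : ℝ)⁻¹) ^ 2 := by
  calc _ ≤ ∑ v ∈ exponentBox L ε, 2 * ((p : ℝ)⁻¹) ^ 2 *
        ∏ j, (θ ^ max (v j).1 (v j).2 * R ^ (v j).1) := by
        refine Finset.sum_le_sum fun v _ => ?_
        split_ifs with h
        · rw [eulerFactor, localWeight, if_pos h, Finset.prod_mul_distrib, mul_assoc]
        · positivity
    _ = 2 * ((p : ℝ)⁻¹) ^ 2 * ∏ j, ∑ y ∈ Finset.range (ε j + 1) ×ˢ Finset.range (L + 1),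
          (θ ^ max y.1 y.2 * R ^ y.1) := by
        rw [← Finset.mul_sum, exponentBox, ← Finset.prod_univ_sum (fun j : ι =>
          Finset.range (ε j + 1) ×ˢ Finset.range (L + 1))
          (fun _ y => θ ^ max y.1 y.2 * R ^ y.1)]
    _ ≤ 2 * ((p : ℝ)⁻¹) ^ 2 * ∏ _j : ι, ((1 + R) / (1 - θ)) := by
        refine mul_le_mul_of_nonneg_left (Finset.prod_le_prod (fun j _ => ?_) fun j _ =>
          sum_pow_max_mul_le' hθ0 hθ1 hR L (hε j)) (by positivity)
        exact Finset.sum_nonneg fun _ _ => by positivity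
    _ = _ := by
        rw [collisionConst, Finset.prod_const, Finset.card_univ]; ring

/-- A local sum is the Euler factor of the variables `d`, up to a factor whose product over all
primes stays bounded: `R / p` is only charged at primes that may divide some `u j`. -/
theorem sum_eulerFactor_le {θ R : ℝ} (hθ0 : 0 ≤ θ) (hθ1 : θ < 1) (hR : 0 ≤ R)
    {p : ℕ} (hp : 2 ≤ p) (L : ℕ) {ε : ι → ℕ} (hε : ∀ j, ε j ≤ 1) :
    ∑ v ∈ exponentBox L ε, eulerFactor θ R p v ≤
      ((1 - (p : ℝ)⁻¹)⁻¹) ^ Fintype.card ι * Real.exp (2 * R * ∑ j, (ε j * (p : ℝ)⁻¹) +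
        collisionConst θ R (Fintype.card ι) * ((p : ℝ)⁻¹) ^ 2) := by
  classical
  set K := collisionConst θ R (Fintype.card ι) with hK
  have hK0 : 0 ≤ K := by
    have : 0 ≤ (1 + R) / (1 - θ) := div_nonneg (by linarith) (by linarith)
    rw [hK, collisionConst]; positivity
  set x : ℝ := (p : ℝ)⁻¹ with hx
  have hx0 : 0 ≤ x := by positivity
  have hx1 : x < 1 := inv_lt_one_of_one_lt₀ (by exact_mod_cast hp)
  have hinv : 1 ≤ (1 - x)⁻¹ := (one_le_inv₀ (by linarith)).2 (by linarith)
  have h1 : ∑ v ∈ exponentBox L ε, eulerFactor θ R p v ≤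
      ∑ v ∈ exponentBox L ε, ∏ j, (x ^ max (v j).1 (v j).2 * R ^ (v j).1) +
      ∑ v ∈ exponentBox L ε, (if Colliding fun j => max (v j).1 (v j).2 then
        eulerFactor θ R p v else 0) := by
    rw [← Finset.sum_add_distrib]
    refine Finset.sum_le_sum fun v _ => ?_
    split_ifs with h
    · have : 0 ≤ ∏ j, (x ^ max (v j).1 (v j).2 * R ^ (v j).1) :=
        Finset.prod_nonneg fun _ _ => by positivity
      linarith
    · rw [eulerFactor, localWeight, if_neg h, Finset.prod_mul_distrib, add_zero]
  have h2 : ∑ v ∈ exponentBox L ε, ∏ j, (x ^ max (v j).1 (v j).2 * R ^ (v j).1) ≤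
      ((1 - x)⁻¹) ^ Fintype.card ι * Real.exp (2 * R * ∑ j, (ε j * x)) := by
    rw [exponentBox, ← Finset.prod_univ_sum (fun j : ι =>
      Finset.range (ε j + 1) ×ˢ Finset.range (L + 1))
      (fun _ y => x ^ max y.1 y.2 * R ^ y.1)]
    calc _ ≤ ∏ j, ((1 - x)⁻¹ * Real.exp (2 * R * (ε j * x))) := by
          refine Finset.prod_le_prod (fun j _ => Finset.sum_nonneg fun _ _ => by positivity)
            fun j _ => (sum_pow_max_mul_le hx0 hx1 hR L (hε j)).trans ?_
          refine mul_le_mul_of_nonneg_left ?_ (by linarith)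
          have := Real.add_one_le_exp (2 * R * (ε j * x))
          linarith
      _ = _ := by
          rw [Finset.prod_mul_distrib, Finset.prod_const, Finset.card_univ, ← Real.exp_sum,
            Finset.mul_sum]
  have h3 := sum_eulerFactor_colliding_le hθ0 hθ1 hR p L hε
  set E := Real.exp (2 * R * ∑ j, (ε j * x)) with hE
  have hE1 : 1 ≤ E := Real.one_le_exp (by
    have : 0 ≤ ∑ j, ((ε j : ℝ) * x) := Finset.sum_nonneg fun _ _ => by positivity
    positivity)
  have hX1 : 1 ≤ ((1 - x)⁻¹) ^ Fintype.card ι := one_le_pow₀ hinv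
  rw [Real.exp_add]
  have h4 := Real.add_one_le_exp (K * x ^ 2)
  have h5 : 0 ≤ K * x ^ 2 := by positivity
  have h6 : 1 ≤ ((1 - x)⁻¹) ^ Fintype.card ι * E := one_le_mul_of_one_le_of_one_le hX1 hE1
  calc _ ≤ ((1 - x)⁻¹) ^ Fintype.card ι * E + K * x ^ 2 := h1.trans (add_le_add h2 h3)
    _ ≤ ((1 - x)⁻¹) ^ Fintype.card ι * E * (1 + K * x ^ 2) := by nlinarith
    _ ≤ ((1 - x)⁻¹) ^ Fintype.card ι * E * Real.exp (K * x ^ 2) := by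
        refine mul_le_mul_of_nonneg_left ?_ (by linarith); linarith
    _ = _ := by ring

open Classical in
/-- The total weight of tuples of pairs `(u, d)` for which some prime divides two of the least
common multiples. The condition `ω(u j) = m j` is relaxed by Rankin's trick to the factor
`R ^ (ω(u j) - m j)`, after which everything factors over primes. -/
theorem sum_colliding_le {θ R : ℝ} (hθ0 : 0 ≤ θ) (hθ1 : θ < 1) (hR : 0 < R)
    {P : Finset ℕ} (hP : ∀ p ∈ P, p.Prime) {A : ι → Finset ℕ} (hA : ∀ j, A j ⊆ P)
    {m : ι → ℕ} {X : ι → Finset (ℕ × ℕ)}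
    (hu : ∀ j, ∀ y ∈ X j, Squarefree y.1 ∧ y.1.primeFactors ⊆ A j ∧ y.1.primeFactors.card = m j)
    (hd : ∀ j, ∀ y ∈ X j, y.2 ≠ 0 ∧ y.2.primeFactors ⊆ P) :
    ∑ y ∈ Fintype.piFinset X,
      (if ∃ p ∈ P, Colliding fun j => (Nat.lcm (y j).1 (y j).2).factorization p then
        ∏ p ∈ P, localWeight θ p fun j => (Nat.lcm (y j).1 (y j).2).factorization p else 0) ≤
    (∏ j, (R⁻¹) ^ m j) * (collisionConst θ R (Fintype.card ι) * ∑ p ∈ P, ((p : ℝ)⁻¹) ^ 2) *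
      ((∏ p ∈ P, (1 - (p : ℝ)⁻¹)⁻¹) ^ Fintype.card ι *
        Real.exp (2 * R * ∑ j, ∑ p ∈ A j, (p : ℝ)⁻¹ +
          collisionConst θ R (Fintype.card ι) * ∑ p ∈ P, ((p : ℝ)⁻¹) ^ 2)) := by
  set K := collisionConst θ R (Fintype.card ι) with hK
  have hK0 : 0 ≤ K := by
    have : 0 ≤ (1 + R) / (1 - θ) := div_nonneg (by linarith) (by linarith)
    rw [hK, collisionConst]; positivity
  obtain ⟨L, hL⟩ : ∃ L : ℕ, ∀ j, ∀ y ∈ X j, y.2 ≤ L := by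
    refine ⟨∑ j, ∑ y ∈ X j, y.2, fun j y hy => ?_⟩
    exact (Finset.single_le_sum (f := fun y : ℕ × ℕ => y.2) (fun _ _ => Nat.zero_le _) hy).trans
      (Finset.single_le_sum (f := fun j => ∑ y ∈ X j, y.2) (fun _ _ => Nat.zero_le _)
        (Finset.mem_univ j))
  set ε : ℕ → ι → ℕ := fun p j => if p ∈ A j then 1 else 0 with hε
  have hε1 : ∀ p j, ε p j ≤ 1 := fun p j => by simp only [hε]; split_ifs <;> omega
  set G : (ι → ℕ × ℕ) → ℕ → (ι → ℕ × ℕ) :=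
    fun y p j => ((y j).1.factorization p, (y j).2.factorization p) with hG
  have hmemX : ∀ y ∈ Fintype.piFinset X, ∀ j, y j ∈ X j := fun y hy => Fintype.mem_piFinset.1 hy
  have hu0 : ∀ j, ∀ y ∈ X j, y.1 ≠ 0 := fun j y hy => (hu j y hy).1.ne_zero
  -- the exponents of a tuple lie in the boxes and determine the tuple
  have hGA : ∀ y ∈ Fintype.piFinset X, ∀ p ∈ P, G y p ∈ exponentBox L (ε p) := by
    intro y hy p _
    rw [exponentBox, Fintype.mem_piFinset]
    intro j
    have hyj := hmemX y hy j
    simp only [hG, Finset.mem_product, Finset.mem_range]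
    refine ⟨?_, ?_⟩
    · rw [Nat.lt_succ_iff]
      by_cases h : p ∈ A j
      · simpa [hε, h] using (hu j _ hyj).1.natFactorization_le_one p
      · have : p ∉ (y j).1.primeFactors := fun h' => h ((hu j _ hyj).2.1 h')
        rw [← Nat.support_factorization, Finsupp.notMem_support_iff] at this
        omega
    · exact lt_of_lt_of_le (Nat.factorization_lt p (hd j _ hyj).1)
        ((hL j _ hyj).trans (Nat.le_succ L))
  have hGinj : ∀ y ∈ Fintype.piFinset X, ∀ y' ∈ Fintype.piFinset X,
      (∀ p ∈ P, G y p = G y' p) → y = y' := by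
    intro y hy y' hy' h
    ext j
    · have h1 := prod_pow_factorization_eq (hu0 j _ (hmemX y hy j))
        (((hu j _ (hmemX y hy j)).2.1).trans (hA j))
      have h2 := prod_pow_factorization_eq (hu0 j _ (hmemX y' hy' j))
        (((hu j _ (hmemX y' hy' j)).2.1).trans (hA j))
      rw [← h1, ← h2]
      refine Finset.prod_congr rfl fun p hp => ?_
      have := congrArg Prod.fst (congrFun (h p hp) j)
      simp only [hG] at this
      rw [this]
    · have h1 := prod_pow_factorization_eq (hd j _ (hmemX y hy j)).1 (hd j _ (hmemX y hy j)).2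
      have h2 := prod_pow_factorization_eq (hd j _ (hmemX y' hy' j)).1
        (hd j _ (hmemX y' hy' j)).2
      rw [← h1, ← h2]
      refine Finset.prod_congr rfl fun p hp => ?_
      have := congrArg Prod.snd (congrFun (h p hp) j)
      simp only [hG] at this
      rw [this]
  -- the weight of a tuple is a product of Euler factors
  have hfac : ∀ y ∈ Fintype.piFinset X, ∀ p,
      (fun j => (Nat.lcm (y j).1 (y j).2).factorization p) =
        fun j => max (G y p j).1 (G y p j).2 := by
    intro y hy p
    ext j
    rw [Nat.factorization_lcm (hu0 j _ (hmemX y hy j)) (hd j _ (hmemX y hy j)).1]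
    rfl
  have hweight : ∀ y ∈ Fintype.piFinset X,
      ∏ p ∈ P, localWeight θ p (fun j => (Nat.lcm (y j).1 (y j).2).factorization p) =
        (∏ j, (R⁻¹) ^ m j) * ∏ p ∈ P, eulerFactor θ R p (G y p) := by
    intro y hy
    have h1 : ∏ p ∈ P, ∏ j, R ^ (G y p j).1 = ∏ j, R ^ m j := by
      rw [Finset.prod_comm]
      refine Finset.prod_congr rfl fun j _ => ?_
      have hyj := hu j _ (hmemX y hy j)
      rw [Finset.prod_pow_eq_pow_sum]
      congr 1
      rw [← hyj.2.2, Finset.card_eq_sum_ones]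
      symm
      refine (Finset.sum_subset_zero_on_sdiff (hyj.2.1.trans (hA j)) ?_ ?_)
      · intro p hp
        have := (Finset.mem_sdiff.1 hp).2
        rwa [← Nat.support_factorization, Finsupp.notMem_support_iff] at this
      · intro p hp
        have h3 := hyj.1.natFactorization_le_one p
        have h4 : (y j).1.factorization p ≠ 0 := by
          rwa [← Finsupp.mem_support_iff, Nat.support_factorization]
        simp only [hG]
        omega
    have h2 : (∏ j, (R⁻¹) ^ m j) * ∏ j, R ^ m j = 1 := by
      rw [← Finset.prod_mul_distrib]
      refine Finset.prod_eq_one fun j _ => ?_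
      rw [← mul_pow, inv_mul_cancel₀ hR.ne', one_pow]
    simp only [eulerFactor]
    rw [Finset.prod_mul_distrib, h1, mul_left_comm, h2, mul_one]
    exact Finset.prod_congr rfl fun p _ => by rw [hfac y hy p]
  set c := ∏ j, (R⁻¹) ^ m j with hc
  have hc0 : 0 ≤ c := by positivity
  -- single out a colliding prime `p₀`
  set f : ℕ → ℕ → (ι → ℕ × ℕ) → ℝ := fun p₀ p v =>
    if p = p₀ then (if Colliding fun j => max (v j).1 (v j).2 then eulerFactor θ R p v else 0)
    else eulerFactor θ R p v with hf
  have hf0 : ∀ p₀ p v, 0 ≤ f p₀ p v := by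
    intro p₀ p v
    have := eulerFactor_nonneg hθ0 hR.le p v
    simp only [hf]
    split_ifs <;> first | exact this | exact le_rfl
  have hstep : ∀ y ∈ Fintype.piFinset X,
      (if ∃ p ∈ P, Colliding fun j => (Nat.lcm (y j).1 (y j).2).factorization p then
        ∏ p ∈ P, localWeight θ p fun j => (Nat.lcm (y j).1 (y j).2).factorization p else 0) ≤
      c * ∑ p₀ ∈ P, ∏ p ∈ P, f p₀ p (G y p) := by
    intro y hy
    split_ifs with h
    · obtain ⟨p₀, hp₀, hcol⟩ := h
      rw [hweight y hy]
      refine mul_le_mul_of_nonneg_left ?_ hc0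
      refine le_trans (le_of_eq ?_) (Finset.single_le_sum
        (f := fun p₀ => ∏ p ∈ P, f p₀ p (G y p))
        (fun p _ => Finset.prod_nonneg fun _ _ => hf0 _ _ _) hp₀)
      refine Finset.prod_congr rfl fun p _ => ?_
      simp only [hf]
      split_ifs with h1 h2
      · rfl
      · subst h1
        rw [hfac y hy p] at hcol
        exact absurd hcol h2
      · rfl
    · exact mul_nonneg hc0 (Finset.sum_nonneg fun p _ =>
        Finset.prod_nonneg fun _ _ => hf0 _ _ _)
  set T := ∏ p ∈ P, ∑ v ∈ exponentBox L (ε p), eulerFactor θ R p v with hT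
  have hlocal : ∀ p₀ ∈ P, ∏ p ∈ P, ∑ v ∈ exponentBox L (ε p), f p₀ p v ≤
      K * ((p₀ : ℝ)⁻¹) ^ 2 * T := by
    intro p₀ hp₀
    rw [hT, ← Finset.mul_prod_erase P _ hp₀, ← Finset.mul_prod_erase P (fun p =>
      ∑ v ∈ exponentBox L (ε p), eulerFactor θ R p v) hp₀]
    have e1 : ∏ p ∈ P.erase p₀, ∑ v ∈ exponentBox L (ε p), f p₀ p v =
        ∏ p ∈ P.erase p₀, ∑ v ∈ exponentBox L (ε p), eulerFactor θ R p v := by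
      refine Finset.prod_congr rfl fun p hp => Finset.sum_congr rfl fun v _ => ?_
      simp only [hf, if_neg (Finset.ne_of_mem_erase hp)]
    have e2 : ∑ v ∈ exponentBox L (ε p₀), f p₀ p₀ v ≤ K * ((p₀ : ℝ)⁻¹) ^ 2 := by
      simp only [hf, if_true]
      exact sum_eulerFactor_colliding_le hθ0 hθ1 hR.le p₀ L (hε1 p₀)
    have e3 := one_le_sum_eulerFactor hθ0 hR.le p₀ L (ε p₀)
    have e4 : 0 ≤ ∏ p ∈ P.erase p₀, ∑ v ∈ exponentBox L (ε p), eulerFactor θ R p v :=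
      Finset.prod_nonneg fun p _ => Finset.sum_nonneg fun v _ => eulerFactor_nonneg hθ0 hR.le p v
    rw [e1]
    calc _ ≤ K * ((p₀ : ℝ)⁻¹) ^ 2 *
          ∏ p ∈ P.erase p₀, ∑ v ∈ exponentBox L (ε p), eulerFactor θ R p v :=
          mul_le_mul_of_nonneg_right e2 e4
      _ ≤ _ := by
          refine mul_le_mul_of_nonneg_left ?_ (by positivity)
          exact le_mul_of_one_le_left e4 e3
  have hTle : T ≤ (∏ p ∈ P, (1 - (p : ℝ)⁻¹)⁻¹) ^ Fintype.card ι *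
        Real.exp (2 * R * ∑ j, ∑ p ∈ A j, (p : ℝ)⁻¹ + K * ∑ p ∈ P, ((p : ℝ)⁻¹) ^ 2) := by
    rw [hT]
    calc _ ≤ ∏ p ∈ P, (((1 - (p : ℝ)⁻¹)⁻¹) ^ Fintype.card ι *
          Real.exp (2 * R * ∑ j, (ε p j * (p : ℝ)⁻¹) + K * ((p : ℝ)⁻¹) ^ 2)) :=
          Finset.prod_le_prod (fun p _ => Finset.sum_nonneg fun v _ =>
            eulerFactor_nonneg hθ0 hR.le p v) fun p hp =>
            sum_eulerFactor_le hθ0 hθ1 hR.le (hP p hp).two_le L (hε1 p)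
      _ = _ := by
          rw [Finset.prod_mul_distrib, Finset.prod_pow, ← Real.exp_sum, Finset.sum_add_distrib,
            ← Finset.mul_sum, ← Finset.mul_sum, Finset.sum_comm]
          congr 4
          refine Finset.sum_congr rfl fun j _ => ?_
          simp only [hε]
          push_cast
          simp only [ite_mul, one_mul, zero_mul]
          rw [← Finset.sum_filter]
          refine Finset.sum_congr ?_ fun _ _ => rfl
          ext p
          simp only [Finset.mem_filter, and_iff_right_iff_imp]
          exact fun h => hA j h
  calc _ ≤ ∑ y ∈ Fintype.piFinset X, c * ∑ p₀ ∈ P, ∏ p ∈ P, f p₀ p (G y p) :=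
        Finset.sum_le_sum hstep
    _ = c * ∑ p₀ ∈ P, ∑ y ∈ Fintype.piFinset X, ∏ p ∈ P, f p₀ p (G y p) := by
        rw [← Finset.mul_sum, Finset.sum_comm]
    _ ≤ c * ∑ p₀ ∈ P, K * ((p₀ : ℝ)⁻¹) ^ 2 * T := by
        refine mul_le_mul_of_nonneg_left (Finset.sum_le_sum fun p₀ hp₀ => ?_) hc0
        exact (sum_prod_le_prod_sum hGA hGinj fun p _ v => hf0 p₀ p v).trans (hlocal p₀ hp₀)
    _ = c * (K * ∑ p₀ ∈ P, ((p₀ : ℝ)⁻¹) ^ 2) * T := by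
        rw [← Finset.sum_mul, ← Finset.mul_sum]; ring
    _ ≤ _ := by
        refine mul_le_mul_of_nonneg_left hTle ?_
        have : 0 ≤ ∑ p ∈ P, ((p : ℝ)⁻¹) ^ 2 := Finset.sum_nonneg fun _ _ => by positivity
        positivity

end

end DivisorMajorant

namespace DivisorMajorant

/-! ### The majorant as a combination of divisibility conditions -/

/-- The index set of the majorant: the base term `none` and the pairs `(s, i)`. -/
noncomputable def levels (γ : ℝ) (N : ℕ) : Finset (Option (Σ _ : ℕ, ℕ)) :=
  Finset.insertNone ((Finset.Ioc ⌊2 / γ⌋₊ ⌊Real.log (Real.log N) ^ 3⌋₊).sigma fun s =>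
    Finset.Icc ⌈Real.logb 2 s - 2⌉₊ ⌊6 * Real.log (Real.log (Real.log N))⌋₊)

/-- The factor `2 ^ s` of a level; the base term has `s = 2 / γ`. -/
noncomputable def levelWeight (γ : ℝ) : Option (Σ _ : ℕ, ℕ) → ℝ
  | none => 2 ^ (2 / γ)
  | some x => 2 ^ x.1

/-- The set `U(i, s)` of a level. -/
noncomputable def levelU (γ : ℝ) (N : ℕ) : Option (Σ _ : ℕ, ℕ) → Finset ℕ
  | none => {1}
  | some x => U γ N x.2 x.1

/-- The primes from which the elements of `U(i, s)` are built. -/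
noncomputable def levelPrimes (N : ℕ) : Option (Σ _ : ℕ, ℕ) → Finset ℕ
  | none => ∅
  | some x => dyadicPrimes N x.2

/-- The number of prime factors of the elements of `U(i, s)`. -/
noncomputable def levelCard (γ : ℝ) : Option (Σ _ : ℕ, ℕ) → ℕ
  | none => 0
  | some x => m₀ γ x.2 x.1

/-- The divisors counted by `truncTau`. -/
noncomputable def tauDivisors (γ : ℝ) (N : ℕ) : Finset ℕ :=
  (Finset.Icc 1 ⌊(N : ℝ) ^ γ⌋₊).filter fun d : ℕ => Nat.Coprime d (W N)

/-- The normalising factor of `truncTau`. -/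
noncomputable def tauConst (γ : ℝ) (N : ℕ) : ℝ :=
  (W N : ℝ) / (Nat.totient (W N) : ℝ) * (γ * Real.log N)⁻¹

/-- The pairs `(u, d)` that contribute to a level. -/
noncomputable def levelPairs (γ : ℝ) (N : ℕ) (k : Option (Σ _ : ℕ, ℕ)) : Finset (ℕ × ℕ) :=
  levelU γ N k ×ˢ tauDivisors γ N

/-- The mean value `∑ c_q / q` of the majorant `∑ c_q 1_{q ∣ n}`. -/
noncomputable def meanSum (γ : ℝ) (N : ℕ) : ℝ :=
  ∑ k ∈ levels γ N, ∑ y ∈ levelPairs γ N k,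
    levelWeight γ k * tauConst γ N * ((Nat.lcm y.1 y.2 : ℕ) : ℝ)⁻¹

/-- The sum of all coefficients of the majorant `∑ c_q 1_{q ∣ n}`. -/
noncomputable def totalSum (γ : ℝ) (N : ℕ) : ℝ :=
  ∑ k ∈ levels γ N, ∑ _y ∈ levelPairs γ N k, levelWeight γ k * tauConst γ N

theorem levelWeight_nonneg (γ : ℝ) (k : Option (Σ _ : ℕ, ℕ)) : 0 ≤ levelWeight γ k := by
  cases k <;> simp only [levelWeight] <;> positivity

theorem tauConst_nonneg {γ : ℝ} (hγ : 0 < γ) (N : ℕ) : 0 ≤ tauConst γ N := by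
  have : 0 ≤ Real.log N := Real.log_natCast_nonneg N
  unfold tauConst
  positivity

theorem truncTau_eq_sum (γ : ℝ) (N : ℕ) (n : ℤ) :
    truncTau γ N n = ∑ d ∈ tauDivisors γ N, tauConst γ N * (if (d : ℤ) ∣ n then 1 else 0) := by
  rw [truncTau, ← Finset.mul_sum, Finset.sum_boole, tauDivisors, Finset.filter_filter]
  rfl

theorem nuSum_eq_sum (γ : ℝ) (N : ℕ) (n : ℤ) :
    nuSum γ N n = ∑ k ∈ levels γ N, ∑ y ∈ levelPairs γ N k,
      levelWeight γ k * tauConst γ N * (if ((Nat.lcm y.1 y.2 : ℕ) : ℤ) ∣ n then 1 else 0) := by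
  have hpair : ∀ k, ∑ y ∈ levelPairs γ N k, levelWeight γ k * tauConst γ N *
      (if ((Nat.lcm y.1 y.2 : ℕ) : ℤ) ∣ n then (1 : ℝ) else 0) =
      ∑ u ∈ levelU γ N k, levelWeight γ k * (if (u : ℤ) ∣ n then 1 else 0) * truncTau γ N n := by
    intro k
    rw [levelPairs, Finset.sum_product]
    refine Finset.sum_congr rfl fun u _ => ?_
    rw [truncTau_eq_sum, Finset.mul_sum]
    refine Finset.sum_congr rfl fun d _ => ?_
    have : ((Nat.lcm u d : ℕ) : ℤ) ∣ n ↔ (u : ℤ) ∣ n ∧ (d : ℤ) ∣ n := by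
      rw [Int.natCast_dvd, Int.natCast_dvd, Int.natCast_dvd, Nat.lcm_dvd_iff]
    by_cases h1 : (u : ℤ) ∣ n <;> by_cases h2 : (d : ℤ) ∣ n <;> simp [this, h1, h2]
  simp only [hpair]
  rw [levels, Finset.sum_insertNone, Finset.sum_sigma, nuSum]
  simp [levelWeight, levelU]

theorem nuSum_nonneg {γ : ℝ} (hγ : 0 < γ) (N : ℕ) (n : ℤ) : 0 ≤ nuSum γ N n := by
  rw [nuSum_eq_sum]
  refine Finset.sum_nonneg fun k _ => Finset.sum_nonneg fun y _ => ?_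
  have := levelWeight_nonneg γ k
  have := tauConst_nonneg hγ N
  positivity

theorem nuSum_le_totalSum {γ : ℝ} (hγ : 0 < γ) (N : ℕ) (n : ℤ) : nuSum γ N n ≤ totalSum γ N := by
  rw [nuSum_eq_sum, totalSum]
  refine Finset.sum_le_sum fun k _ => Finset.sum_le_sum fun y _ => ?_
  have h1 := levelWeight_nonneg γ k
  have h2 := tauConst_nonneg hγ N
  split_ifs
  · rw [mul_one]
  · rw [mul_zero]; positivity

/-- The primes in `(w(N), N]`; all moduli of the majorant are composed of these. -/
noncomputable def largePrimes (N : ℕ) : Finset ℕ :=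
  (Finset.Ioc ⌊w N⌋₊ N).filter Nat.Prime

theorem prime_of_mem_largePrimes {N p : ℕ} (h : p ∈ largePrimes N) : p.Prime :=
  (Finset.mem_filter.1 h).2

theorem squarefree_of_mem_U {γ : ℝ} {N i s u : ℕ} (hu : u ∈ U γ N i s) :
    Squarefree u ∧ u.primeFactors ⊆ dyadicPrimes N i ∧ u.primeFactors.card = m₀ γ i s := by
  obtain ⟨S, hS, rfl⟩ := Finset.mem_image.1 hu
  obtain ⟨hS1, hS2⟩ := Finset.mem_powersetCard.1 hS
  have hp : ∀ p ∈ S, p.Prime := fun p hp => (Finset.mem_filter.1 (hS1 hp)).2.1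
  have hpf : (∏ p ∈ S, p).primeFactors = S := Nat.primeFactors_prod hp
  refine ⟨?_, by rw [hpf]; exact hS1, by rw [hpf]; exact hS2⟩
  refine Finset.squarefree_prod_of_pairwise_isCoprime ?_ fun p hpS => (hp p hpS).squarefree
  intro p hpS q hqS hpq
  exact Nat.coprime_iff_isRelPrime.1 ((Nat.coprime_primes (hp p hpS) (hp q hqS)).2 hpq)

theorem squarefree_of_mem_levelU {γ : ℝ} {N u : ℕ} {k : Option (Σ _ : ℕ, ℕ)}
    (hu : u ∈ levelU γ N k) :
    Squarefree u ∧ u.primeFactors ⊆ levelPrimes N k ∧ u.primeFactors.card = levelCard γ k := by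
  cases k with
  | none =>
    rw [levelU, Finset.mem_singleton] at hu
    subst hu
    simp [levelPrimes, levelCard]
  | some x => exact squarefree_of_mem_U hu

theorem W_dvd_of_prime_le {N p : ℕ} (hp : p.Prime) (h : p ≤ ⌊w N⌋₊) : p ∣ W N := by
  rw [W, primorial]
  exact Finset.dvd_prod_of_mem _ (Finset.mem_filter.2 ⟨Finset.mem_range.2 (by omega), hp⟩)

/-- Coprimality to `W` leaves only primes larger than `w(N)`. -/
theorem primeFactors_tauDivisors {γ : ℝ} (hγ : γ ≤ 1) {N d : ℕ} (hN : 1 ≤ N)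
    (hd : d ∈ tauDivisors γ N) : d ≠ 0 ∧ d.primeFactors ⊆ largePrimes N := by
  obtain ⟨h1, h2⟩ := Finset.mem_filter.1 hd
  obtain ⟨h3, h4⟩ := Finset.mem_Icc.1 h1
  refine ⟨by omega, fun p hp => ?_⟩
  have hpp := Nat.prime_of_mem_primeFactors hp
  have hpd := Nat.dvd_of_mem_primeFactors hp
  refine Finset.mem_filter.2 ⟨Finset.mem_Ioc.2 ⟨?_, ?_⟩, hpp⟩
  · by_contra hcon
    push Not at hcon
    have := Nat.dvd_gcd hpd (W_dvd_of_prime_le hpp hcon)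
    rw [h2] at this
    exact hpp.one_lt.ne' (Nat.dvd_one.1 this)
  · have h5 : (d : ℝ) ≤ N := by
      calc (d : ℝ) ≤ (N : ℝ) ^ γ := (Nat.le_floor_iff (by positivity)).1 h4
        _ ≤ (N : ℝ) ^ (1 : ℝ) := Real.rpow_le_rpow_of_exponent_le (by exact_mod_cast hN) hγ
        _ = N := Real.rpow_one _
    exact (Nat.le_of_dvd (by omega) hpd).trans (by exact_mod_cast h5)

variable {ι : Type*} [Fintype ι] {d : ℕ}

/-- Expanding a product of sums over levels and pairs. -/
theorem prod_sum_levelPairs [DecidableEq ι] (γ : ℝ) (N : ℕ)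
    (f : ι → Option (Σ _ : ℕ, ℕ) → ℕ × ℕ → ℝ) :
    ∏ j, ∑ k ∈ levels γ N, ∑ y ∈ levelPairs γ N k, f j k y =
      ∑ k ∈ Fintype.piFinset fun _ : ι => levels γ N,
        ∑ y ∈ Fintype.piFinset fun j => levelPairs γ N (k j), ∏ j, f j (k j) (y j) := by
  rw [Finset.prod_univ_sum (fun _ : ι => levels γ N)]
  refine Finset.sum_congr rfl fun k _ => ?_
  rw [Finset.prod_univ_sum]

/-- The main estimate, with explicit error terms: a product of unnormalised majorants has mean
value `meanSum ^ t` over the lattice points of a convex set. The first error term comes from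
the lattice point counts, the second one from tuples of moduli with a common prime factor. -/
theorem abs_sum_prod_nuSum_sub_le {γ : ℝ} (hγ0 : 0 < γ) (hγ1 : γ ≤ 1) {N : ℕ} (hN : 1 ≤ N)
    {θ R Ξ T q₀ H : ℝ} (hθ0 : 0 < θ) (hθ1 : θ < 1) (hθ : 1 / 2 ≤ θ ^ Fintype.card ι)
    (hR : 0 < R) (hH : 0 ≤ H)
    (hprimes : ∀ k ∈ levels γ N, levelPrimes N k ⊆ largePrimes N)
    (hrecip : ∀ k ∈ levels γ N, ∑ p ∈ levelPrimes N k, (p : ℝ)⁻¹ ≤ 3)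
    (hq₀ : ∀ k ∈ levels γ N, ∀ y ∈ levelPairs γ N k, ((Nat.lcm y.1 y.2 : ℕ) : ℝ) ≤ q₀)
    (hT : tauConst γ N * ∏ p ∈ largePrimes N, (1 - (p : ℝ)⁻¹)⁻¹ ≤ T)
    (hΞ : ∑ k ∈ levels γ N, levelWeight γ k * (R⁻¹) ^ levelCard γ k ≤ Ξ)
    {Ψ : ι → AffineForm d} (hΨ : ∀ p ∈ largePrimes N, Unexceptional Ψ p)
    {K : Set (Fin d → ℝ)} (hc : Convex ℝ K) (hK : ∀ x ∈ K, ∀ k, |x k| ≤ H)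
    {S : Finset (Fin d → ℤ)} (hS : ∀ n, n ∈ S ↔ n ∈ latticePoints K) :
    |∑ n ∈ S, ∏ j, nuSum γ N ((Ψ j).eval n) - volume.real K * meanSum γ N ^ Fintype.card ι| ≤
      totalSum γ N ^ Fintype.card ι *
        ((q₀ ^ Fintype.card ι) ^ d * (d * (2 * H + 1) ^ (d - 1))) +
      volume.real K * ((Ξ * T) ^ Fintype.card ι *
        (collisionConst θ R (Fintype.card ι) * ∑ p ∈ largePrimes N, ((p : ℝ)⁻¹) ^ 2) *
        Real.exp (6 * R * Fintype.card ι +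
          collisionConst θ R (Fintype.card ι) * ∑ p ∈ largePrimes N, ((p : ℝ)⁻¹) ^ 2)) := by
  classical
  set t := Fintype.card ι with ht
  set τ := tauConst γ N with hτ
  have hτ0 : 0 ≤ τ := tauConst_nonneg hγ0 N
  set P := largePrimes N with hP
  have hPp : ∀ p ∈ P, p.Prime := fun p hp => prime_of_mem_largePrimes hp
  set κ := Fintype.piFinset fun _ : ι => levels γ N with hκ
  set c : (ι → Option (Σ _ : ℕ, ℕ)) → ℝ := fun k => ∏ j, (levelWeight γ (k j) * τ) with hc'
  have hc0 : ∀ k, 0 ≤ c k := fun k =>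
    Finset.prod_nonneg fun j _ => mul_nonneg (levelWeight_nonneg _ _) hτ0
  set q : (ι → ℕ × ℕ) → ι → ℕ := fun y j => Nat.lcm (y j).1 (y j).2 with hq
  have hkl : ∀ k ∈ κ, ∀ j, k j ∈ levels γ N := fun k hk => Fintype.mem_piFinset.1 hk
  have hyl : ∀ {k : ι → Option (Σ _ : ℕ, ℕ)} {y : ι → ℕ × ℕ},
      y ∈ Fintype.piFinset (fun j => levelPairs γ N (k j)) → ∀ j, (y j).1 ∈ levelU γ N (k j) ∧
        (y j).2 ∈ tauDivisors γ N := fun hy j =>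
    Finset.mem_product.1 (Fintype.mem_piFinset.1 hy j)
  have hq0 : ∀ k ∈ κ, ∀ y ∈ Fintype.piFinset (fun j => levelPairs γ N (k j)), ∀ j,
      q y j ≠ 0 := by
    intro k _ y hy j
    exact Nat.lcm_ne_zero (squarefree_of_mem_levelU (hyl hy j).1).1.ne_zero
      (primeFactors_tauDivisors hγ1 hN (hyl hy j).2).1
  have hqP : ∀ k ∈ κ, ∀ y ∈ Fintype.piFinset (fun j => levelPairs γ N (k j)), ∀ j,
      (q y j).primeFactors ⊆ P := by
    intro k hk y hy j
    have h1 := squarefree_of_mem_levelU (hyl hy j).1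
    have h2 := primeFactors_tauDivisors hγ1 hN (hyl hy j).2
    simp only [hq]
    intro p hp
    have hpp := Nat.prime_of_mem_primeFactors hp
    rcases hpp.dvd_mul.1 ((Nat.dvd_of_mem_primeFactors hp).trans (Nat.lcm_dvd_mul _ _)) with h | h
    · exact hprimes _ (hkl k hk j) (h1.2.1 (Nat.mem_primeFactors.2 ⟨hpp, h, h1.1.ne_zero⟩))
    · exact h2.2 (Nat.mem_primeFactors.2 ⟨hpp, h, h2.1⟩)
  -- expand both sides over tuples of levels and pairs
  have e1 : ∑ n ∈ S, ∏ j, nuSum γ N ((Ψ j).eval n) =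
      ∑ k ∈ κ, ∑ y ∈ Fintype.piFinset fun j => levelPairs γ N (k j),
        c k * ((S.filter fun n => ∀ j, (q y j : ℤ) ∣ (Ψ j).eval n).card : ℝ) := by
    simp only [nuSum_eq_sum]
    simp_rw [prod_sum_levelPairs γ N (fun (j : ι) k y => levelWeight γ k * tauConst γ N *
      (if ((Nat.lcm y.1 y.2 : ℕ) : ℤ) ∣ (Ψ j).eval _ then (1 : ℝ) else 0))]
    rw [Finset.sum_comm]
    refine Finset.sum_congr rfl fun k _ => ?_
    rw [Finset.sum_comm]
    refine Finset.sum_congr rfl fun y _ => ?_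
    simp_rw [Finset.prod_mul_distrib (f := fun j => levelWeight γ (k j) * tauConst γ N)]
    rw [← Finset.mul_sum]
    congr 1
    rw [Finset.card_filter]
    push_cast
    refine Finset.sum_congr rfl fun n _ => ?_
    rw [Finset.prod_ite_zero]
    simp [hq]
  have e2 : meanSum γ N ^ t = ∑ k ∈ κ, ∑ y ∈ Fintype.piFinset fun j => levelPairs γ N (k j),
        c k * ∏ j, ((q y j : ℝ))⁻¹ := by
    rw [ht, ← Finset.card_univ, ← Finset.prod_const, meanSum]
    rw [prod_sum_levelPairs γ N (fun (_ : ι) k y => levelWeight γ k * tauConst γ N *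
      ((Nat.lcm y.1 y.2 : ℕ) : ℝ)⁻¹)]
    refine Finset.sum_congr rfl fun k _ => Finset.sum_congr rfl fun y _ => ?_
    rw [Finset.prod_mul_distrib]
  have e3 : totalSum γ N ^ t = ∑ k ∈ κ, ∑ _y ∈ Fintype.piFinset fun j => levelPairs γ N (k j),
        c k := by
    rw [ht, ← Finset.card_univ, ← Finset.prod_const, totalSum]
    rw [prod_sum_levelPairs γ N (fun (_ : ι) k _ => levelWeight γ k * tauConst γ N)]
  have hV : 0 ≤ volume.real K := measureReal_nonneg
  -- compare the terms of both sums
  have hterm : ∀ k ∈ κ, ∀ y ∈ Fintype.piFinset (fun j => levelPairs γ N (k j)),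
      |((S.filter fun n => ∀ j, (q y j : ℤ) ∣ (Ψ j).eval n).card : ℝ) -
        volume.real K * ∏ j, ((q y j : ℝ))⁻¹| ≤
      (q₀ ^ t) ^ d * (d * (2 * H + 1) ^ (d - 1)) + volume.real K *
        (if ∃ p ∈ P, Colliding fun j => (q y j).factorization p then
          ∏ p ∈ P, localWeight θ p fun j => (q y j).factorization p else 0) := by
    intro k hk y hy
    set Q := ∏ j, q y j with hQ
    have hQ0 : Q ≠ 0 := Finset.prod_ne_zero_iff.2 fun j _ => hq0 k hk y hy j
    have : NeZero Q := ⟨hQ0⟩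
    have hQd : ∀ j, q y j ∣ Q := fun j => Finset.dvd_prod_of_mem _ (Finset.mem_univ j)
    have hQle : (Q : ℝ) ≤ q₀ ^ t := by
      rw [hQ, ht, ← Finset.card_univ, ← Finset.prod_const]
      push_cast
      exact Finset.prod_le_prod (fun _ _ => by positivity) fun j _ =>
        hq₀ _ (hkl k hk j) _ (Fintype.mem_piFinset.1 hy j)
    have h1 := abs_card_filter_dvd_sub_le hH hc hK hS Ψ Q hQd
    have h2 := abs_residueCount_div_sub_le (P := P) hθ0 hθ1.le hθ hPp hΨ (hq0 k hk y hy)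
      (hqP k hk y hy) Q hQd
    set ρ := (residueCount Ψ (q y) Q : ℝ) / (Q : ℝ) ^ d
    have h3 : |ρ * volume.real K - volume.real K * ∏ j, ((q y j : ℝ))⁻¹| =
        volume.real K * |ρ - ∏ j, ((q y j : ℝ))⁻¹| := by
      rw [← abs_of_nonneg hV, ← abs_mul, abs_of_nonneg hV]; ring_nf
    refine (abs_sub_le _ (ρ * volume.real K) _).trans (add_le_add (h1.trans ?_) ?_)
    · gcongr
    · rw [h3]
      exact mul_le_mul_of_nonneg_left h2 hV
  have e4 : ∑ n ∈ S, ∏ j, nuSum γ N ((Ψ j).eval n) - volume.real K * meanSum γ N ^ t =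
      ∑ k ∈ κ, ∑ y ∈ Fintype.piFinset (fun j => levelPairs γ N (k j)),
        c k * (((S.filter fun n => ∀ j, (q y j : ℤ) ∣ (Ψ j).eval n).card : ℝ) -
          volume.real K * ∏ j, ((q y j : ℝ))⁻¹) := by
    rw [e1, e2, Finset.mul_sum, ← Finset.sum_sub_distrib]
    refine Finset.sum_congr rfl fun k _ => ?_
    rw [Finset.mul_sum, ← Finset.sum_sub_distrib]
    exact Finset.sum_congr rfl fun y _ => by ring
  rw [e4]
  refine (Finset.abs_sum_le_sum_abs _ _).trans ?_
  calc _ ≤ ∑ k ∈ κ, ∑ y ∈ Fintype.piFinset (fun j => levelPairs γ N (k j)),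
        c k * ((q₀ ^ t) ^ d * (d * (2 * H + 1) ^ (d - 1)) + volume.real K *
        (if ∃ p ∈ P, Colliding fun j => (q y j).factorization p then
          ∏ p ∈ P, localWeight θ p fun j => (q y j).factorization p else 0)) := by
        refine Finset.sum_le_sum fun k hk => (Finset.abs_sum_le_sum_abs _ _).trans
          (Finset.sum_le_sum fun y hy => ?_)
        have h3 := hterm k hk y hy
        rw [abs_mul, abs_of_nonneg (hc0 k)]
        exact mul_le_mul_of_nonneg_left h3 (hc0 k)
    _ = totalSum γ N ^ t * ((q₀ ^ t) ^ d * (d * (2 * H + 1) ^ (d - 1))) +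
        volume.real K * ∑ k ∈ κ, c k * ∑ y ∈ Fintype.piFinset (fun j => levelPairs γ N (k j)),
        (if ∃ p ∈ P, Colliding fun j => (q y j).factorization p then
          ∏ p ∈ P, localWeight θ p fun j => (q y j).factorization p else 0) := by
        rw [e3, Finset.sum_mul, Finset.mul_sum, ← Finset.sum_add_distrib]
        refine Finset.sum_congr rfl fun k _ => ?_
        rw [Finset.sum_mul, Finset.mul_sum, Finset.mul_sum, ← Finset.sum_add_distrib]
        exact Finset.sum_congr rfl fun y _ => by ring
    _ ≤ _ := by
        refine add_le_add le_rfl (mul_le_mul_of_nonneg_left ?_ hV)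
        set Kc := collisionConst θ R t with hKc
        set σ := ∑ p ∈ P, ((p : ℝ)⁻¹) ^ 2 with hσ
        have hσ0 : 0 ≤ σ := Finset.sum_nonneg fun _ _ => by positivity
        have hKc0 : 0 ≤ Kc := by
          have : 0 ≤ (1 + R) / (1 - θ) := div_nonneg (by linarith) (by linarith)
          rw [hKc, collisionConst]; positivity
        set X := ∏ p ∈ P, (1 - (p : ℝ)⁻¹)⁻¹ with hX
        have hX0 : 0 ≤ X := Finset.prod_nonneg fun p hp => inv_nonneg.2 (sub_nonneg.2
          (inv_le_one_of_one_le₀ (by exact_mod_cast (hPp p hp).one_le)))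
        calc _ ≤ ∑ k ∈ κ, c k * ((∏ j, (R⁻¹) ^ levelCard γ (k j)) * (Kc * σ) *
              (X ^ t * Real.exp (6 * R * t + Kc * σ))) := by
              refine Finset.sum_le_sum fun k hk => mul_le_mul_of_nonneg_left ?_ (hc0 k)
              refine (sum_colliding_le hθ0.le hθ1 hR hPp
                (fun j => hprimes _ (hkl k hk j)) (m := fun j => levelCard γ (k j))
                (X := fun j => levelPairs γ N (k j)) ?_ ?_).trans ?_
              · intro j y hy
                exact squarefree_of_mem_levelU (Finset.mem_product.1 hy).1
              · intro j y hy
                exact primeFactors_tauDivisors hγ1 hN (Finset.mem_product.1 hy).2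
              · have : ∑ j, ∑ p ∈ levelPrimes N (k j), (p : ℝ)⁻¹ ≤ t * 3 := by
                  calc _ ≤ ∑ _j : ι, (3 : ℝ) := Finset.sum_le_sum fun j _ =>
                        hrecip _ (hkl k hk j)
                    _ = t * 3 := by simp [ht]
                refine mul_le_mul_of_nonneg_left (mul_le_mul_of_nonneg_left
                  (Real.exp_le_exp.2 (add_le_add ?_ le_rfl)) (by positivity)) (by positivity)
                nlinarith
          _ = (∑ k ∈ κ, ∏ j, (levelWeight γ (k j) * (R⁻¹) ^ levelCard γ (k j))) *
              ((τ * X) ^ t * (Kc * σ) * Real.exp (6 * R * t + Kc * σ)) := by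
              rw [Finset.sum_mul]
              refine Finset.sum_congr rfl fun k _ => ?_
              simp only [hc', Finset.prod_mul_distrib, Finset.prod_const, Finset.card_univ, ← ht]
              ring
          _ = (∑ k ∈ levels γ N, levelWeight γ k * (R⁻¹) ^ levelCard γ k) ^ t *
              ((τ * X) ^ t * (Kc * σ) * Real.exp (6 * R * t + Kc * σ)) := by
              congr 1
              rw [ht, ← Finset.card_univ, ← Finset.prod_const, Finset.prod_univ_sum]
          _ ≤ Ξ ^ t * (T ^ t * (Kc * σ) * Real.exp (6 * R * t + Kc * σ)) := by
              have h0 : 0 ≤ ∑ k ∈ levels γ N, levelWeight γ k * (R⁻¹) ^ levelCard γ k :=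
                Finset.sum_nonneg fun k _ => mul_nonneg (levelWeight_nonneg _ _) (by positivity)
              have := h0.trans hΞ
              gcongr
          _ = _ := by rw [mul_pow]; ring

end DivisorMajorant

namespace DivisorMajorant

/-! ### Size of the parameters -/

theorem prod_primesLE_w_eq (N : ℕ) :
    (W N : ℝ) / (Nat.totient (W N) : ℝ) = ∏ p ∈ (⌊w N⌋₊).primesLE, (1 - (p : ℝ)⁻¹)⁻¹ := by
  have h := Nat.totient_eq_mul_prod_factors (W N)
  have h' : (Nat.totient (W N) : ℝ) = W N * ∏ p ∈ (W N).primeFactors, (1 - (p : ℝ)⁻¹) := by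
    have h'' := congrArg (Rat.cast : ℚ → ℝ) h
    push_cast at h''
    exact h''
  have hW : (W N : ℝ) ≠ 0 := by exact_mod_cast (primorial_pos _).ne'
  rw [h', W, primeFactors_primorial, Finset.prod_inv_distrib, ← div_div, ← W, div_self hW,
    one_div]

/-- Sieving out the primes in `T` from the harmonic sum costs at most the factor
`∏ (1 - 1 / p)⁻¹`. -/
theorem sum_inv_le_prod_mul_sum_inv {T : Finset ℕ} (hT : ∀ p ∈ T, p.Prime) (x : ℕ) :
    ∑ n ∈ Finset.Icc 1 x, (n : ℝ)⁻¹ ≤ (∏ p ∈ T, (1 - (p : ℝ)⁻¹)⁻¹) *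
      ∑ n ∈ (Finset.Icc 1 x).filter (fun n => ∀ p ∈ T, ¬ p ∣ n), (n : ℝ)⁻¹ := by
  classical
  induction T using Finset.induction_on with
  | empty => simp
  | insert p T hpT ih =>
    have ih := ih fun q hq => hT q (Finset.mem_insert_of_mem hq)
    have hp : p.Prime := hT p (Finset.mem_insert_self p T)
    have hp1 : (1 : ℝ) < p := by exact_mod_cast hp.one_lt
    have hpos : 0 < 1 - (p : ℝ)⁻¹ := sub_pos.2 (inv_lt_one_of_one_lt₀ hp1)
    set F := (Finset.Icc 1 x).filter (fun n => ∀ q ∈ T, ¬ q ∣ n) with hF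
    have hsplit : ∑ n ∈ F, (n : ℝ)⁻¹ = ∑ n ∈ F.filter (fun n => p ∣ n), (n : ℝ)⁻¹ +
        ∑ n ∈ F.filter (fun n => ¬ p ∣ n), (n : ℝ)⁻¹ :=
      (Finset.sum_filter_add_sum_filter_not F _ _).symm
    have hdiv : ∑ n ∈ F.filter (fun n => p ∣ n), (n : ℝ)⁻¹ ≤ (p : ℝ)⁻¹ * ∑ n ∈ F, (n : ℝ)⁻¹ := by
      rw [Finset.mul_sum]
      have himg : F.filter (fun n => p ∣ n) ⊆ F.image (fun m => p * m) := by
        intro n hn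
        obtain ⟨hnF, m, rfl⟩ := Finset.mem_filter.1 hn
        obtain ⟨h1, h2⟩ := Finset.mem_filter.1 hnF
        obtain ⟨h3, h4⟩ := Finset.mem_Icc.1 h1
        refine Finset.mem_image.2 ⟨m, Finset.mem_filter.2 ⟨Finset.mem_Icc.2 ⟨?_, ?_⟩,
          fun q hq hqm => h2 q hq (hqm.mul_left p)⟩, rfl⟩
        · rcases Nat.eq_zero_or_pos m with rfl | h
          · simp at h3
          · exact h
        · exact (Nat.le_mul_of_pos_left m hp.pos).trans h4
      refine (Finset.sum_le_sum_of_subset_of_nonneg himg fun _ _ _ => by positivity).trans ?_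
      rw [Finset.sum_image (fun a _ b _ h => Nat.eq_of_mul_eq_mul_left hp.pos h)]
      refine le_of_eq (Finset.sum_congr rfl fun m _ => ?_)
      push_cast
      rw [mul_inv]
    have hFp : F.filter (fun n => ¬ p ∣ n) =
        (Finset.Icc 1 x).filter (fun n => ∀ q ∈ insert p T, ¬ q ∣ n) := by
      ext n
      simp only [hF, Finset.mem_filter, Finset.mem_insert, forall_eq_or_imp]
      tauto
    have hstep : ∑ n ∈ F, (n : ℝ)⁻¹ ≤ (1 - (p : ℝ)⁻¹)⁻¹ *
        ∑ n ∈ (Finset.Icc 1 x).filter (fun n => ∀ q ∈ insert p T, ¬ q ∣ n), (n : ℝ)⁻¹ := by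
      rw [← hFp, ← div_eq_inv_mul, le_div_iff₀ hpos]
      linarith
    have hprod : 0 ≤ ∏ q ∈ T, (1 - (q : ℝ)⁻¹)⁻¹ := Finset.prod_nonneg fun q hq =>
      inv_nonneg.2 (sub_nonneg.2 (inv_le_one_of_one_le₀
        (by exact_mod_cast (hT q (Finset.mem_insert_of_mem hq)).one_le)))
    rw [Finset.prod_insert hpT]
    calc _ ≤ _ := ih
      _ ≤ (∏ q ∈ T, (1 - (q : ℝ)⁻¹)⁻¹) * ((1 - (p : ℝ)⁻¹)⁻¹ *
        ∑ n ∈ (Finset.Icc 1 x).filter (fun n => ∀ q ∈ insert p T, ¬ q ∣ n), (n : ℝ)⁻¹) :=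
          mul_le_mul_of_nonneg_left hstep hprod
      _ = _ := by ring

/-- The truncated divisor function has mean value at least `1`: the harmonic sum up to `N ^ γ` is
at most the Euler product of `W` times the sum over the divisors coprime to `W`. -/
theorem one_le_tauConst_mul_sum {γ : ℝ} (hγ : 0 < γ) {N : ℕ} (hN : 2 ≤ N) :
    1 ≤ tauConst γ N * ∑ d ∈ tauDivisors γ N, (d : ℝ)⁻¹ := by
  have hlog : 0 < Real.log N := Real.log_pos (by exact_mod_cast hN)
  have hN0 : (0 : ℝ) < N := by positivity
  have h1 : γ * Real.log N ≤ ∑ n ∈ Finset.Icc 1 ⌊(N : ℝ) ^ γ⌋₊, (n : ℝ)⁻¹ := by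
    have := log_le_harmonic_floor ((N : ℝ) ^ γ) (by positivity)
    rw [Real.log_rpow hN0, harmonic_eq_sum_Icc] at this
    push_cast at this
    exact this
  have h2 := sum_inv_le_prod_mul_sum_inv (T := (⌊w N⌋₊).primesLE)
    (fun p hp => Nat.prime_of_mem_primesLE hp) ⌊(N : ℝ) ^ γ⌋₊
  rw [← prod_primesLE_w_eq] at h2
  have h3 : (Finset.Icc 1 ⌊(N : ℝ) ^ γ⌋₊).filter
      (fun n => ∀ p ∈ (⌊w N⌋₊).primesLE, ¬ p ∣ n) = tauDivisors γ N := by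
    refine Finset.filter_congr fun n _ => ?_
    constructor
    · intro h
      refine Nat.coprime_of_dvd fun p hp hpn hpW => ?_
      exact h p (Nat.mem_primesLE.2 ⟨hp.dvd_primorial_iff.1 hpW, hp⟩) hpn
    · intro h p hp hpn
      have hpp := Nat.prime_of_mem_primesLE hp
      exact Nat.not_coprime_of_dvd_of_dvd hpp.one_lt hpn
        (W_dvd_of_prime_le hpp (Nat.le_of_mem_primesLE hp)) h
  rw [h3] at h2
  have h4 : tauConst γ N * ∑ d ∈ tauDivisors γ N, (d : ℝ)⁻¹ =
      (γ * Real.log N)⁻¹ * ((W N : ℝ) / (Nat.totient (W N) : ℝ) *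
        ∑ d ∈ tauDivisors γ N, (d : ℝ)⁻¹) := by rw [tauConst]; ring
  rw [h4, ← div_eq_inv_mul, one_le_div (by positivity)]
  exact h1.trans h2

/-- The mean value of the majorant is bounded below, by the base term alone. -/
theorem one_le_meanSum {γ : ℝ} (hγ : 0 < γ) {N : ℕ} (hN : 2 ≤ N) : 1 ≤ meanSum γ N := by
  have hτ := tauConst_nonneg hγ N
  have hnone : (none : Option (Σ _ : ℕ, ℕ)) ∈ levels γ N := by simp [levels]
  refine le_trans ?_ (Finset.single_le_sum (f := fun k => ∑ y ∈ levelPairs γ N k,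
    levelWeight γ k * tauConst γ N * ((Nat.lcm y.1 y.2 : ℕ) : ℝ)⁻¹) (fun k _ =>
      Finset.sum_nonneg fun y _ => ?_) hnone)
  · have h1 := one_le_tauConst_mul_sum hγ hN
    have h2 : (1 : ℝ) ≤ 2 ^ (2 / γ) := Real.one_le_rpow (by norm_num) (by positivity)
    have h3 : ∑ y ∈ levelPairs γ N none, levelWeight γ none * tauConst γ N *
        ((Nat.lcm y.1 y.2 : ℕ) : ℝ)⁻¹ =
        2 ^ (2 / γ) * (tauConst γ N * ∑ d ∈ tauDivisors γ N, (d : ℝ)⁻¹) := by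
      rw [levelPairs, Finset.sum_product, levelU, Finset.sum_singleton, ← mul_assoc,
        Finset.mul_sum]
      simp [levelWeight]
    rw [h3]
    exact one_le_mul_of_one_le_of_one_le h2 h1
  · have := levelWeight_nonneg γ k
    positivity

/-- The average of the majorant over `[N]` is `meanSum` up to a negligible error. -/
theorem abs_average_sub_meanSum_le {γ : ℝ} (hγ : 0 < γ) {N : ℕ} (hN : 1 ≤ N) :
    |(∑ n ∈ Finset.Icc 1 N, nuSum γ N (n : ℤ)) / N - meanSum γ N| ≤ totalSum γ N / N := by
  have hN0 : (0 : ℝ) < N := by exact_mod_cast hN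
  have hτ := tauConst_nonneg hγ N
  have h1 : ∑ n ∈ Finset.Icc 1 N, nuSum γ N (n : ℤ) = ∑ k ∈ levels γ N,
      ∑ y ∈ levelPairs γ N k, levelWeight γ k * tauConst γ N *
        ((N / Nat.lcm y.1 y.2 : ℕ) : ℝ) := by
    simp only [nuSum_eq_sum]
    rw [Finset.sum_comm]
    refine Finset.sum_congr rfl fun k _ => ?_
    rw [Finset.sum_comm]
    refine Finset.sum_congr rfl fun y _ => ?_
    rw [← Finset.mul_sum, Finset.sum_boole]
    congr 2
    rw [← Nat.Ioc_filter_dvd_card_eq_div]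
    congr 1
    ext n
    simp only [Finset.mem_filter, Finset.mem_Icc, Finset.mem_Ioc, Int.natCast_dvd_natCast]
    exact Iff.rfl
  have h2 : (∑ n ∈ Finset.Icc 1 N, nuSum γ N (n : ℤ)) - N * meanSum γ N =
      ∑ k ∈ levels γ N, ∑ y ∈ levelPairs γ N k, levelWeight γ k * tauConst γ N *
        (((N / Nat.lcm y.1 y.2 : ℕ) : ℝ) - N * ((Nat.lcm y.1 y.2 : ℕ) : ℝ)⁻¹) := by
    rw [h1, meanSum, Finset.mul_sum, ← Finset.sum_sub_distrib]
    refine Finset.sum_congr rfl fun k _ => ?_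
    rw [Finset.mul_sum, ← Finset.sum_sub_distrib]
    exact Finset.sum_congr rfl fun y _ => by ring
  have h3 : |(∑ n ∈ Finset.Icc 1 N, nuSum γ N (n : ℤ)) - N * meanSum γ N| ≤ totalSum γ N := by
    rw [h2, totalSum]
    refine (Finset.abs_sum_le_sum_abs _ _).trans (Finset.sum_le_sum fun k _ =>
      (Finset.abs_sum_le_sum_abs _ _).trans (Finset.sum_le_sum fun y hy => ?_))
    have hw := levelWeight_nonneg γ k
    rw [abs_mul, abs_of_nonneg (by positivity : 0 ≤ levelWeight γ k * tauConst γ N)]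
    refine mul_le_of_le_one_right (by positivity) ?_
    rw [← div_eq_mul_inv, ← Nat.floor_div_eq_div (K := ℝ), abs_le]
    have e1 := Nat.floor_le (by positivity : 0 ≤ (N : ℝ) / ((Nat.lcm y.1 y.2 : ℕ) : ℝ))
    have e2 := Nat.lt_floor_add_one ((N : ℝ) / ((Nat.lcm y.1 y.2 : ℕ) : ℝ))
    constructor <;> linarith
  have h4 : (∑ n ∈ Finset.Icc 1 N, nuSum γ N (n : ℤ)) / N - meanSum γ N =
      ((∑ n ∈ Finset.Icc 1 N, nuSum γ N (n : ℤ)) - N * meanSum γ N) / N := by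
    field_simp
  rw [h4, abs_div, abs_of_pos hN0]
  gcongr

/-- The factor `W / φ(W)` completes the Euler product over large primes to that over all primes
up to `N`, which is `O(log N)`. -/
theorem tauConst_mul_prod_le {γ : ℝ} (hγ : 0 < γ) {N : ℕ} (hN : 3 ≤ N) (hw : ⌊w N⌋₊ ≤ N) :
    tauConst γ N * ∏ p ∈ largePrimes N, (1 - (p : ℝ)⁻¹)⁻¹ ≤ 2 * Real.exp 6 / γ := by
  have hlog : 0 < Real.log N := Real.log_pos (by exact_mod_cast (by omega : 1 < N))
  have h1 := prod_primesLE_one_sub_inv_le hN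
  have h2 : ∏ p ∈ N.primesLE, (1 - (p : ℝ)⁻¹)⁻¹ = (∏ p ∈ (⌊w N⌋₊).primesLE, (1 - (p : ℝ)⁻¹)⁻¹) *
      ∏ p ∈ largePrimes N, (1 - (p : ℝ)⁻¹)⁻¹ := by
    rw [← Finset.prod_union]
    · refine Finset.prod_congr ?_ fun _ _ => rfl
      ext p
      simp only [Finset.mem_union, Nat.mem_primesLE, largePrimes, Finset.mem_filter,
        Finset.mem_Ioc]
      constructor
      · rintro ⟨h, hp⟩
        by_cases h' : p ≤ ⌊w N⌋₊
        · exact Or.inl ⟨h', hp⟩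
        · exact Or.inr ⟨⟨by omega, h⟩, hp⟩
      · rintro (⟨h, hp⟩ | ⟨⟨_, h⟩, hp⟩)
        · exact ⟨h.trans hw, hp⟩
        · exact ⟨h, hp⟩
    · refine Finset.disjoint_left.2 fun p h h' => ?_
      have := Nat.le_of_mem_primesLE h
      have := (Finset.mem_Ioc.1 (Finset.mem_filter.1 h').1).1
      omega
  rw [tauConst, prod_primesLE_w_eq, mul_right_comm, ← h2, ← div_eq_mul_inv,
    div_le_div_iff₀ (by positivity) hγ]
  nlinarith

theorem one_le_prod_largePrimes (N : ℕ) : 1 ≤ ∏ p ∈ largePrimes N, (1 - (p : ℝ)⁻¹)⁻¹ := by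
  refine Finset.one_le_prod fun p hp => ?_
  have hp1 : (1 : ℝ) < p := by exact_mod_cast (prime_of_mem_largePrimes hp).one_lt
  have : 0 < (p : ℝ)⁻¹ := by positivity
  exact (one_le_inv₀ (sub_pos.2 (inv_lt_one_of_one_lt₀ hp1))).2 (by linarith)

theorem sum_largePrimes_inv_sq_le (N : ℕ) :
    ∑ p ∈ largePrimes N, ((p : ℝ)⁻¹) ^ 2 ≤ 2 / (⌊w N⌋₊ + 1) := by
  refine le_trans ?_ (sum_Ioo_inv_sq_le ⌊w N⌋₊ (N + 1))
  have hsub : largePrimes N ⊆ Finset.Ioo ⌊w N⌋₊ (N + 1) := by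
    intro p hp
    have := Finset.mem_Ioc.1 (Finset.mem_filter.1 hp).1
    exact Finset.mem_Ioo.2 ⟨this.1, by omega⟩
  refine (Finset.sum_le_sum_of_subset_of_nonneg hsub fun _ _ _ => by positivity).trans ?_
  exact le_of_eq (Finset.sum_congr rfl fun p _ => by rw [inv_pow])

/-- The Rankin parameter: each prime factor of `u` is charged `R⁻¹ = 4 ^ (-100 / γ)`, so that
`m₀(i, s)` of them beat the factor `2 ^ s`. -/
noncomputable def rankinBase (γ : ℝ) : ℝ := 4 ^ (100 / γ)

theorem rankinBase_pos (γ : ℝ) : 0 < rankinBase γ := by unfold rankinBase; positivity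

theorem two_pow_mul_rankinBase_inv_pow_le {γ : ℝ} (hγ : 0 < γ) {s i : ℕ} (hs : 1 ≤ s)
    (hi : ⌈Real.logb 2 s - 2⌉₊ ≤ i) :
    (2 : ℝ) ^ s * ((rankinBase γ)⁻¹) ^ m₀ γ i s ≤
      (1 / 2) ^ s * (1 / 4) ^ (i - ⌈Real.logb 2 s - 2⌉₊) := by
  set i₀ := ⌈Real.logb 2 s - 2⌉₊ with hi₀
  obtain ⟨j, rfl⟩ := Nat.exists_eq_add_of_le hi
  rw [Nat.add_sub_cancel_left]
  have h1 : Real.logb 2 s - 2 ≤ i₀ := Nat.le_ceil _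
  have h2 : γ * s * ((i₀ + j : ℕ) + 3 - Real.logb 2 s) / 100 ≤ m₀ γ (i₀ + j) s := Nat.le_ceil _
  have hs1 : (1 : ℝ) ≤ s := by exact_mod_cast hs
  have h3 : (s + j : ℝ) ≤ 100 / γ * m₀ γ (i₀ + j) s := by
    rw [div_mul_eq_mul_div, le_div_iff₀ hγ]
    push_cast at h2
    have h4 : (1 + j : ℝ) ≤ i₀ + j + 3 - Real.logb 2 s := by linarith
    have h5 : (s + j : ℝ) ≤ s * (1 + j) := by
      have : (0 : ℝ) ≤ j := by positivity
      nlinarith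
    have h6 : (s : ℝ) * (1 + j) ≤ s * (i₀ + j + 3 - Real.logb 2 s) := by gcongr
    nlinarith
  have h7 : (4 : ℝ) ^ (s + j) ≤ (rankinBase γ) ^ m₀ γ (i₀ + j) s := by
    rw [rankinBase, ← Real.rpow_natCast, ← Real.rpow_natCast, ← Real.rpow_mul (by norm_num)]
    refine Real.rpow_le_rpow_of_exponent_le (by norm_num) ?_
    push_cast
    exact h3
  calc (2 : ℝ) ^ s * ((rankinBase γ)⁻¹) ^ m₀ γ (i₀ + j) s
      ≤ 2 ^ s * ((4 : ℝ) ^ (s + j))⁻¹ := by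
        rw [inv_pow]
        gcongr
    _ = (1 / 2) ^ s * (1 / 4) ^ j := by
        rw [pow_add, show (4 : ℝ) ^ s = 2 ^ s * 2 ^ s by rw [← mul_pow]; norm_num]
        rw [one_div, one_div, inv_pow, inv_pow]
        field_simp

/-- Summing over levels: the series converges because `R ^ (-m₀(i, s))` beats `2 ^ s`. -/
theorem sum_levelWeight_mul_le {γ : ℝ} (hγ : 0 < γ) (N : ℕ) :
    ∑ k ∈ levels γ N, levelWeight γ k * ((rankinBase γ)⁻¹) ^ levelCard γ k ≤
      2 ^ (2 / γ) + 4 := by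
  rw [levels, Finset.sum_insertNone, Finset.sum_sigma]
  simp only [levelWeight, levelCard, pow_zero, mul_one]
  refine add_le_add le_rfl ?_
  have hgeo : ∀ (a b : ℕ), ∑ i ∈ Finset.Icc a b, ((1 : ℝ) / 4) ^ (i - a) ≤ 2 := by
    intro a b
    rw [← Finset.Ico_add_one_right_eq_Icc, Finset.sum_Ico_eq_sum_range]
    simp only [Nat.add_sub_cancel_left]
    refine (sum_range_pow_le (by norm_num) (by norm_num) _).trans (by norm_num)
  calc _ ≤ ∑ s ∈ Finset.Ioc ⌊2 / γ⌋₊ ⌊Real.log (Real.log N) ^ 3⌋₊, ((1 : ℝ) / 2) ^ s * 2 := by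
        refine Finset.sum_le_sum fun s hs => ?_
        have hs1 : 1 ≤ s := by have := (Finset.mem_Ioc.1 hs).1; omega
        refine (Finset.sum_le_sum fun i hi => two_pow_mul_rankinBase_inv_pow_le hγ hs1
          (Finset.mem_Icc.1 hi).1).trans ?_
        rw [← Finset.mul_sum]
        gcongr
        exact hgeo _ _
    _ ≤ (∑ s ∈ Finset.range (⌊Real.log (Real.log N) ^ 3⌋₊ + 1), ((1 : ℝ) / 2) ^ s) * 2 := by
        rw [← Finset.sum_mul]
        gcongr
        intro s hs
        have := (Finset.mem_Ioc.1 hs).2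
        exact Finset.mem_range.2 (by omega)
    _ ≤ 4 := by
        have := sum_range_pow_le (x := (1 : ℝ) / 2) (by norm_num) (by norm_num)
          (⌊Real.log (Real.log N) ^ 3⌋₊ + 1)
        norm_num at this ⊢
        linarith

theorem le_two_rpow_self (z : ℝ) : z ≤ (2 : ℝ) ^ z := by
  -- `2 ^ z = (2 ^ (z / 2)) ^ 2 ≥ (1 + a) ^ 2 ≥ 4 a` with `a = (z / 2) log 2`
  have h1 : (2 : ℝ) ^ z = (Real.exp (z / 2 * Real.log 2)) ^ 2 := by
    rw [← Real.exp_nat_mul, Real.rpow_def_of_pos (by norm_num)]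
    congr 1
    push_cast
    ring
  rcases le_total z 0 with hz | hz
  · exact hz.trans (by positivity)
  · have h2 := Real.add_one_le_exp (z / 2 * Real.log 2)
    have h3 := Real.log_two_gt_d9
    have h4 : 0 ≤ z / 2 * Real.log 2 := by positivity
    have h5 : (z / 2 * Real.log 2 + 1) ^ 2 ≤ (Real.exp (z / 2 * Real.log 2)) ^ 2 := by gcongr
    have h6 : z ≤ 4 * (z / 2 * Real.log 2) := by nlinarith
    rw [h1]
    nlinarith [sq_nonneg (z / 2 * Real.log 2 - 1)]

/-- The elements of `U(i, s)` are small powers of `N`. -/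
theorem le_of_mem_U {γ : ℝ} (hγ : 0 < γ) {N i s u : ℕ} (hN : 1 ≤ N) (hs : ⌊2 / γ⌋₊ < s)
    (hi : ⌈Real.logb 2 s - 2⌉₊ ≤ i) (hu : u ∈ U γ N i s) : (u : ℝ) ≤ (N : ℝ) ^ (3 * γ) := by
  obtain ⟨S, hS, rfl⟩ := Finset.mem_image.1 hu
  obtain ⟨hS1, hS2⟩ := Finset.mem_powersetCard.1 hS
  have hN1 : (1 : ℝ) ≤ N := by exact_mod_cast hN
  have hs1 : (1 : ℝ) ≤ s := by exact_mod_cast (by omega : 1 ≤ s)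
  have hs2 : 2 / γ ≤ s := (Nat.lt_of_floor_lt hs).le
  have h1 : ((∏ p ∈ S, p : ℕ) : ℝ) ≤ ((N : ℝ) ^ ((1 : ℝ) / 2 ^ i)) ^ m₀ γ i s := by
    rw [← hS2, ← Finset.prod_const]
    push_cast
    exact Finset.prod_le_prod (fun _ _ => by positivity) fun p hp =>
      (Finset.mem_filter.1 (hS1 hp)).2.2.2
  refine h1.trans ?_
  rw [← Real.rpow_natCast, ← Real.rpow_mul (by positivity)]
  refine Real.rpow_le_rpow_of_exponent_le hN1 ?_
  set z : ℝ := i + 3 - Real.logb 2 s with hz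
  have hz1 : 1 ≤ z := by
    have h2 : Real.logb 2 s - 2 ≤ ⌈Real.logb 2 s - 2⌉₊ := Nat.le_ceil _
    have h3 : ((⌈Real.logb 2 s - 2⌉₊ : ℕ) : ℝ) ≤ i := by exact_mod_cast hi
    linarith
  -- `2 ^ i = s * 2 ^ z / 8`
  have h2i : (2 : ℝ) ^ i = s * 2 ^ z / 8 := by
    have h4 : (2 : ℝ) ^ Real.logb 2 s = s := Real.rpow_logb (by norm_num) (by norm_num)
      (by linarith)
    have h5 : (i : ℝ) = Real.logb 2 s + z - 3 := by rw [hz]; ring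
    rw [← Real.rpow_natCast, h5, Real.rpow_sub (by norm_num), Real.rpow_add (by norm_num), h4]
    norm_num
  have hzz := le_two_rpow_self z
  have hm : (m₀ γ i s : ℝ) ≤ γ * s * z / 100 + 1 :=
    (Nat.ceil_lt_add_one (by positivity)).le
  have h2z : (2 : ℝ) ≤ 2 ^ z := by
    calc (2 : ℝ) = 2 ^ (1 : ℝ) := (Real.rpow_one 2).symm
      _ ≤ 2 ^ z := Real.rpow_le_rpow_of_exponent_le (by norm_num) hz1
  have hγs : 2 ≤ γ * s := by rwa [div_le_iff₀' hγ] at hs2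
  rw [h2i, one_div, inv_mul_le_iff₀ (by positivity)]
  have h6 : γ * s * z ≤ γ * s * 2 ^ z := by gcongr
  have h7 : 2 * 2 ≤ γ * s * 2 ^ z := by gcongr
  have h8 : s * 2 ^ z / 8 * (3 * γ) = 3 / 8 * (γ * s * 2 ^ z) := by ring
  rw [h8]
  linarith

theorem le_of_mem_levelU {γ : ℝ} (hγ : 0 < γ) {N u : ℕ} (hN : 1 ≤ N)
    {k : Option (Σ _ : ℕ, ℕ)} (hk : k ∈ levels γ N) (hu : u ∈ levelU γ N k) :
    (u : ℝ) ≤ (N : ℝ) ^ (3 * γ) := by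
  cases k with
  | none =>
    rw [levelU, Finset.mem_singleton] at hu
    subst hu
    simpa using Real.one_le_rpow (by exact_mod_cast hN : (1 : ℝ) ≤ N) (by positivity)
  | some x =>
    rw [levels, Finset.some_mem_insertNone, Finset.mem_sigma] at hk
    exact le_of_mem_U hγ hN (Finset.mem_Ioc.1 hk.1).1 (Finset.mem_Icc.1 hk.2).1 hu

theorem lcm_le_of_mem_levelPairs {γ : ℝ} (hγ : 0 < γ) {N : ℕ} (hN : 1 ≤ N)
    {k : Option (Σ _ : ℕ, ℕ)} (hk : k ∈ levels γ N) {y : ℕ × ℕ} (hy : y ∈ levelPairs γ N k) :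
    ((Nat.lcm y.1 y.2 : ℕ) : ℝ) ≤ (N : ℝ) ^ (4 * γ) := by
  obtain ⟨h1, h2⟩ := Finset.mem_product.1 hy
  have hN0 : (0 : ℝ) < N := by exact_mod_cast hN
  have h3 := le_of_mem_levelU hγ hN hk h1
  have h5 := (Finset.mem_Icc.1 (Finset.mem_filter.1 h2).1)
  have h4 : (y.2 : ℝ) ≤ (N : ℝ) ^ γ := (Nat.le_floor_iff (by positivity)).1 h5.2
  have h6 : Nat.lcm y.1 y.2 ≤ y.1 * y.2 :=
    Nat.le_of_dvd (Nat.mul_pos (Nat.pos_of_ne_zero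
      (squarefree_of_mem_levelU h1).1.ne_zero) (by omega)) (Nat.lcm_dvd_mul _ _)
  calc ((Nat.lcm y.1 y.2 : ℕ) : ℝ) ≤ (y.1 : ℝ) * y.2 := by exact_mod_cast h6
    _ ≤ (N : ℝ) ^ (3 * γ) * (N : ℝ) ^ γ := by gcongr
    _ = (N : ℝ) ^ (4 * γ) := by rw [← Real.rpow_add hN0]; ring_nf

theorem card_levelPairs_le {γ : ℝ} (hγ : 0 < γ) {N : ℕ} (hN : 1 ≤ N)
    {k : Option (Σ _ : ℕ, ℕ)} (hk : k ∈ levels γ N) :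
    ((levelPairs γ N k).card : ℝ) ≤ (N : ℝ) ^ (4 * γ) := by
  have hN0 : (0 : ℝ) < N := by exact_mod_cast hN
  have h1 : ((levelU γ N k).card : ℝ) ≤ (N : ℝ) ^ (3 * γ) := by
    have hsub : levelU γ N k ⊆ Finset.Icc 1 ⌊(N : ℝ) ^ (3 * γ)⌋₊ := by
      intro u hu
      exact Finset.mem_Icc.2 ⟨Nat.one_le_iff_ne_zero.2 (squarefree_of_mem_levelU hu).1.ne_zero,
        Nat.le_floor (le_of_mem_levelU hγ hN hk hu)⟩
    have := Finset.card_le_card hsub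
    rw [Nat.card_Icc, Nat.add_sub_cancel] at this
    exact (Nat.cast_le.2 this).trans (Nat.floor_le (by positivity))
  have h2 : ((tauDivisors γ N).card : ℝ) ≤ (N : ℝ) ^ γ := by
    have := Finset.card_filter_le (Finset.Icc 1 ⌊(N : ℝ) ^ γ⌋₊) fun d : ℕ => Nat.Coprime d (W N)
    rw [Nat.card_Icc, Nat.add_sub_cancel] at this
    exact (Nat.cast_le.2 this).trans (Nat.floor_le (by positivity))
  rw [levelPairs, Finset.card_product]
  push_cast
  calc _ ≤ (N : ℝ) ^ (3 * γ) * (N : ℝ) ^ γ := by gcongr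
    _ = (N : ℝ) ^ (4 * γ) := by rw [← Real.rpow_add hN0]; ring_nf

end DivisorMajorant

namespace DivisorMajorant

/-! ### Asymptotics of the parameters -/

theorem tendsto_log_log_natCast :
    Tendsto (fun N : ℕ => Real.log (Real.log N)) atTop atTop :=
  Real.tendsto_log_atTop.comp (Real.tendsto_log_atTop.comp tendsto_natCast_atTop_atTop)

theorem tendsto_w : Tendsto w atTop atTop :=
  tendsto_log_log_natCast.atTop_div_const (by norm_num)

/-- Properties of `log log N` for large `N`, together with `log N = exp (log log N)`. -/
theorem eventually_log_log {p : ℝ → Prop} (h : ∀ᶠ x in atTop, p x) :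
    ∀ᶠ N : ℕ in atTop, p (Real.log (Real.log N)) ∧
      Real.log N = Real.exp (Real.log (Real.log N)) ∧ 3 ≤ N := by
  filter_upwards [tendsto_log_log_natCast.eventually h, eventually_ge_atTop 3] with N h1 h3
  exact ⟨h1, (Real.exp_log (Real.log_pos (by exact_mod_cast (by omega : 1 < N)))).symm, h3⟩

theorem eventually_mul_pow_le_exp (a : ℝ) (n : ℕ) : ∀ᶠ x : ℝ in atTop, a * x ^ n ≤ Real.exp x := by
  filter_upwards [(Real.tendsto_exp_div_pow_atTop n).eventually_ge_atTop a,
    eventually_gt_atTop 0] with x h hx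
  rwa [le_div_iff₀ (by positivity)] at h

theorem rpow_eq_exp_mul_exp {N : ℕ} {x a : ℝ} (hN : 3 ≤ N) (h : Real.log N = Real.exp x) :
    (N : ℝ) ^ a = Real.exp (a * Real.exp x) := by
  have : (0 : ℝ) < N := by positivity
  rw [Real.rpow_def_of_pos this, h, mul_comm]

theorem two_pow_le_pow_five {x : ℝ} (hx : 1 ≤ x) {i : ℕ} (hi : i ≤ ⌊6 * Real.log x⌋₊) :
    (2 : ℝ) ^ i ≤ x ^ 5 := by
  have hl : 0 ≤ Real.log x := Real.log_nonneg hx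
  have h1 : (i : ℝ) ≤ 6 * Real.log x := (Nat.le_floor_iff (by positivity)).1 hi
  rw [← Real.exp_log (by norm_num : (0 : ℝ) < 2), ← Real.exp_nat_mul,
    ← Real.exp_log (by positivity : (0 : ℝ) < x ^ 5), Real.log_pow]
  refine Real.exp_le_exp.2 ?_
  have h2 := Real.log_two_lt_d9
  have h3 := Real.log_two_gt_d9
  push_cast
  nlinarith

/-- The primes used for `U(i, s)` exceed `w(N)`, and their reciprocals have a bounded sum. -/
theorem eventually_levelPrimes (γ : ℝ) : ∀ᶠ N : ℕ in atTop, ∀ k ∈ levels γ N,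
    levelPrimes N k ⊆ largePrimes N ∧ ∑ p ∈ levelPrimes N k, (p : ℝ)⁻¹ ≤ 3 := by
  filter_upwards [eventually_log_log ((eventually_ge_atTop (1 : ℝ)).and
    (eventually_mul_pow_le_exp 4 6))] with N hN
  obtain ⟨⟨hx1, hx2⟩, hlog, hN3⟩ := hN
  rintro (_ | ⟨s, i⟩) hk
  · simp [levelPrimes]
  rw [levels, Finset.some_mem_insertNone, Finset.mem_sigma] at hk
  have hi := (Finset.mem_Icc.1 hk.2).2
  simp only [levelPrimes] at hi ⊢
  have hi2 := two_pow_le_pow_five hx1 hi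
  set x := Real.log (Real.log N) with hx
  have hN0 : (0 : ℝ) < N := by positivity
  have hexp : 4 * x * x ^ 5 ≤ Real.exp x := by linarith [show 4 * x * x ^ 5 = 4 * x ^ 6 by ring]
  have hdiv : 2 * x ≤ Real.exp x / 2 ^ (i + 1) := by
    rw [le_div_iff₀ (by positivity), pow_succ]
    have : 2 * x * (2 ^ i * 2) ≤ 2 * x * (x ^ 5 * 2) := by gcongr
    linarith
  have hlow : Real.exp (Real.exp x / 2 ^ (i + 1)) = (N : ℝ) ^ ((1 : ℝ) / 2 ^ (i + 1)) := by
    rw [rpow_eq_exp_mul_exp hN3 hlog]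
    congr 1
    ring
  have hlarge : ∀ p ∈ dyadicPrimes N i, Real.exp (Real.exp x / 2 ^ (i + 1)) ≤ p := by
    intro p hp
    rw [hlow]
    exact (Finset.mem_filter.1 hp).2.2.1
  constructor
  · intro p hp
    have h1 := Finset.mem_filter.1 hp
    refine Finset.mem_filter.2 ⟨Finset.mem_Ioc.2 ⟨?_, ?_⟩, h1.2.1⟩
    · have h2 := hlarge p hp
      have h3 := Real.add_one_le_exp (Real.exp x / 2 ^ (i + 1))
      have h4 : w N = x / 2 := rfl
      rw [h4, Nat.floor_lt (by linarith)]
      linarith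
    · have := Finset.mem_range.1 h1.1
      omega
  · set b : ℕ := ⌊(N : ℝ) ^ ((1 : ℝ) / 2 ^ i)⌋₊ with hb
    have hsub : dyadicPrimes N i ⊆ b.primesLE := by
      intro p hp
      have h1 := Finset.mem_filter.1 hp
      exact Nat.mem_primesLE.2 ⟨Nat.le_floor h1.2.2.2, h1.2.1⟩
    have hb1 : 1 ≤ b := Nat.le_floor (by
      simpa using Real.one_le_rpow (by exact_mod_cast (by omega : 1 ≤ N)) (by positivity))
    have h1 := sum_log_div_primesLE_le hb1
    have h2 : Real.log b ≤ 2 * (Real.exp x / 2 ^ (i + 1)) := by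
      have h3 : (b : ℝ) ≤ Real.exp (2 * (Real.exp x / 2 ^ (i + 1))) := by
        refine (Nat.floor_le (by positivity)).trans (le_of_eq ?_)
        rw [rpow_eq_exp_mul_exp hN3 hlog, pow_succ]
        congr 1
        field_simp
      rw [← Real.log_exp (2 * (Real.exp x / 2 ^ (i + 1)))]
      exact Real.log_le_log (by exact_mod_cast hb1) h3
    set y := Real.exp x / 2 ^ (i + 1) with hy
    have hy0 : 0 < y := by positivity
    have h4 : y * ∑ p ∈ dyadicPrimes N i, (p : ℝ)⁻¹ ≤ ∑ p ∈ b.primesLE, Real.log p / p := by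
      rw [Finset.mul_sum]
      refine (Finset.sum_le_sum fun p hp => ?_).trans
        (Finset.sum_le_sum_of_subset_of_nonneg hsub fun p _ _ =>
          div_nonneg (Real.log_natCast_nonneg p) (by positivity))
      rw [div_eq_mul_inv]
      refine mul_le_mul_of_nonneg_right ?_ (by positivity)
      rw [← Real.log_exp y]
      exact Real.log_le_log (Real.exp_pos _) (hlarge p hp)
    have h5 : Real.log 4 ≤ 2 := by
      rw [show (4 : ℝ) = 2 ^ 2 by norm_num, Real.log_pow]
      have := Real.log_two_lt_d9
      push_cast; linarith
    have h6 : y * ∑ p ∈ dyadicPrimes N i, (p : ℝ)⁻¹ ≤ y * 3 := by linarith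
    exact le_of_mul_le_mul_left h6 hy0

theorem eventually_floor_w_le : ∀ᶠ N : ℕ in atTop, ⌊w N⌋₊ ≤ N := by
  filter_upwards [eventually_log_log (eventually_ge_atTop (0 : ℝ))] with N hN
  obtain ⟨hx, hlog, hN3⟩ := hN
  have h1 : w N ≤ N := by
    have h2 := Real.add_one_le_exp (Real.log (Real.log N))
    have h3 := Real.log_le_sub_one_of_pos (by positivity : (0 : ℝ) < N)
    have h4 : w N = Real.log (Real.log N) / 2 := rfl
    rw [h4]; linarith
  exact (Nat.floor_le_floor h1).trans (le_of_eq (Nat.floor_natCast N))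

/-- The coefficients of the majorant sum to at most a small power of `N`. -/
theorem eventually_totalSum_le {γ : ℝ} (hγ : 0 < γ) :
    ∀ᶠ N : ℕ in atTop, totalSum γ N ≤ (N : ℝ) ^ (6 * γ) := by
  set c : ℝ := 2 * Real.exp 6 / γ * (2 ^ (2 / γ) + 168) with hc
  have hc0 : 0 < c := by positivity
  have hev : ∀ᶠ x : ℝ in atTop, 1 ≤ x ∧ Real.log c ≤ x ∧ 3 / (2 * γ) * x ^ 3 ≤ Real.exp x :=
    (eventually_ge_atTop 1).and ((eventually_ge_atTop _).and (eventually_mul_pow_le_exp _ 3))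
  filter_upwards [eventually_log_log hev, eventually_floor_w_le] with N hN hw
  obtain ⟨⟨hx1, hxc, hx3⟩, hlog, hN3⟩ := hN
  set x := Real.log (Real.log N) with hx
  have hN0 : (0 : ℝ) < N := by positivity
  have hτ0 := tauConst_nonneg hγ N
  have hτ : tauConst γ N ≤ 2 * Real.exp 6 / γ :=
    (le_mul_of_one_le_right hτ0 (one_le_prod_largePrimes N)).trans
      (tauConst_mul_prod_le hγ hN3 hw)
  have hweights : ∑ k ∈ levels γ N, levelWeight γ k ≤
      (2 ^ (2 / γ) + 168) * Real.exp (2 * x ^ 3) := by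
    rw [levels, Finset.sum_insertNone, Finset.sum_sigma]
    simp only [levelWeight, ← hx]
    have hl0 : 0 ≤ Real.log x := Real.log_nonneg hx1
    have hlx : Real.log x ≤ x := by
      have := Real.log_le_sub_one_of_pos (by linarith : 0 < x); linarith
    have h1 : ∑ s ∈ Finset.Ioc ⌊2 / γ⌋₊ ⌊x ^ 3⌋₊,
        ∑ _i ∈ Finset.Icc ⌈Real.logb 2 s - 2⌉₊ ⌊6 * Real.log x⌋₊, (2 : ℝ) ^ s ≤
        x ^ 3 * (7 * x * Real.exp (x ^ 3)) := by
      have h2 : ∀ s ∈ Finset.Ioc ⌊2 / γ⌋₊ ⌊x ^ 3⌋₊,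
          ∑ _i ∈ Finset.Icc ⌈Real.logb 2 s - 2⌉₊ ⌊6 * Real.log x⌋₊, (2 : ℝ) ^ s ≤
          7 * x * Real.exp (x ^ 3) := by
        intro s hs
        rw [Finset.sum_const, nsmul_eq_mul, Nat.card_Icc]
        have h3 : ((⌊6 * Real.log x⌋₊ + 1 - ⌈Real.logb 2 s - 2⌉₊ : ℕ) : ℝ) ≤ 7 * x := by
          calc ((⌊6 * Real.log x⌋₊ + 1 - ⌈Real.logb 2 s - 2⌉₊ : ℕ) : ℝ)
              ≤ ((⌊6 * Real.log x⌋₊ + 1 : ℕ) : ℝ) := by exact_mod_cast Nat.sub_le _ _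
            _ ≤ 6 * Real.log x + 1 := by
                push_cast
                linarith [Nat.floor_le (by positivity : 0 ≤ 6 * Real.log x)]
            _ ≤ 7 * x := by linarith
        have h4 : (2 : ℝ) ^ s ≤ Real.exp (x ^ 3) := by
          have h5 : (s : ℝ) ≤ x ^ 3 :=
            (Nat.le_floor_iff (by positivity)).1 (Finset.mem_Ioc.1 hs).2
          rw [← Real.exp_log (by norm_num : (0 : ℝ) < 2), ← Real.exp_nat_mul]
          refine Real.exp_le_exp.2 ?_
          have := Real.log_two_lt_d9
          have hs0 : (0 : ℝ) ≤ s := by positivity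
          nlinarith
        exact mul_le_mul h3 h4 (by positivity) (by positivity)
      refine (Finset.sum_le_sum h2).trans ?_
      rw [Finset.sum_const, nsmul_eq_mul, Nat.card_Ioc]
      refine mul_le_mul_of_nonneg_right ?_ (by positivity)
      calc ((⌊x ^ 3⌋₊ - ⌊2 / γ⌋₊ : ℕ) : ℝ) ≤ ((⌊x ^ 3⌋₊ : ℕ) : ℝ) := by
            exact_mod_cast Nat.sub_le _ _
        _ ≤ x ^ 3 := Nat.floor_le (by positivity)
    have h6 : x ^ 4 ≤ 24 * Real.exp (x ^ 3) := by
      have h7 := Real.pow_div_factorial_le_exp x (by linarith) 4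
      rw [div_le_iff₀ (by positivity)] at h7
      have h8 : x ≤ x ^ 3 := le_self_pow₀ hx1 (by norm_num)
      have h9 := Real.exp_le_exp.2 h8
      have : ((Nat.factorial 4 : ℕ) : ℝ) = 24 := by norm_num [Nat.factorial]
      rw [this] at h7
      linarith
    have h10 : Real.exp (2 * x ^ 3) = Real.exp (x ^ 3) * Real.exp (x ^ 3) := by
      rw [← Real.exp_add]; ring_nf
    have h11 : 1 ≤ Real.exp (2 * x ^ 3) := Real.one_le_exp (by positivity)
    have h12 : (0 : ℝ) < 2 ^ (2 / γ) := by positivity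
    have h13 : x ^ 3 * (7 * x * Real.exp (x ^ 3)) ≤ 168 * Real.exp (2 * x ^ 3) := by
      rw [h10]
      have h14 := Real.exp_pos (x ^ 3)
      nlinarith
    nlinarith
  have hsum : totalSum γ N ≤ (N : ℝ) ^ (4 * γ) * (c * Real.exp (2 * x ^ 3)) := by
    calc totalSum γ N = ∑ k ∈ levels γ N,
          ((levelPairs γ N k).card : ℝ) * (levelWeight γ k * tauConst γ N) := by
          rw [totalSum]
          exact Finset.sum_congr rfl fun k _ => by rw [Finset.sum_const, nsmul_eq_mul]
      _ ≤ ∑ k ∈ levels γ N, (N : ℝ) ^ (4 * γ) * (levelWeight γ k * tauConst γ N) := by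
          refine Finset.sum_le_sum fun k hk => ?_
          have := levelWeight_nonneg γ k
          have := card_levelPairs_le hγ (by omega : 1 ≤ N) hk
          gcongr
      _ = (N : ℝ) ^ (4 * γ) * (tauConst γ N * ∑ k ∈ levels γ N, levelWeight γ k) := by
          rw [Finset.mul_sum, Finset.mul_sum]
          exact Finset.sum_congr rfl fun k _ => by ring
      _ ≤ (N : ℝ) ^ (4 * γ) *
          (2 * Real.exp 6 / γ * ((2 ^ (2 / γ) + 168) * Real.exp (2 * x ^ 3))) := by
          have h0 : 0 ≤ ∑ k ∈ levels γ N, levelWeight γ k :=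
            Finset.sum_nonneg fun k _ => levelWeight_nonneg γ k
          gcongr
      _ = _ := by rw [hc]; ring
  refine hsum.trans ?_
  rw [show 6 * γ = 4 * γ + 2 * γ by ring, Real.rpow_add hN0]
  refine mul_le_mul_of_nonneg_left ?_ (by positivity)
  rw [rpow_eq_exp_mul_exp hN3 hlog, ← Real.exp_log hc0, ← Real.exp_add]
  refine Real.exp_le_exp.2 ?_
  have h15 : x ≤ x ^ 3 := le_self_pow₀ hx1 (by norm_num)
  rw [div_mul_eq_mul_div, div_le_iff₀ (by positivity)] at hx3
  linarith

theorem tendsto_rpow_neg {a : ℝ} (ha : a < 0) :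
    Tendsto (fun N : ℕ => (N : ℝ) ^ a) atTop (𝓝 0) := by
  have := (tendsto_rpow_neg_atTop (neg_pos.2 ha)).comp (tendsto_natCast_atTop_atTop (R := ℝ))
  simpa [Function.comp_def] using this

theorem eventually_le_rpow (c : ℝ) {a : ℝ} (ha : 0 < a) :
    ∀ᶠ N : ℕ in atTop, c ≤ (N : ℝ) ^ a :=
  ((tendsto_rpow_atTop ha).comp tendsto_natCast_atTop_atTop).eventually_ge_atTop c

/-- All normalising constants are asymptotic to `meanSum`. -/
theorem IsNormalising.tendsto_meanSum_div {γ : ℝ} (hγ : 0 < γ) (hγ1 : γ ≤ 1 / 12) {C : ℕ → ℝ}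
    (hC : IsNormalising γ C) : Tendsto (fun N => meanSum γ N / C N) atTop (𝓝 1) := by
  set a : ℕ → ℝ := fun N => (∑ n ∈ Finset.Icc 1 N, nuSum γ N (n : ℤ)) / N with ha
  have h1 : Tendsto (fun N => a N / C N) atTop (𝓝 1) := by
    refine hC.congr fun N => ?_
    simp only [nu, ha]
    rw [← Finset.sum_div, div_right_comm]
  have h2 : Tendsto (fun N => a N - meanSum γ N) atTop (𝓝 0) := by
    refine squeeze_zero_norm' ?_ (tendsto_rpow_neg (a := 6 * γ - 1) (by linarith))
    filter_upwards [eventually_totalSum_le hγ, eventually_ge_atTop 1] with N hN hN1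
    have hN0 : (0 : ℝ) < N := by exact_mod_cast hN1
    rw [Real.rpow_sub_one hN0.ne']
    exact (abs_average_sub_meanSum_le hγ hN1).trans (by gcongr)
  have h3 : Tendsto (fun N => a N / meanSum γ N) atTop (𝓝 1) := by
    have h4 : Tendsto (fun N => (a N - meanSum γ N) / meanSum γ N) atTop (𝓝 0) := by
      have h2' : Tendsto (fun N => |a N - meanSum γ N|) atTop (𝓝 0) := by simpa using h2.abs
      refine squeeze_zero_norm' ?_ h2'
      filter_upwards [eventually_ge_atTop 2] with N hN
      have := one_le_meanSum hγ hN
      rw [Real.norm_eq_abs, abs_div, abs_of_pos (by linarith : 0 < meanSum γ N)]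
      exact div_le_self (abs_nonneg _) this
    have h5 := h4.add_const 1
    rw [zero_add] at h5
    refine h5.congr' ?_
    filter_upwards [eventually_ge_atTop 2] with N hN
    have := one_le_meanSum hγ hN
    have : meanSum γ N ≠ 0 := by linarith
    field_simp
    ring
  have h5 : ∀ᶠ N in atTop, a N ≠ 0 ∧ meanSum γ N ≠ 0 := by
    filter_upwards [eventually_ge_atTop 2, h3.eventually_ne one_ne_zero] with N hN h6
    have := one_le_meanSum hγ hN
    refine ⟨fun h => h6 (by simp [h]), by linarith⟩
  have h7 := h1.div h3 one_ne_zero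
  rw [div_one] at h7
  refine h7.congr' ?_
  filter_upwards [h5] with N hN
  have := hN.1
  have := hN.2
  simp only [Pi.div_apply]
  field_simp

end DivisorMajorant

namespace DivisorMajorant

/-! ### The linear forms estimate -/

/-- The linear forms estimate in summed form, for a fixed number of forms and variables. -/
theorem eventually_abs_sum_prod_nu_sub_le_of_card (t d : ℕ) (hd : 1 ≤ d) {γ : ℝ} (hγ : 0 < γ)
    (hγ1 : γ ≤ 1 / 12) {C : ℕ → ℝ} (hC : IsNormalising γ C) {c : ℝ} (hc : 0 ≤ c) {ε : ℝ}
    (hε : 0 < ε) :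
    ∀ᶠ N : ℕ in atTop, ∀ (ι : Type) [Fintype ι], Fintype.card ι = t →
      ∀ Ψ : ι → AffineForm d, (∀ p : ℕ, p.Prime → w N < p → Unexceptional Ψ p) →
      ∀ K : Set (Fin d → ℝ), Convex ℝ K → (∀ x ∈ K, ∀ k, |x k| ≤ c * N) →
      ∀ S : Finset (Fin d → ℤ), (∀ n, n ∈ S ↔ n ∈ latticePoints K) →
      |∑ n ∈ S, ∏ j, nu γ C N ((Ψ j).eval n) - volume.real K| ≤
        ε * volume.real K + (N : ℝ) ^ ((d : ℝ) - 1 + (6 * t + 4 * t * d + 1) * γ) := by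
  set R := rankinBase γ with hR
  have hR0 : 0 < R := rankinBase_pos γ
  -- any `θ < 1` with `θ ^ t ≥ 1 / 2` will do
  set θ : ℝ := 1 - 1 / (2 * (t + 1)) with hθ
  have hθa : 1 / (2 * ((t : ℝ) + 1)) ≤ 1 / 2 := by
    apply one_div_le_one_div_of_le <;> [norm_num; linarith [(Nat.cast_nonneg t : (0 : ℝ) ≤ t)]]
  have hθb : 0 < 1 / (2 * ((t : ℝ) + 1)) := by positivity
  have hθ0 : 0 < θ := by rw [hθ]; linarith
  have hθ1 : θ < 1 := by rw [hθ]; linarith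
  have hθt : 1 / 2 ≤ θ ^ t := by
    have h1 := one_add_mul_le_pow (a := -(1 / (2 * ((t : ℝ) + 1)))) (by linarith) t
    have h2 : (t : ℝ) * (1 / (2 * (t + 1))) ≤ 1 / 2 := by
      rw [mul_one_div, div_le_div_iff₀ (by positivity) (by norm_num)]
      linarith [(Nat.cast_nonneg t : (0 : ℝ) ≤ t)]
    rw [hθ, sub_eq_add_neg]
    linarith
  set Kc := collisionConst θ R t with hKc
  set Ξ : ℝ := 2 ^ (2 / γ) + 4 with hΞ
  set T : ℝ := 2 * Real.exp 6 / γ with hT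
  set σ : ℕ → ℝ := fun N => ∑ p ∈ largePrimes N, ((p : ℝ)⁻¹) ^ 2 with hσ
  have hσlim : Tendsto σ atTop (𝓝 0) := by
    have h1 : Tendsto (fun N => 2 / w N) atTop (𝓝 0) := tendsto_w.const_div_atTop 2
    refine squeeze_zero' (Eventually.of_forall fun N => Finset.sum_nonneg fun _ _ => by positivity)
      ?_ h1
    filter_upwards [tendsto_w.eventually_gt_atTop 0] with N hw
    refine (sum_largePrimes_inv_sq_le N).trans ?_
    exact div_le_div_of_nonneg_left (by norm_num) hw (Nat.lt_floor_add_one _).le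
  set E : ℕ → ℝ := fun N => (Ξ * T) ^ t * (Kc * σ N) * Real.exp (6 * R * t + Kc * σ N) with hE
  have hElim : Tendsto E atTop (𝓝 0) := by
    have hcont : Continuous fun s : ℝ =>
        (Ξ * T) ^ t * (Kc * s) * Real.exp (6 * R * t + Kc * s) := by
      fun_prop
    have := (hcont.tendsto 0).comp hσlim
    simpa [Function.comp_def] using this
  have hm := hC.tendsto_meanSum_div hγ hγ1
  have hmt : Tendsto (fun N => |(meanSum γ N / C N) ^ t - 1|) atTop (𝓝 0) := by
    have := ((hm.pow t).sub_const 1).abs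
    simpa using this
  have hsum : Tendsto (fun N => 2 ^ t * E N + |(meanSum γ N / C N) ^ t - 1|) atTop (𝓝 0) := by
    simpa using (hElim.const_mul (2 ^ t)).add hmt
  filter_upwards [hsum.eventually_lt_const hε, hm.eventually_lt_const one_lt_two,
    hm.eventually_const_lt one_pos, eventually_levelPrimes γ, eventually_floor_w_le,
    eventually_totalSum_le hγ, eventually_ge_atTop 3,
    eventually_le_rpow (2 ^ t * (d * (2 * c + 1) ^ (d - 1))) hγ] with
    N hNε hm2 hm0 hlev hw htot hN3 hconst
  intro ι _ hcard Ψ hΨ K hKc' hKb S hS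
  have hN1 : (1 : ℝ) ≤ N := by exact_mod_cast (by omega : 1 ≤ N)
  have hN0 : (0 : ℝ) < N := by linarith
  have hmean := one_le_meanSum hγ (by omega : 2 ≤ N)
  have hCpos : 0 < C N := by
    by_contra h
    push Not at h
    exact absurd hm0 (not_lt.2 (div_nonpos_of_nonneg_of_nonpos (by linarith) h))
  have hChalf : (C N)⁻¹ ≤ 2 := by
    rw [div_lt_iff₀ hCpos] at hm2
    rw [inv_le_comm₀ hCpos (by norm_num)]
    linarith
  have hΨ' : ∀ p ∈ largePrimes N, Unexceptional Ψ p := by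
    intro p hp
    refine hΨ p (prime_of_mem_largePrimes hp) ?_
    exact Nat.lt_of_floor_lt (Finset.mem_Ioc.1 (Finset.mem_filter.1 hp).1).1
  have key := abs_sum_prod_nuSum_sub_le hγ (by linarith) (by omega : 1 ≤ N) hθ0 hθ1
    (by rw [hcard]; exact hθt) hR0 (H := c * N) (by positivity) (fun k hk => (hlev k hk).1)
    (fun k hk => (hlev k hk).2)
    (fun k hk y hy => lcm_le_of_mem_levelPairs hγ (by omega) hk hy)
    (tauConst_mul_prod_le hγ hN3 hw) (sum_levelWeight_mul_le hγ N) hΨ' hKc' hKb hS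
  rw [hcard] at key
  set V := volume.real K with hV
  have hV0 : 0 ≤ V := measureReal_nonneg
  have hnu : ∑ n ∈ S, ∏ j, nu γ C N ((Ψ j).eval n) =
      (C N)⁻¹ ^ t * ∑ n ∈ S, ∏ j, nuSum γ N ((Ψ j).eval n) := by
    rw [Finset.mul_sum]
    refine Finset.sum_congr rfl fun n _ => ?_
    simp only [nu, div_eq_mul_inv]
    rw [Finset.prod_mul_distrib, Finset.prod_const, Finset.card_univ, hcard, mul_comm]
  have hCinv : 0 ≤ (C N)⁻¹ := by positivity
  have hpow : (C N)⁻¹ ^ t ≤ 2 ^ t := by gcongr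
  have hE0 : 0 ≤ E N := by
    have : 0 ≤ (1 + R) / (1 - θ) := div_nonneg (by linarith) (by linarith)
    have hKc0 : 0 ≤ Kc := by rw [hKc, collisionConst]; positivity
    have : 0 ≤ σ N := Finset.sum_nonneg fun _ _ => by positivity
    simp only [hE]
    positivity
  -- the error from the lattice point counts
  set F := totalSum γ N ^ t * ((((N : ℝ) ^ (4 * γ)) ^ t) ^ d *
    (d * (2 * (c * N) + 1) ^ (d - 1))) with hF
  have htot0 : 0 ≤ totalSum γ N := (nuSum_nonneg hγ N 0).trans (nuSum_le_totalSum hγ N 0)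
  have hF0 : 0 ≤ F := by positivity
  have hFle : 2 ^ t * F ≤ (N : ℝ) ^ ((d : ℝ) - 1 + (6 * t + 4 * t * d + 1) * γ) := by
    have h1 : (2 * (c * N) + 1) ^ (d - 1) ≤ (2 * c + 1) ^ (d - 1) * (N : ℝ) ^ (d - 1) := by
      rw [← mul_pow]
      gcongr
      linarith
    have h2 : totalSum γ N ^ t ≤ ((N : ℝ) ^ (6 * γ)) ^ t := by gcongr
    calc 2 ^ t * F ≤ 2 ^ t * (((N : ℝ) ^ (6 * γ)) ^ t * ((((N : ℝ) ^ (4 * γ)) ^ t) ^ d *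
          (d * ((2 * c + 1) ^ (d - 1) * (N : ℝ) ^ (d - 1))))) := by rw [hF]; gcongr
      _ = (2 ^ t * (d * (2 * c + 1) ^ (d - 1))) * (((N : ℝ) ^ (6 * γ)) ^ t *
          (((N : ℝ) ^ (4 * γ)) ^ t) ^ d * (N : ℝ) ^ (d - 1)) := by ring
      _ ≤ (N : ℝ) ^ γ * (((N : ℝ) ^ (6 * γ)) ^ t *
          (((N : ℝ) ^ (4 * γ)) ^ t) ^ d * (N : ℝ) ^ (d - 1)) := by gcongr
      _ = _ := by
        rw [← Real.rpow_natCast ((N : ℝ) ^ (6 * γ)), ← Real.rpow_natCast ((N : ℝ) ^ (4 * γ)),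
          ← Real.rpow_natCast _ d, ← Real.rpow_natCast _ (d - 1), ← Real.rpow_mul hN0.le,
          ← Real.rpow_mul hN0.le, ← Real.rpow_mul hN0.le, ← Real.rpow_add hN0,
          ← Real.rpow_add hN0, ← Real.rpow_add hN0, Nat.cast_sub hd]
        congr 1
        push_cast
        ring
  rw [hnu]
  set s := ∑ n ∈ S, ∏ j, nuSum γ N ((Ψ j).eval n) with hs
  have hsplit : (C N)⁻¹ ^ t * s - V = (C N)⁻¹ ^ t * (s - V * meanSum γ N ^ t) +
      V * ((meanSum γ N / C N) ^ t - 1) := by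
    rw [div_eq_mul_inv, mul_pow]; ring
  rw [hsplit]
  calc |(C N)⁻¹ ^ t * (s - V * meanSum γ N ^ t) + V * ((meanSum γ N / C N) ^ t - 1)|
      ≤ (C N)⁻¹ ^ t * |s - V * meanSum γ N ^ t| + V * |(meanSum γ N / C N) ^ t - 1| := by
        refine (abs_add_le _ _).trans (le_of_eq ?_)
        rw [abs_mul, abs_mul, abs_of_nonneg hV0, abs_of_nonneg (by positivity)]
    _ ≤ 2 ^ t * (F + V * E N) + V * |(meanSum γ N / C N) ^ t - 1| := by
        gcongr
    _ = 2 ^ t * F + V * (2 ^ t * E N + |(meanSum γ N / C N) ^ t - 1|) := by ring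
    _ ≤ (N : ℝ) ^ ((d : ℝ) - 1 + (6 * t + 4 * t * d + 1) * γ) + V * ε := by gcongr
    _ = _ := by ring

/-- The exponent of the error term in the summed estimate. -/
noncomputable def errorExponent (D : ℕ) : ℝ := 6 * D + 4 * D * D + 1

theorem one_le_errorExponent (D : ℕ) : 1 ≤ errorExponent D := by
  have : (0 : ℝ) ≤ D := by positivity
  unfold errorExponent
  nlinarith

/-- The linear forms estimate in summed form. The range of the forms plays no role, nor does
the interior of `K`; without forms it counts lattice points. -/
theorem eventually_abs_sum_prod_nu_sub_le (D : ℕ) {γ : ℝ} (hγ : 0 < γ)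
    (hγ1 : γ ≤ 1 / 12) {C : ℕ → ℝ} (hC : IsNormalising γ C) {c : ℝ} (hc : 0 ≤ c) {ε : ℝ}
    (hε : 0 < ε) :
    ∀ᶠ N : ℕ in atTop, ∀ (ι : Type) [Fintype ι], Fintype.card ι ≤ D →
      ∀ d : ℕ, 1 ≤ d → d ≤ D →
      ∀ Ψ : ι → AffineForm d, (∀ p : ℕ, p.Prime → w N < p → Unexceptional Ψ p) →
      ∀ K : Set (Fin d → ℝ), Convex ℝ K → (∀ x ∈ K, ∀ k, |x k| ≤ c * N) →
      ∀ S : Finset (Fin d → ℤ), (∀ n, n ∈ S ↔ n ∈ latticePoints K) →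
      |∑ n ∈ S, ∏ j, nu γ C N ((Ψ j).eval n) - volume.real K| ≤
        ε * volume.real K + (N : ℝ) ^ ((d : ℝ) - 1 + errorExponent D * γ) := by
  have h1 : ∀ᶠ N : ℕ in atTop, ∀ t ∈ Finset.range (D + 1), ∀ d ∈ Finset.Icc 1 D,
      ∀ (ι : Type) [Fintype ι], Fintype.card ι = t →
      ∀ Ψ : ι → AffineForm d, (∀ p : ℕ, p.Prime → w N < p → Unexceptional Ψ p) →
      ∀ K : Set (Fin d → ℝ), Convex ℝ K → (∀ x ∈ K, ∀ k, |x k| ≤ c * N) →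
      ∀ S : Finset (Fin d → ℤ), (∀ n, n ∈ S ↔ n ∈ latticePoints K) →
      |∑ n ∈ S, ∏ j, nu γ C N ((Ψ j).eval n) - volume.real K| ≤
        ε * volume.real K + (N : ℝ) ^ ((d : ℝ) - 1 + (6 * t + 4 * t * d + 1) * γ) := by
    rw [Finset.eventually_all]
    intro t _
    rw [Finset.eventually_all]
    intro d hd
    exact eventually_abs_sum_prod_nu_sub_le_of_card t d (Finset.mem_Icc.1 hd).1 hγ hγ1 hC hc hε
  filter_upwards [h1, eventually_ge_atTop 1] with N hN hN1
  intro ι _ hcard d hd1 hdD Ψ hΨ K hK hKb S hS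
  refine (hN (Fintype.card ι) (Finset.mem_range.2 (by omega)) d (Finset.mem_Icc.2 ⟨hd1, hdD⟩) ι rfl
    Ψ hΨ K hK hKb S hS).trans ?_
  gcongr
  · exact_mod_cast hN1
  · unfold errorExponent
    have h2 : ((Fintype.card ι : ℕ) : ℝ) ≤ D := by exact_mod_cast hcard
    have h3 : (d : ℝ) ≤ D := by exact_mod_cast hdD
    gcongr

/-- Pointwise bounds for the normalised majorant. -/
theorem eventually_nu_le {γ : ℝ} (hγ : 0 < γ) (hγ1 : γ ≤ 1 / 12) {C : ℕ → ℝ}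
    (hC : IsNormalising γ C) :
    ∀ᶠ N : ℕ in atTop, ∀ n : ℤ, 0 ≤ nu γ C N n ∧ nu γ C N n ≤ 2 * (N : ℝ) ^ (6 * γ) := by
  have hm := hC.tendsto_meanSum_div hγ hγ1
  filter_upwards [hm.eventually_lt_const one_lt_two, hm.eventually_const_lt one_pos,
    eventually_totalSum_le hγ, eventually_ge_atTop 2] with N hm2 hm0 htot hN2 n
  have hmean := one_le_meanSum hγ hN2
  have hCpos : 0 < C N := by
    by_contra h
    push Not at h
    exact absurd hm0 (not_lt.2 (div_nonpos_of_nonneg_of_nonpos (by linarith) h))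
  have h0 := nuSum_nonneg hγ N n
  refine ⟨div_nonneg h0 hCpos.le, ?_⟩
  rw [nu, div_le_iff₀ hCpos]
  rw [div_lt_iff₀ hCpos] at hm2
  have h1 := (nuSum_le_totalSum hγ N n).trans htot
  have h2 : 0 ≤ (N : ℝ) ^ (6 * γ) := by positivity
  nlinarith

/-- The exponent of the error term in the averaged estimate. -/
noncomputable def averageExponent (D : ℕ) : ℝ := errorExponent D + 6 * D + 1

/-- The linear forms estimate for averages. When the volume of `K` is too small for the summed
estimate to be of use, the error term exceeds the trivial bound. -/
theorem eventually_abs_latticeAverage_sub_one_le (D : ℕ) {γ : ℝ} (hγ : 0 < γ)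
    (hγ1 : γ ≤ 1 / 12) {C : ℕ → ℝ} (hC : IsNormalising γ C) {ε : ℝ} (hε : 0 < ε) :
    ∀ᶠ N : ℕ in atTop, ∀ d t : ℕ, 1 ≤ d → d ≤ D → t ≤ D →
      ∀ Ψ : Fin t → AffineForm d, (∀ p : ℕ, p.Prime → w N < p → Unexceptional Ψ p) →
      ∀ K : Set (Fin d → ℝ), IsConvexBody K → (∀ x ∈ K, ∀ k, |x k| ≤ (N : ℝ)) →
      |latticeAverage K (fun n => ∏ j, nu γ C N ((Ψ j).eval n)) - 1| ≤
        4 * ((N : ℝ) ^ ((d : ℝ) - 1 + averageExponent D * γ) / volume.real K) + ε := by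
  set ε' := min (ε / 8) (1 / 8) with hε'
  have hε'0 : 0 < ε' := lt_min (by positivity) (by norm_num)
  have hε'1 : ε' ≤ ε / 8 := min_le_left _ _
  have hε'2 : ε' ≤ 1 / 8 := min_le_right _ _
  filter_upwards [eventually_abs_sum_prod_nu_sub_le D hγ hγ1 hC zero_le_one hε'0,
    eventually_nu_le hγ hγ1 hC, eventually_ge_atTop 2, eventually_le_rpow (1 + 2 ^ D) hγ] with
    N hN hnu hN2 hbig
  intro d t hd1 hdD htD Ψ hΨ K hK hKb
  have hN1 : (1 : ℝ) ≤ N := by exact_mod_cast (by omega : 1 ≤ N)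
  have hN0 : (0 : ℝ) < N := by linarith
  have hbox : ∀ x ∈ K, ∀ k,
      x k ∈ Set.Icc ((fun _ => -(N : ℝ)) k) ((fun _ => -(N : ℝ)) k + 2 * N) := by
    intro x hx k
    have := abs_le.1 (hKb x hx k)
    exact ⟨this.1, by simp only; linarith⟩
  have hfin := finite_latticePoints hbox
  set S := hfin.toFinset with hS
  have hSmem : ∀ n, n ∈ S ↔ n ∈ latticePoints K := fun n => hfin.mem_toFinset
  have hKb' : ∀ x ∈ K, ∀ k, |x k| ≤ 1 * (N : ℝ) := by simpa using hKb
  set V := volume.real K with hV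
  have hV0 : 0 < V := by
    rw [hV, measureReal_def, ENNReal.toReal_pos_iff]
    refine ⟨?_, hK.2.1.measure_lt_top⟩
    exact (isOpen_interior.measure_pos volume hK.2.2).trans_le (measure_mono interior_subset)
  set A := errorExponent D with hA
  set e := (N : ℝ) ^ ((d : ℝ) - 1 + A * γ) with he
  have he0 : 0 < e := by positivity
  have h1 := hN (Fin t) (by simpa using htD) d hd1 hdD Ψ hΨ K hK.1 hKb' S hSmem
  have h2 := hN (Fin 0) (by simp) d hd1 hdD (fun j => j.elim0)
    (fun p _ _ => ⟨fun i => i.elim0, fun i => i.elim0⟩) K hK.1 hKb' S hSmem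
  simp only [Finset.univ_eq_empty, Finset.prod_empty, Finset.sum_const, nsmul_eq_mul,
    mul_one] at h2
  set s := ∑ n ∈ S, ∏ j, nu γ C N ((Ψ j).eval n) with hs
  have hav : latticeAverage K (fun n => ∏ j, nu γ C N ((Ψ j).eval n)) = s / S.card := by
    rw [latticeAverage, finsum_mem_eq_finite_toFinset_sum _ hfin, Set.ncard_eq_toFinset_card _ hfin]
  rw [hav]
  have hrpow : e * (N : ℝ) ^ ((6 * D + 1) * γ) =
      (N : ℝ) ^ ((d : ℝ) - 1 + averageExponent D * γ) := by
    rw [he, ← Real.rpow_add hN0]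
    congr 1
    rw [averageExponent]
    ring
  have hgain : 1 ≤ (N : ℝ) ^ ((6 * D + 1) * γ) := Real.one_le_rpow hN1 (by positivity)
  rcases le_total e (V / 4) with hcase | hcase
  · rw [abs_le] at h1 h2
    have hcard : V / 2 ≤ S.card := by
      have : ε' * V ≤ 1 / 8 * V := by gcongr
      linarith
    have hcard0 : (0 : ℝ) < S.card := by linarith
    have h3 : |s - S.card| ≤ 2 * (ε' * V + e) := by rw [abs_le]; constructor <;> linarith
    have h4 : s / S.card - 1 = (s - S.card) / S.card := by field_simp
    rw [h4, abs_div, abs_of_pos hcard0]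
    calc |s - S.card| / S.card ≤ 2 * (ε' * V + e) / (V / 2) := by gcongr
      _ = 4 * ε' + 4 * (e / V) := by field_simp; ring
      _ ≤ ε + 4 * ((N : ℝ) ^ ((d : ℝ) - 1 + averageExponent D * γ) / V) := by
          rw [← hrpow]
          have : e ≤ e * (N : ℝ) ^ ((6 * D + 1) * γ) := le_mul_of_one_le_right he0.le hgain
          gcongr
          linarith
      _ = _ := by ring
  · have h5 : (N : ℝ) ^ ((6 * D + 1) * γ) ≤
        4 * ((N : ℝ) ^ ((d : ℝ) - 1 + averageExponent D * γ) / V) := by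
      rw [← hrpow, ← mul_div_assoc, le_div_iff₀ hV0]
      have h0 : 0 ≤ (N : ℝ) ^ ((6 * D + 1) * γ) := by positivity
      nlinarith
    have hprod : ∀ n ∈ S, ∏ j, nu γ C N ((Ψ j).eval n) ≤ 2 ^ D * (N : ℝ) ^ (6 * D * γ) := by
      intro n _
      have hone : 1 ≤ 2 * (N : ℝ) ^ (6 * γ) := by
        have := Real.one_le_rpow hN1 (by positivity : 0 ≤ 6 * γ)
        linarith
      calc ∏ j, nu γ C N ((Ψ j).eval n) ≤ ∏ _j : Fin t, (2 * (N : ℝ) ^ (6 * γ)) :=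
            Finset.prod_le_prod (fun j _ => (hnu _).1) fun j _ => (hnu _).2
        _ = (2 * (N : ℝ) ^ (6 * γ)) ^ t := by simp
        _ ≤ (2 * (N : ℝ) ^ (6 * γ)) ^ D := pow_le_pow_right₀ hone htD
        _ = 2 ^ D * (N : ℝ) ^ (6 * D * γ) := by
            rw [mul_pow, ← Real.rpow_natCast ((N : ℝ) ^ (6 * γ)), ← Real.rpow_mul hN0.le]
            ring_nf
    have hs0 : 0 ≤ s := Finset.sum_nonneg fun n _ => Finset.prod_nonneg fun j _ => (hnu _).1
    have hs1 : s / S.card ≤ 2 ^ D * (N : ℝ) ^ (6 * D * γ) := by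
      refine div_le_of_le_mul₀ (by positivity) (by positivity) ?_
      refine (Finset.sum_le_sum hprod).trans (le_of_eq ?_)
      rw [Finset.sum_const, nsmul_eq_mul, mul_comm]
    have hs2 : 0 ≤ s / S.card := by positivity
    have hD1 : 1 ≤ (N : ℝ) ^ (6 * D * γ) := Real.one_le_rpow hN1 (by positivity)
    have h6 : (N : ℝ) ^ ((6 * D + 1) * γ) = (N : ℝ) ^ γ * (N : ℝ) ^ (6 * D * γ) := by
      rw [← Real.rpow_add hN0]; ring_nf
    have h7 : (1 + 2 ^ D) * (N : ℝ) ^ (6 * D * γ) ≤ (N : ℝ) ^ ((6 * D + 1) * γ) := by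
      rw [h6]; gcongr
    rw [abs_le]
    constructor <;> nlinarith

theorem unexceptional_of_not_isExceptional {d t : ℕ} {Ψ : Fin t → AffineForm d} {p : ℕ}
    (h : ¬ IsExceptional Ψ p) : Unexceptional Ψ p :=
  ⟨fun i j hij hr => h (Or.inl ⟨i, j, hij, hr⟩), fun i hi => h (Or.inr ⟨i, hi⟩)⟩

/-! ### Systems of finite complexity along an arithmetic progression -/

/-- The form `a ψ + b`. -/
def AffineForm.affine {d : ℕ} (a b : ℤ) (ψ : AffineForm d) : AffineForm d where
  coeff k := a * ψ.coeff k
  const := a * ψ.const + b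

theorem AffineForm.eval_affine {d : ℕ} {R : Type*} [CommRing R] (a b : ℤ) (ψ : AffineForm d)
    (x : Fin d → R) : (ψ.affine a b).eval x = (a : R) * ψ.eval x + (b : R) := by
  simp only [AffineForm.eval, AffineForm.affine]
  push_cast
  rw [mul_add, Finset.mul_sum, add_assoc]
  simp only [mul_assoc]

/-- The exceptional primes of a system of finite complexity with coefficients at most `D`,
restricted to a progression of modulus `a`, divide `a` or are at most `2 D²`: otherwise a
`2 × 2` minor that vanishes modulo `p` vanishes. -/
theorem FiniteComplexity.unexceptional_affine {d t : ℕ} {Ψ : Fin t → AffineForm d}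
    (h : FiniteComplexity Ψ) {D : ℕ} (hD : ∀ j k, |(Ψ j).coeff k| ≤ (D : ℤ)) {p : ℕ}
    (hp : p.Prime) (hpD : 2 * D * D < p) {a : ℤ} (hpa : ¬ (p : ℤ) ∣ a) (b : Fin t → ℤ) :
    Unexceptional (fun j => (Ψ j).affine a (b j)) p := by
  have : Fact p.Prime := ⟨hp⟩
  have ha : (a : ZMod p) ≠ 0 := by rwa [Ne, ZMod.intCast_zmod_eq_zero_iff_dvd]
  have hpD' : (2 * D * D : ℤ) < p := by exact_mod_cast hpD
  constructor
  · rintro i j hij ⟨x, y, hxy, hk⟩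
    have hk' : ∀ k, x * ((Ψ i).coeff k : ZMod p) + y * ((Ψ j).coeff k : ZMod p) = 0 := by
      intro k
      have := hk k
      simp only [AffineForm.affine] at this
      push_cast at this
      have h2 : (a : ZMod p) *
          (x * ((Ψ i).coeff k : ZMod p) + y * ((Ψ j).coeff k : ZMod p)) = 0 := by
        rw [← this]; ring
      exact (mul_eq_zero.1 h2).resolve_left ha
    have hminor : ∀ k l, (Ψ i).coeff k * (Ψ j).coeff l - (Ψ i).coeff l * (Ψ j).coeff k = 0 := by
      intro k l
      have hz : (((Ψ i).coeff k * (Ψ j).coeff l - (Ψ i).coeff l * (Ψ j).coeff k : ℤ) : ZMod p) =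
          0 := by
        push_cast
        have h1 := hk' k
        have h2 := hk' l
        rcases hxy with hx | hy
        · have : x * (((Ψ i).coeff k : ZMod p) * ((Ψ j).coeff l : ZMod p) -
              ((Ψ i).coeff l : ZMod p) * ((Ψ j).coeff k : ZMod p)) = 0 := by
            linear_combination ((Ψ j).coeff l : ZMod p) * h1 - ((Ψ j).coeff k : ZMod p) * h2
          exact (mul_eq_zero.1 this).resolve_left hx
        · have : y * (((Ψ i).coeff k : ZMod p) * ((Ψ j).coeff l : ZMod p) -
              ((Ψ i).coeff l : ZMod p) * ((Ψ j).coeff k : ZMod p)) = 0 := by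
            linear_combination ((Ψ i).coeff k : ZMod p) * h2 - ((Ψ i).coeff l : ZMod p) * h1
          exact (mul_eq_zero.1 this).resolve_left hy
      refine Int.eq_zero_of_abs_lt_dvd ((ZMod.intCast_zmod_eq_zero_iff_dvd _ _).1 hz) ?_
      have e1 : |(Ψ i).coeff k * (Ψ j).coeff l| ≤ D * D := by
        rw [abs_mul]; exact mul_le_mul (hD _ _) (hD _ _) (abs_nonneg _) (by positivity)
      have e2 : |(Ψ i).coeff l * (Ψ j).coeff k| ≤ D * D := by
        rw [abs_mul]; exact mul_le_mul (hD _ _) (hD _ _) (abs_nonneg _) (by positivity)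
      have e3 := abs_sub ((Ψ i).coeff k * (Ψ j).coeff l) ((Ψ i).coeff l * (Ψ j).coeff k)
      linarith
    obtain ⟨l, hl⟩ := Function.ne_iff.1 (h.1 i)
    have := (h.2 i j hij ((Ψ j).coeff l) (-(Ψ i).coeff l) fun k => by
      linear_combination hminor k l).2
    exact hl (neg_eq_zero.1 this)
  · intro i hi
    obtain ⟨l, hl⟩ := Function.ne_iff.1 (h.1 i)
    have h1 := hi l
    simp only [AffineForm.affine] at h1
    push_cast at h1
    have h2 := (mul_eq_zero.1 h1).resolve_left ha
    apply hl
    refine Int.eq_zero_of_abs_lt_dvd ((ZMod.intCast_zmod_eq_zero_iff_dvd _ _).1 h2) ?_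
    have h3 := hD i l
    have h4 : (D : ℤ) ≤ 2 * D * D := by
      rcases Nat.eq_zero_or_pos D with h0 | h0
      · simp [h0]
      · have : (1 : ℤ) ≤ D := by exact_mod_cast h0
        nlinarith
    linarith

theorem one_le_Wbar (C₁ : ℝ) (N : ℕ) : 1 ≤ Wbar C₁ N := by
  rw [Wbar]
  exact Finset.one_le_prod' fun p hp => Nat.one_le_pow _ _ (Finset.mem_filter.1 hp).2.pos

/-- The primes dividing `Wbar` are at most `w(N)`. -/
theorem le_of_prime_dvd_Wbar {C₁ : ℝ} {N p : ℕ} (hp : p.Prime) (h : p ∣ Wbar C₁ N) :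
    p ≤ ⌊w N⌋₊ := by
  obtain ⟨q, hq, hpq⟩ := (Prime.dvd_finsetProd_iff hp.prime _).1 h
  obtain ⟨h1, h2⟩ := Finset.mem_filter.1 hq
  have : p = q := (Nat.prime_dvd_prime_iff_eq hp h2).1 (hp.dvd_of_dvd_pow hpq)
  have := Finset.mem_range.1 h1
  omega

/-- Along progressions modulo `Wbar`, systems of finite complexity with bounded coefficients have
no exceptional primes beyond `w(N)`, whatever the shifts. -/
theorem eventually_unexceptional_affine_Wbar (D : ℕ) (C₁ : ℝ) :
    ∀ᶠ N : ℕ in atTop, ∀ d t : ℕ, ∀ Ψ : Fin t → AffineForm d, FiniteComplexity Ψ →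
      (∀ j k, |(Ψ j).coeff k| ≤ (D : ℤ)) → ∀ b : Fin t → ℤ, ∀ p : ℕ, p.Prime → w N < p →
      Unexceptional (fun j => (Ψ j).affine (Wbar C₁ N) (b j)) p := by
  filter_upwards [tendsto_w.eventually_gt_atTop ((2 * D * D : ℕ) : ℝ)] with N hN
  intro d t Ψ hΨ hD b p hp hwp
  refine hΨ.unexceptional_affine hD hp (by exact_mod_cast hN.trans hwp) ?_ b
  intro hdvd
  have h1 := le_of_prime_dvd_Wbar hp (Int.natCast_dvd_natCast.1 hdvd)
  have h2 : (p : ℝ) ≤ w N := (Nat.le_floor_iff' hp.ne_zero).1 h1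
  linarith

end DivisorMajorant

namespace DivisorMajorant

/-! ### The size of the modulus `Wbar` -/

/-- Each of the at most `w(N) + 1` prime powers in `Wbar` is at most `(log N) ^ C₁`. -/
theorem eventually_Wbar_le {C₁ : ℝ} (hC₁ : 0 ≤ C₁) {δ : ℝ} (hδ : 0 < δ) :
    ∀ᶠ N : ℕ in atTop, (Wbar C₁ N : ℝ) ≤ (N : ℝ) ^ δ := by
  filter_upwards [eventually_log_log ((eventually_ge_atTop (2 : ℝ)).and
    (eventually_mul_pow_le_exp (C₁ / δ) 2))] with N hN
  obtain ⟨⟨hx, hexp⟩, hlog, hN3⟩ := hN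
  set x := Real.log (Real.log N) with hxdef
  have hL : 1 ≤ Real.log N := by
    rw [hlog]; exact Real.one_le_exp (by linarith)
  have hP : 1 ≤ Real.log N ^ C₁ := Real.one_le_rpow hL hC₁
  have hfac : ∀ p ∈ (Finset.range (⌊w N⌋₊ + 1)).filter Nat.Prime,
      ((p : ℝ) ^ ⌊C₁ * Real.logb p (Real.log N)⌋₊) ≤ Real.log N ^ C₁ := by
    intro p hp
    have hp1 : (1 : ℝ) < p := by exact_mod_cast (Finset.mem_filter.1 hp).2.one_lt
    have hlb : 0 ≤ Real.logb p (Real.log N) := Real.logb_nonneg hp1 hL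
    calc (p : ℝ) ^ ⌊C₁ * Real.logb p (Real.log N)⌋₊
        = (p : ℝ) ^ ((⌊C₁ * Real.logb p (Real.log N)⌋₊ : ℕ) : ℝ) := (Real.rpow_natCast _ _).symm
      _ ≤ (p : ℝ) ^ (C₁ * Real.logb p (Real.log N)) := by
          gcongr
          · exact hp1.le
          · exact Nat.floor_le (by positivity)
      _ = Real.log N ^ C₁ := by
          rw [mul_comm, Real.rpow_mul (by linarith), Real.rpow_logb (by linarith) hp1.ne'
            (by linarith)]
  have hw0 : 0 ≤ w N := by rw [w]; linarith
  have hcard : ((((Finset.range (⌊w N⌋₊ + 1)).filter Nat.Prime).card : ℕ) : ℝ) ≤ x := by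
    have h1 : ((Finset.range (⌊w N⌋₊ + 1)).filter Nat.Prime).card ≤ ⌊w N⌋₊ + 1 := by
      simpa using Finset.card_filter_le (Finset.range (⌊w N⌋₊ + 1)) Nat.Prime
    have h2 : ((((Finset.range (⌊w N⌋₊ + 1)).filter Nat.Prime).card : ℕ) : ℝ) ≤ ⌊w N⌋₊ + 1 := by
      exact_mod_cast h1
    have h3 := Nat.floor_le hw0
    have h4 : w N = x / 2 := rfl
    linarith
  rw [Wbar]
  push_cast
  calc ∏ p ∈ (Finset.range (⌊w N⌋₊ + 1)).filter Nat.Prime,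
        (p : ℝ) ^ ⌊C₁ * Real.logb p (Real.log N)⌋₊
      ≤ ∏ _p ∈ (Finset.range (⌊w N⌋₊ + 1)).filter Nat.Prime, Real.log N ^ C₁ :=
        Finset.prod_le_prod (fun _ _ => by positivity) hfac
    _ = (Real.log N ^ C₁) ^ ((((Finset.range (⌊w N⌋₊ + 1)).filter Nat.Prime).card : ℕ) : ℝ) := by
        rw [Finset.prod_const, Real.rpow_natCast]
    _ ≤ (Real.log N ^ C₁) ^ x := by gcongr
    _ = Real.exp (C₁ * x ^ 2) := by
        rw [hlog, ← Real.exp_mul, ← Real.exp_mul]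
        congr 1
        ring
    _ ≤ Real.exp (δ * Real.exp x) := by
        rw [Real.exp_le_exp]
        rw [div_mul_eq_mul_div, div_le_iff₀ hδ] at hexp
        linarith
    _ = (N : ℝ) ^ δ := (rpow_eq_exp_mul_exp hN3 hlog).symm

/-! ### The linear forms condition on cyclic groups -/

/-- The average of `1` and an average of functions is a convex combination; so estimates for
the products over subsystems of the functions pass to products of such averages. -/
theorem abs_sum_prod_average_sub_le {α : Type*} (S : Finset α) {t r : ℕ} (hr : 1 ≤ r)
    (J : Finset (Fin t)) (g : Fin t → Fin r → α → ℝ) {V η : ℝ}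
    (h : ∀ (I : Finset (Fin t)) (a : Fin t → Fin r),
      |∑ m ∈ S, ∏ j ∈ I, g j (a j) m - V| ≤ η) :
    |∑ m ∈ S, ∏ j, (if j ∈ J then (1 + (∑ i, g j i m) / r) / 2 else 1) - V| ≤ η := by
  have hr0 : (0 : ℝ) < r := by exact_mod_cast hr
  let wt : Option (Fin r) → ℝ := fun o => o.elim (1 / 2) fun _ => 1 / (2 * r)
  have hwt0 : ∀ o, 0 ≤ wt o := by
    rintro (_ | _) <;> simp only [wt, Option.elim] <;> positivity
  have hwt1 : ∑ o, wt o = 1 := by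
    rw [Fintype.sum_option]
    simp only [wt, Option.elim, Finset.sum_const, Finset.card_univ, Fintype.card_fin, nsmul_eq_mul]
    field_simp
    norm_num
  let f : Fin t → Option (Fin r) → α → ℝ := fun j o m =>
    if j ∈ J then o.elim 1 fun i => g j i m else 1
  have hfac : ∀ m j, (if j ∈ J then (1 + (∑ i, g j i m) / r) / 2 else 1) =
      ∑ o, wt o * f j o m := by
    intro m j
    by_cases hj : j ∈ J
    · simp only [f, hj, if_true]
      rw [Fintype.sum_option]
      simp only [wt, Option.elim]
      rw [← Finset.mul_sum]
      field_simp
    · simp only [f, hj, if_false, mul_one]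
      exact hwt1.symm
  have hexpand : ∀ m, ∏ j, (if j ∈ J then (1 + (∑ i, g j i m) / r) / 2 else 1) =
      ∑ o : Fin t → Option (Fin r), (∏ j, wt (o j)) * ∏ j, f j (o j) m := by
    intro m
    simp_rw [hfac m]
    rw [Finset.prod_univ_sum]
    simp only [Finset.prod_mul_distrib, Fintype.piFinset_univ]
  have htot : ∑ o : Fin t → Option (Fin r), ∏ j, wt (o j) = 1 := by
    have := Finset.prod_univ_sum (fun _ : Fin t => (Finset.univ : Finset (Option (Fin r))))
      fun _ o => wt o
    rw [Fintype.piFinset_univ] at this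
    rw [← this]
    simp [hwt1]
  have hone : ∀ o : Fin t → Option (Fin r), |∑ m ∈ S, ∏ j, f j (o j) m - V| ≤ η := by
    intro o
    convert h (J.filter fun j => (o j).isSome) (fun j => (o j).getD ⟨0, hr⟩) using 4 with m hm
    rw [Finset.prod_filter, ← Finset.prod_filter_mul_prod_filter_not Finset.univ (· ∈ J)]
    rw [Finset.prod_eq_one (s := Finset.univ.filter fun j => ¬ j ∈ J), mul_one]
    · refine Finset.prod_congr (by ext; simp) fun j hj => ?_
      have hj' : j ∈ J := by simpa using hj
      simp only [f, hj', if_true]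
      cases o j <;> simp
    · intro j hj
      simp only [Finset.mem_filter, Finset.mem_univ, true_and] at hj
      simp [f, hj]
  have hV : ∑ m ∈ S, ∏ j, (if j ∈ J then (1 + (∑ i, g j i m) / r) / 2 else 1) - V =
      ∑ o : Fin t → Option (Fin r), (∏ j, wt (o j)) * (∑ m ∈ S, ∏ j, f j (o j) m - V) := by
    simp_rw [hexpand, mul_sub, Finset.sum_sub_distrib, Finset.mul_sum]
    rw [Finset.sum_comm, ← Finset.sum_mul, htot, one_mul]
  rw [hV]
  calc _ ≤ ∑ o : Fin t → Option (Fin r), |(∏ j, wt (o j)) * (∑ m ∈ S, ∏ j, f j (o j) m - V)| :=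
        Finset.abs_sum_le_sum_abs _ _
    _ ≤ ∑ o : Fin t → Option (Fin r), (∏ j, wt (o j)) * η := by
        refine Finset.sum_le_sum fun o _ => ?_
        rw [abs_mul, abs_of_nonneg (Finset.prod_nonneg fun j _ => hwt0 _)]
        exact mul_le_mul_of_nonneg_left (hone o) (Finset.prod_nonneg fun j _ => hwt0 _)
    _ = η := by rw [← Finset.sum_mul, htot, one_mul]

/-- The integer vectors with coordinates in `{0, …, q - 1}`. -/
noncomputable def residueBox (d q : ℕ) : Finset (Fin d → ℤ) :=
  Fintype.piFinset fun _ => Finset.Ico (0 : ℤ) q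

theorem mem_residueBox {d q : ℕ} {m : Fin d → ℤ} :
    m ∈ residueBox d q ↔ ∀ k, 0 ≤ m k ∧ m k < q := by
  simp [residueBox]

theorem card_residueBox (d q : ℕ) : (residueBox d q).card = q ^ d := by
  simp [residueBox]

theorem sum_zmod_eq_sum_residueBox {d q : ℕ} [NeZero q] (F : (Fin d → ZMod q) → ℝ) :
    ∑ n, F n = ∑ m ∈ residueBox d q, F fun k => (m k : ZMod q) := by
  refine Finset.sum_bij' (fun n _ k => ((n k).val : ℤ)) (fun m _ k => (m k : ZMod q)) ?_ ?_ ?_ ?_ ?_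
  · intro n _
    exact mem_residueBox.2 fun k => ⟨by positivity, by exact_mod_cast ZMod.val_lt _⟩
  · intro m _
    exact Finset.mem_univ _
  · intro n _
    ext k
    simp
  · intro m hm
    ext k
    have := mem_residueBox.1 hm k
    rw [ZMod.val_intCast, Int.emod_eq_of_lt this.1 this.2]
  · intro n _
    simp

/-- The number of multiples of `q` by which `y` exceeds its representative in `{1, …, q}`. -/
def wrap (q : ℕ) (y : ℤ) : ℤ := (y - 1) / q

theorem sub_wrap_mem {q : ℕ} (hq : 1 ≤ q) (y : ℤ) :
    1 ≤ y - wrap q y * q ∧ y - wrap q y * q ≤ q := by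
  have hq' : (0 : ℤ) < q := by exact_mod_cast hq
  have h1 := Int.emod_add_mul_ediv (y - 1) q
  have h2 := Int.emod_nonneg (y - 1) hq'.ne'
  have h3 := Int.emod_lt_of_pos (y - 1) hq'
  rw [wrap, mul_comm]
  constructor <;> linarith

theorem wrap_eq_of_mem {q : ℕ} (hq : 1 ≤ q) {y k : ℤ} (h1 : 1 ≤ y - k * q)
    (h2 : y - k * q ≤ q) : wrap q y = k := by
  have hq' : (0 : ℤ) < q := by exact_mod_cast hq
  rw [wrap, Int.ediv_eq_iff_of_pos hq']
  constructor <;> linarith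

/-- `ν*` in terms of representatives in `{1, …, M'}`. The representative `M'` has `val = 0`, but
it exceeds `N / Wbar`. -/
theorem nuStar_intCast (γ : ℝ) (C : ℕ → ℝ) (C₁ : ℝ) (N : ℕ) {r : ℕ} (b : Fin r → ℕ) {M' : ℕ}
    [NeZero M'] (hM : (N : ℝ) / Wbar C₁ N < M') (y : ℤ) :
    nuStar γ C C₁ N b M' (y : ZMod M') =
      if ((y - wrap M' y * M' : ℤ) : ℝ) ≤ (N : ℝ) / Wbar C₁ N then
        (1 + (∑ i, nu γ C N ((Wbar C₁ N : ℤ) * (y - wrap M' y * M') + (b i : ℤ))) / (r : ℝ)) / 2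
      else 1 := by
  have hM' : 1 ≤ M' := NeZero.one_le
  set ρ := y - wrap M' y * M' with hρ
  have hρ1 := sub_wrap_mem hM' y
  rw [← hρ] at hρ1
  have hcast : (y : ZMod M') = (ρ : ZMod M') := by rw [hρ]; simp
  have hval : (((ρ : ZMod M').val : ℕ) : ℤ) = ρ % M' := ZMod.val_intCast ρ
  rw [hcast, nuStar]
  rcases hρ1.2.lt_or_eq with hlt | heq
  · rw [Int.emod_eq_of_lt (by linarith) hlt] at hval
    have h1 : 1 ≤ (ρ : ZMod M').val := by omega
    have hvalR : (((ρ : ZMod M').val : ℕ) : ℝ) = (ρ : ℝ) := by exact_mod_cast hval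
    simp only [h1, true_and, hvalR, hval]
  · have h0 : (ρ : ZMod M').val = 0 := by
      have h1 : (((ρ : ZMod M').val : ℕ) : ℤ) = 0 := by rw [hval, heq, Int.emod_self]
      exact_mod_cast h1
    have h2 : ¬ (ρ : ℝ) ≤ (N : ℝ) / Wbar C₁ N := by
      rw [heq]; push_cast; linarith
    simp [h0, h2]

theorem convex_eval_preimage {d : ℕ} (ψ : AffineForm d) (z : ℝ) {I : Set ℝ} (hI : Convex ℝ I) :
    Convex ℝ {x : Fin d → ℝ | ψ.eval x - z ∈ I} := by
  intro x hx y hy a b ha hb hab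
  have h : ψ.eval (a • x + b • y) - z = a • (ψ.eval x - z) + b • (ψ.eval y - z) := by
    simp only [AffineForm.eval, Pi.add_apply, Pi.smul_apply, smul_eq_mul, mul_add,
      Finset.sum_add_distrib, mul_sub, Finset.mul_sum]
    have h1 : ∀ k, (ψ.coeff k : ℝ) * (a * x k) = a * ((ψ.coeff k : ℝ) * x k) := fun k => by ring
    have h2 : ∀ k, (ψ.coeff k : ℝ) * (b * y k) = b * ((ψ.coeff k : ℝ) * y k) := fun k => by ring
    simp only [h1, h2]
    linear_combination (z - ψ.const) * hab
  change ψ.eval (a • x + b • y) - z ∈ I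
  rw [h]
  exact hI hx hy ha hb hab

end DivisorMajorant

namespace DivisorMajorant

/-- Reduction of the linear forms condition to sums over convex sets: the box is cut into
boundedly many pieces, on each of which every form wraps around `ℤ/M'ℤ` a constant number of
times and its representative stays on one side of `N / Wbar`. -/
theorem abs_sum_prod_nuStar_sub_le {γ : ℝ} {C : ℕ → ℝ} {C₁ : ℝ} {N M' r d t D : ℕ}
    [NeZero M'] (hM : (N : ℝ) / Wbar C₁ N < M') (hr : 1 ≤ r) (b : Fin r → ℕ)
    {Ψ : Fin t → AffineForm d} (hD : ∀ j k, |(Ψ j).coeff k| ≤ (D : ℤ)) {η : ℝ}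
    (hest : ∀ (I : Finset (Fin t)) (a : Fin t → ℤ) (K : Set (Fin d → ℝ)), Convex ℝ K →
      (∀ x ∈ K, ∀ k, 0 ≤ x k ∧ x k ≤ M') →
      ∀ S : Finset (Fin d → ℤ), (∀ m, m ∈ S ↔ m ∈ latticePoints K) →
      |∑ m ∈ S, ∏ j ∈ I, nu γ C N (((Ψ j).affine (Wbar C₁ N) (a j)).eval m) - volume.real K| ≤ η) :
    |∑ n : Fin d → ZMod M', ∏ j, nuStar γ C C₁ N b M' ((Ψ j).eval n) - (M' : ℝ) ^ d| ≤
      ((2 * d * D + 1) * 2) ^ t * (2 * η) := by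
  have hM' : 1 ≤ M' := NeZero.one_le
  have hMz : (0 : ℤ) < M' := by exact_mod_cast hM'
  set L := (N : ℝ) / Wbar C₁ N with hL
  let rep : Fin t → (Fin d → ℤ) → ℤ := fun j m =>
    (Ψ j).eval m - wrap M' ((Ψ j).eval m) * M'
  let key : (Fin d → ℤ) → Fin t → ℤ × Bool := fun m j =>
    (wrap M' ((Ψ j).eval m), decide ((rep j m : ℝ) ≤ L))
  set F : (Fin d → ℤ) → ℝ := fun m => ∏ j, nuStar γ C C₁ N b M' (((Ψ j).eval m : ℤ) : ZMod M')
    with hF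
  have hsum : ∑ n : Fin d → ZMod M', ∏ j, nuStar γ C C₁ N b M' ((Ψ j).eval n) =
      ∑ m ∈ residueBox d M', F m := by
    rw [sum_zmod_eq_sum_residueBox]
    simp only [hF, eval_intCast]
  -- each form wraps around at most `2 d D + 1` numbers of times
  let keys : Finset (Fin t → ℤ × Bool) := Fintype.piFinset fun j =>
    Finset.Icc (((Ψ j).const - 1) / (M' : ℤ) - d * D) (((Ψ j).const - 1) / (M' : ℤ) + d * D) ×ˢ
      Finset.univ
  have hkeys : keys.card = ((2 * d * D + 1) * 2) ^ t := by
    simp only [keys, Fintype.card_piFinset, Finset.card_product, Int.card_Icc, Finset.card_univ,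
      Fintype.card_bool]
    rw [Finset.prod_congr rfl (g := fun _ => (2 * d * D + 1) * 2)]
    · simp
    · intro j _
      congr 1
      have : ((Ψ j).const - 1) / (M' : ℤ) + d * D + 1 - (((Ψ j).const - 1) / (M' : ℤ) - d * D) =
          ((2 * d * D + 1 : ℕ) : ℤ) := by push_cast; ring
      rw [this, Int.toNat_natCast]
  have hmaps : ∀ m ∈ residueBox d M', key m ∈ keys := by
    intro m hm
    refine Fintype.mem_piFinset.2 fun j => Finset.mem_product.2 ⟨?_, Finset.mem_univ _⟩
    have hlin : |∑ k, (Ψ j).coeff k * m k| ≤ d * D * M' := by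
      calc |∑ k, (Ψ j).coeff k * m k| ≤ ∑ k, |(Ψ j).coeff k * m k| :=
            Finset.abs_sum_le_sum_abs _ _
        _ ≤ ∑ _k : Fin d, (D * M' : ℤ) := by
            refine Finset.sum_le_sum fun k _ => ?_
            have hk := mem_residueBox.1 hm k
            rw [abs_mul, abs_of_nonneg hk.1]
            exact mul_le_mul (hD j k) hk.2.le hk.1 (by positivity)
        _ = d * D * M' := by simp [mul_assoc]
    have heval : (Ψ j).eval m = ∑ k, (Ψ j).coeff k * m k + (Ψ j).const := by
      simp [AffineForm.eval]
    rw [abs_le] at hlin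
    rw [Finset.mem_Icc]
    constructor
    · change _ ≤ ((Ψ j).eval m - 1) / (M' : ℤ)
      rw [sub_eq_add_neg, ← Int.add_mul_ediv_right _ _ hMz.ne']
      exact Int.ediv_le_ediv hMz (by rw [heval]; linarith)
    · change ((Ψ j).eval m - 1) / (M' : ℤ) ≤ _
      rw [← Int.add_mul_ediv_right _ _ hMz.ne']
      exact Int.ediv_le_ediv hMz (by rw [heval]; linarith)
  have hfibre : ∀ κ ∈ keys, |∑ m ∈ residueBox d M' with key m = κ, F m -
      (((residueBox d M').filter fun m => key m = κ).card : ℝ)| ≤ 2 * η := by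
    intro κ _
    set S := (residueBox d M').filter fun m => key m = κ with hS
    let J : Finset (Fin t) := Finset.univ.filter fun j => (κ j).2 = true
    let K : Set (Fin d → ℝ) := Set.pi Set.univ (fun _ => Set.Icc (0 : ℝ) (M' - 1)) ∩
      ⋂ j, {x | (Ψ j).eval x - ((κ j).1 * M' : ℤ) ∈
        Set.Icc (1 : ℝ) M' ∩ if (κ j).2 = true then Set.Iic L else Set.Ioi L}
    have hKc : Convex ℝ K := by
      refine (convex_pi fun _ _ => convex_Icc _ _).inter (convex_iInter fun j => ?_)
      refine convex_eval_preimage _ _ ((convex_Icc _ _).inter ?_)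
      split_ifs
      · exact convex_Iic _
      · exact convex_Ioi _
    have hKb : ∀ x ∈ K, ∀ k, 0 ≤ x k ∧ x k ≤ (M' : ℝ) := by
      intro x hx k
      have := hx.1 k (Set.mem_univ k)
      exact ⟨this.1, by linarith [this.2]⟩
    have hbox : ∀ m : Fin d → ℤ, m ∈ residueBox d M' ↔
        (fun k => (m k : ℝ)) ∈ Set.pi Set.univ (fun _ : Fin d => Set.Icc (0 : ℝ) (M' - 1)) := by
      intro m
      simp only [mem_residueBox, Set.mem_pi, Set.mem_univ, true_imp_iff, Set.mem_Icc]
      refine forall_congr' fun k => and_congr (by exact_mod_cast Iff.rfl) ?_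
      rw [← Int.le_sub_one_iff]
      exact_mod_cast Iff.rfl
    have hkey : ∀ m, key m = κ ↔ ∀ j, (Ψ j).eval (fun k => (m k : ℝ)) - ((κ j).1 * M' : ℤ) ∈
        Set.Icc (1 : ℝ) M' ∩ if (κ j).2 = true then Set.Iic L else Set.Ioi L := by
      intro m
      rw [funext_iff]
      refine forall_congr' fun j => ?_
      rw [← eval_intCast, ← Int.cast_sub]
      constructor
      · intro h
        rw [← h]
        have h1 := sub_wrap_mem hM' ((Ψ j).eval m)
        refine ⟨⟨by exact_mod_cast h1.1, by exact_mod_cast h1.2⟩, ?_⟩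
        by_cases h2 : (rep j m : ℝ) ≤ L
        · simp only [key, h2, decide_true, if_true]; exact h2
        · simp only [key, h2, decide_false]
          exact not_le.1 h2
      · rintro ⟨⟨h1, h2⟩, h3⟩
        have h4 : wrap M' ((Ψ j).eval m) = (κ j).1 :=
          wrap_eq_of_mem hM' (by exact_mod_cast h1) (by exact_mod_cast h2)
        refine Prod.ext h4 ?_
        simp only [key, rep, h4]
        by_cases h5 : (κ j).2 = true
        · rw [if_pos h5] at h3
          rw [h5, decide_eq_true_iff]
          exact h3
        · rw [if_neg h5] at h3
          rw [Bool.not_eq_true] at h5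
          rw [h5, decide_eq_false_iff_not, not_le]
          exact h3
    have hSK : ∀ m, m ∈ S ↔ m ∈ latticePoints K := by
      intro m
      rw [hS, Finset.mem_filter, hbox, hkey]
      simp only [latticePoints, K, Set.mem_ofPred_eq, Set.mem_inter_iff, Set.mem_iInter]
    have hcount := hest ∅ (fun _ => 0) K hKc hKb S hSK
    simp only [Finset.prod_empty, Finset.sum_const, nsmul_eq_mul, mul_one] at hcount
    have hprod := abs_sum_prod_average_sub_le S hr J (fun j i m =>
      nu γ C N (((Ψ j).affine (Wbar C₁ N) ((b i : ℤ) - Wbar C₁ N * ((κ j).1 * M'))).eval m))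
      (fun I a => hest I (fun j => (b (a j) : ℤ) - Wbar C₁ N * ((κ j).1 * M')) K hKc hKb S hSK)
    have hFS : ∑ m ∈ S, F m = ∑ m ∈ S, ∏ j, (if j ∈ J then (1 + (∑ i, nu γ C N
        (((Ψ j).affine (Wbar C₁ N) ((b i : ℤ) - Wbar C₁ N * ((κ j).1 * M'))).eval m)) / r) / 2
        else 1) := by
      refine Finset.sum_congr rfl fun m hm => Finset.prod_congr rfl fun j _ => ?_
      have hmκ : key m j = κ j := congrFun (Finset.mem_filter.1 hm).2 j
      have h1 : wrap M' ((Ψ j).eval m) = (κ j).1 := congrArg Prod.fst hmκ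
      have h2 : decide ((rep j m : ℝ) ≤ L) = (κ j).2 := congrArg Prod.snd hmκ
      have h3 : j ∈ J ↔ (((Ψ j).eval m - (κ j).1 * M' : ℤ) : ℝ) ≤ L := by
        simp only [J, Finset.mem_filter, Finset.mem_univ, true_and]
        rw [← h2, decide_eq_true_iff]
        simp only [rep, h1]
      rw [nuStar_intCast γ C C₁ N b hM, h1]
      simp only [h3]
      refine if_congr Iff.rfl ?_ rfl
      congr 3
      refine Finset.sum_congr rfl fun i _ => ?_
      congr 1
      rw [AffineForm.eval_affine]
      simp only [Int.cast_id]
      ring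
    rw [hFS]
    rw [abs_le] at hcount hprod ⊢
    constructor <;> linarith [hcount.1, hcount.2, hprod.1, hprod.2]
  rw [hsum, ← Finset.sum_fiberwise_of_maps_to hmaps F]
  have hcardsum : (M' : ℝ) ^ d =
      ∑ κ ∈ keys, (((residueBox d M').filter fun m => key m = κ).card : ℝ) := by
    have := Finset.card_eq_sum_card_fiberwise (s := residueBox d M') (t := keys) (f := key) hmaps
    rw [card_residueBox] at this
    exact_mod_cast this
  rw [hcardsum, ← Finset.sum_sub_distrib]
  calc _ ≤ ∑ κ ∈ keys, |∑ m ∈ residueBox d M' with key m = κ, F m -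
        (((residueBox d M').filter fun m => key m = κ).card : ℝ)| := Finset.abs_sum_le_sum_abs _ _
    _ ≤ ∑ _κ ∈ keys, 2 * η := Finset.sum_le_sum hfibre
    _ = ((2 * d * D + 1) * 2) ^ t * (2 * η) := by
        rw [Finset.sum_const, hkeys, nsmul_eq_mul]
        push_cast
        ring

theorem Unexceptional.comp_injective {ι κ : Type*} {d : ℕ} {Ψ : ι → AffineForm d} {p : ℕ}
    (h : Unexceptional Ψ p) {f : κ → ι} (hf : Function.Injective f) :
    Unexceptional (fun j => Ψ (f j)) p :=
  ⟨fun _ _ hij => h.1 _ _ (hf.ne hij), fun _ => h.2 _⟩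

/-- The linear forms condition on `ℤ/M'ℤ`. As `Wbar` is smaller than any power of `N`, the error
`N ^ (d - 1 + O(γ))` is negligible compared with `M' ^ d`. -/
theorem eventually_abs_sum_nuStar_div_sub_one_le (D : ℕ) {γ : ℝ} (hγ : 0 < γ)
    (hγ1 : γ ≤ 1 / 12) (hγ2 : errorExponent D * γ ≤ 1 / 4) {C : ℕ → ℝ} (hC : IsNormalising γ C)
    {C₁ : ℝ} (hC₁ : 0 ≤ C₁) (c : ℝ) {ε : ℝ} (hε : 0 < ε) :
    ∀ᶠ N : ℕ in atTop, ∀ (M' : ℕ) [NeZero M'], (N : ℝ) / Wbar C₁ N < M' →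
      (M' : ℝ) ≤ c * ((N : ℝ) / Wbar C₁ N) →
      ∀ r : ℕ, 1 ≤ r → ∀ b : Fin r → ℕ, ∀ d t : ℕ, 1 ≤ d → d ≤ D → t ≤ D →
      ∀ Ψ : Fin t → AffineForm d, FiniteComplexity Ψ → (∀ j k, |(Ψ j).coeff k| ≤ (D : ℤ)) →
      |(∑ n : Fin d → ZMod M', ∏ j, nuStar γ C C₁ N b M' ((Ψ j).eval n)) / (M' : ℝ) ^ d - 1| ≤
        ε := by
  -- a bound for the number of pieces
  set Q : ℝ := ((2 * D * D + 1) * 2) ^ D * 2 with hQ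
  have hQ0 : 0 < Q := by positivity
  set ε' := ε / (2 * Q) with hε'
  have hε'0 : 0 < ε' := by positivity
  set δ : ℝ := 1 / (4 * (D + 1)) with hδ
  have hδ0 : 0 < δ := by positivity
  filter_upwards [eventually_abs_sum_prod_nu_sub_le D hγ hγ1 hC (le_max_right c 0) hε'0,
    eventually_unexceptional_affine_Wbar D C₁, eventually_Wbar_le hC₁ hδ0, eventually_ge_atTop 1,
    eventually_le_rpow (1 / ε') (by norm_num : (0 : ℝ) < 1 / 2)] with N hN hunex hWle hN1 hbig
  intro M' _ hM hMc r hr b d t hd1 hdD htD Ψ hΨ hcoef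
  have hN1' : (1 : ℝ) ≤ N := by exact_mod_cast hN1
  have hN0 : (0 : ℝ) < N := by linarith
  have hW1 : (1 : ℝ) ≤ Wbar C₁ N := by exact_mod_cast one_le_Wbar C₁ N
  have hM' : 1 ≤ M' := NeZero.one_le
  have hM0 : (0 : ℝ) < M' := by exact_mod_cast hM'
  have hMpow : 0 < (M' : ℝ) ^ d := by positivity
  have hMle : (M' : ℝ) ≤ max c 0 * N := by
    calc (M' : ℝ) ≤ c * ((N : ℝ) / Wbar C₁ N) := hMc
      _ ≤ max c 0 * ((N : ℝ) / Wbar C₁ N) := by gcongr; exact le_max_left _ _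
      _ ≤ max c 0 * N := by gcongr; exact div_le_self hN0.le hW1
  have herr : (N : ℝ) ^ ((d : ℝ) - 1 + errorExponent D * γ) ≤ ε' * (M' : ℝ) ^ d := by
    have h1 : (N : ℝ) ^ (1 - δ) ≤ M' := by
      refine le_trans ?_ hM.le
      rw [Real.rpow_sub hN0, Real.rpow_one]
      gcongr
    have h2 : (N : ℝ) ^ (d * (1 - δ)) ≤ (M' : ℝ) ^ d := by
      rw [mul_comm, Real.rpow_mul hN0.le, Real.rpow_natCast]
      gcongr
    have h3 : (d : ℝ) * δ ≤ 1 / 4 := by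
      rw [hδ, mul_one_div, div_le_div_iff₀ (by positivity) (by norm_num)]
      have : (d : ℝ) ≤ D := by exact_mod_cast hdD
      linarith
    calc (N : ℝ) ^ ((d : ℝ) - 1 + errorExponent D * γ)
        ≤ (N : ℝ) ^ (d * (1 - δ) - 1 / 2) :=
          Real.rpow_le_rpow_of_exponent_le hN1' (by linarith)
      _ = (N : ℝ) ^ (d * (1 - δ)) / (N : ℝ) ^ (1 / 2 : ℝ) := Real.rpow_sub hN0 _ _
      _ ≤ (N : ℝ) ^ (d * (1 - δ)) / (1 / ε') := by gcongr
      _ = ε' * (N : ℝ) ^ (d * (1 - δ)) := by field_simp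
      _ ≤ ε' * (M' : ℝ) ^ d := by gcongr
  have key := abs_sum_prod_nuStar_sub_le (γ := γ) (C := C) hM hr b hcoef
    (η := 2 * ε' * (M' : ℝ) ^ d) (by
      intro I a K hK hKb S hS
      have hVle : volume.real K ≤ (M' : ℝ) ^ d := by
        have hsub : K ⊆ Set.Icc (fun _ => (0 : ℝ)) (fun _ => (M' : ℝ)) :=
          fun x hx => ⟨fun k => (hKb x hx k).1, fun k => (hKb x hx k).2⟩
        refine (measureReal_mono hsub isCompact_Icc.measure_lt_top.ne).trans (le_of_eq ?_)
        rw [measureReal_def, Real.volume_Icc_pi_toReal (fun _ => hM0.le)]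
        simp
      have h1 := hN {j // j ∈ I} (by
          rw [Fintype.card_coe]
          exact (Finset.card_le_univ I).trans (by simpa using htD)) d hd1 hdD
        (fun j => (Ψ j).affine (Wbar C₁ N) (a j))
        (fun p hp hwp => (hunex d t Ψ hΨ hcoef a p hp hwp).comp_injective
          Subtype.val_injective) K hK
        (fun x hx k => by
          rw [abs_of_nonneg (hKb x hx k).1]
          exact (hKb x hx k).2.trans hMle) S hS
      simp only [← Finset.prod_coe_sort I]
      refine h1.trans ?_
      have : ε' * volume.real K ≤ ε' * (M' : ℝ) ^ d := by gcongr
      linarith)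
  rw [div_sub_one hMpow.ne', abs_div, abs_of_pos hMpow, div_le_iff₀ hMpow]
  refine key.trans ?_
  have hcount : (((2 * d * D + 1) * 2) ^ t : ℝ) ≤ ((2 * D * D + 1) * 2) ^ D := by
    have hdD' : (d : ℝ) ≤ D := by exact_mod_cast hdD
    have h0 : (0 : ℝ) ≤ D * D := by positivity
    calc (((2 * d * D + 1) * 2) ^ t : ℝ) ≤ ((2 * D * D + 1) * 2) ^ t := by gcongr
      _ ≤ ((2 * D * D + 1) * 2) ^ D := pow_le_pow_right₀ (by nlinarith) htD
  calc (((2 * d * D + 1) * 2) ^ t : ℝ) * (2 * (2 * ε' * (M' : ℝ) ^ d))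
      ≤ ((2 * D * D + 1) * 2) ^ D * (2 * (2 * ε' * (M' : ℝ) ^ d)) := by gcongr
    _ = ε * (M' : ℝ) ^ d := by
        rw [hε', hQ]
        field_simp

end DivisorMajorant

theorem mainTheorem4 (D : ℕ) :
    ∃ A B γ₀ : ℝ, 0 < γ₀ ∧
    ∀ γ : ℝ, 0 < γ → γ ≤ γ₀ →
    ∀ C : ℕ → ℝ, DivisorMajorant.IsNormalising γ C →
    -- systems with arbitrary coefficients, all of whose exceptional primes are small
    (∀ ε : ℝ, 0 < ε → ∀ᶠ N : ℕ in Filter.atTop,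
      ∀ d t : ℕ, 1 ≤ d → d ≤ D → 1 ≤ t → t ≤ D →
      ∀ Ψ : Fin t → DivisorMajorant.AffineForm d,
      (∀ p : ℕ, p.Prime → DivisorMajorant.IsExceptional Ψ p →
        (p : ℝ) ≤ DivisorMajorant.w N) →
      ∀ K : Set (Fin d → ℝ), DivisorMajorant.IsConvexBody K →
      (∀ x ∈ K, ∀ k, |x k| ≤ (N : ℝ)) →
      (∀ x ∈ K, ∀ j, (Ψ j).eval x ∈ Set.Icc (1 : ℝ) N) →
      |DivisorMajorant.latticeAverage K
          (fun n => ∏ j, DivisorMajorant.nu γ C N ((Ψ j).eval n)) - 1|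
        ≤ B * ((N : ℝ) ^ ((d : ℝ) - 1 + A * γ) / MeasureTheory.volume.real K) + ε) ∧
    -- the `D`-linear forms estimate
    (∀ C₁ : ℝ, 1 < C₁ → ∀ ε : ℝ, 0 < ε → ∀ᶠ N : ℕ in Filter.atTop,
      ∀ d t : ℕ, 1 ≤ d → d ≤ D → 1 ≤ t → t ≤ D →
      ∀ b : Fin t → ℕ, (∀ i, 1 ≤ b i ∧ b i ≤ DivisorMajorant.Wbar C₁ N) →
      ∀ idx : Fin t → Fin t,
      ∀ Ψ : Fin t → DivisorMajorant.AffineForm d, DivisorMajorant.FiniteComplexity Ψ →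
      (∀ j k, |(Ψ j).coeff k| ≤ (D : ℤ)) →
      ∀ K : Set (Fin d → ℝ), DivisorMajorant.IsConvexBody K →
      (∀ x ∈ K, ∀ k, |x k| ≤ (N : ℝ) / DivisorMajorant.Wbar C₁ N) →
      (∀ x ∈ K, ∀ j, (DivisorMajorant.Wbar C₁ N : ℝ) * (Ψ j).eval x + (b (idx j) : ℝ)
        ∈ Set.Icc (1 : ℝ) N) →
      |DivisorMajorant.latticeAverage K (fun n => ∏ j, DivisorMajorant.nu γ C N
          ((DivisorMajorant.Wbar C₁ N : ℤ) * (Ψ j).eval n + (b (idx j) : ℤ))) - 1|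
        ≤ B * ((N : ℝ) ^ ((d : ℝ) - 1 + A * γ) / MeasureTheory.volume.real K) + ε) ∧
    -- the linear forms condition on the cyclic groups `ℤ/M'ℤ`
    (∀ C₁ : ℝ, 1 < C₁ → ∀ c : ℝ, ∀ ε : ℝ, 0 < ε → ∀ᶠ N : ℕ in Filter.atTop,
      ∀ (M' : ℕ) [Fact M'.Prime],
      (N : ℝ) / DivisorMajorant.Wbar C₁ N < M' →
      (M' : ℝ) ≤ c * ((N : ℝ) / DivisorMajorant.Wbar C₁ N) →
      ∀ r : ℕ, 1 ≤ r →
      ∀ b : Fin r → ℕ, (∀ i, 1 ≤ b i ∧ b i ≤ DivisorMajorant.Wbar C₁ N) →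
      ∀ d t : ℕ, 1 ≤ d → d ≤ D → 1 ≤ t → t ≤ D →
      ∀ Ψ : Fin t → DivisorMajorant.AffineForm d, DivisorMajorant.FiniteComplexity Ψ →
      (∀ j k, |(Ψ j).coeff k| ≤ (D : ℤ)) →
      |(∑ n : Fin d → ZMod M', ∏ j,
          DivisorMajorant.nuStar γ C C₁ N b M' ((Ψ j).eval n)) / (M' : ℝ) ^ d - 1| ≤ ε) := by
  have hE1 := DivisorMajorant.one_le_errorExponent D
  have hE0 : 0 < DivisorMajorant.errorExponent D := by linarith
  -- `γ₀` makes `γ` and the exponent `errorExponent D * γ` of the error terms at most `1 / 12`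
  refine ⟨DivisorMajorant.averageExponent D, 4, 1 / (12 * DivisorMajorant.errorExponent D),
    by positivity, ?_⟩
  intro γ hγ hγ0 C hC
  have hEγ : DivisorMajorant.errorExponent D * γ ≤ 1 / 12 := by
    rw [le_div_iff₀ (by positivity)] at hγ0
    linarith
  have hγ1 : γ ≤ 1 / 12 := by nlinarith
  refine ⟨fun ε hε => ?_, fun C₁ _ ε hε => ?_, fun C₁ hC₁ c ε hε => ?_⟩
  · filter_upwards [DivisorMajorant.eventually_abs_latticeAverage_sub_one_le D hγ hγ1 hC hε]
      with N hN
    intro d t hd1 hdD _ htD Ψ hΨ K hK hKb _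
    refine hN d t hd1 hdD htD Ψ (fun p hp hwp => ?_) K hK hKb
    exact DivisorMajorant.unexceptional_of_not_isExceptional fun h => (hΨ p hp h).not_gt hwp
  · filter_upwards [DivisorMajorant.eventually_abs_latticeAverage_sub_one_le D hγ hγ1 hC hε,
      DivisorMajorant.eventually_unexceptional_affine_Wbar D C₁] with N hN hunex
    intro d t hd1 hdD _ htD b _ idx Ψ hΨ hcoef K hK hKb _
    have hW1 : (1 : ℝ) ≤ DivisorMajorant.Wbar C₁ N := by
      exact_mod_cast DivisorMajorant.one_le_Wbar C₁ N
    have h := hN d t hd1 hdD htD _ (hunex d t Ψ hΨ hcoef fun j => (b (idx j) : ℤ)) K hK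
      fun x hx k => (hKb x hx k).trans (div_le_self (Nat.cast_nonneg N) hW1)
    simpa only [DivisorMajorant.AffineForm.eval_affine, Int.cast_id] using h
  · filter_upwards [DivisorMajorant.eventually_abs_sum_nuStar_div_sub_one_le D hγ hγ1
      (by linarith) hC (by linarith : 0 ≤ C₁) c hε] with N hN
    intro M' _ hM hMc r hr b _ d t hd1 hdD _ htD Ψ hΨ hcoef
    exact hN M' hM hMc r hr b d t hd1 hdD htD Ψ hΨ hcoef
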